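/- Let $E$ be the topos of sheaves on a small site; all rings are sheaves of commutative unital rings on that site. Let $A$ be a ring, $B$ an $A$-algebra and $M$ a $B$-module. A *crossed ring* $f:N\to R$ is an $R$-linear homomorphism of non-unital commutative algebras, where $R$ is a ring and $N$ is an $R$-module and non-unital commutative algebra, with $xy=f(x)\cdot y$ for all $x,y\in N$. A *2-extension* of $B$ by $M$ is an exact sequence $\xi: 0\to M\xrightarrow{e} N\xrightarrow{f} R\xrightarrow{g} B\to 0$ with $f$ a crossed ring, $g$ a surjection of rings and $e$ an $R$-module homomorphism. It can be pulled back along a ring map $C\to B$ to $\xi|_C: 0\to M\to N\to R\times_B C\to C\to 0$. The trivial 2-extension $\overline 0$ is $0\to M= M\xrightarrow{0} B= B\to 0$. A *butterfly* $\xi\to\eta$ between 2-extensions $\xi$ and $\eta: 0\to M\xrightarrow{e'}N'\xrightarrow{f'}R'\xrightarrow{g'}B\to0$ inducing the identity on $M$ and $B$ (all such butterflies are invertible) is a ring $Q$ with ring maps $\rho:Q\to R$, $\pi:Q\to R'$ and additive maps $\iota:N\to Q$, $\kappa:N'\to Q$ which are $Q$-linear ($Q$ acting on $N$ via $\rho$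 and on $N'$ via $\pi$) such that $\rho\iota=f$, $\pi\kappa=-f'$, $\pi\iota=0$, $\iota e=\kappa e'$, $g\rho=g'\pi$, and $0\to N'\xrightarrow{\kappa}Q\xrightarrow{\rho}R\to0$ is exact. Morphisms of butterflies are ring maps commuting with the structure maps. The composite of butterflies $Q:\xi\to\xi'$, $Q':\xi'\to\xi''$ is $(Q\times_{R'}Q')/N'$. A *2-extension of $A$-algebras* of $B$ by $M$ is a 2-extension $\xi$ of $B$ by $M$ together with a butterfly $s_\xi:\xi|_A\to\overline 0$ inducing the identity on $M$ and $A$. Let $A\text{-alg}/B$ be the category of $A$-algebras over $B$ with the topology generated by the families $\{C_i\to D\}$ such that for every object $U$ of the site and every finite set $\Lambda\subseteq\Gamma(U,D)$ there are an index $i$ and a covering of $U$ over each member of which all elements of $\Lambda$ lift to sections of $C_i$. For two 2-extensions of $A$-algebras $\xi,\eta$ of $B$ by $M$, let $\underline{\mathrm{Isom}}(\xi,\eta)$ be the fibered category over $A\text{-alg}/B$ whose objects over $C$ are the butterflies $Q:\xi|_C\to\eta|_C$ inducing the identity on $M$ and $C$, together with an isomorphism $s_\eta\circ Q|_A\cong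 s_\xi$, and whose morphisms are the morphisms of butterflies compatible with these isomorphisms. Let $\mathcal D_M$ be the presheaf $C\mapsto \mathrm{Der}_A(C,M)$ on $A\text{-alg}/B$. **Proposition.** $\mathcal D_M$ is a sheaf, and for all 2-extensions $\xi,\eta$ of $A$-algebras of $B$ by $M$ the fibered category $\underline{\mathrm{Isom}}(\xi,\eta)$ is a stack in groupoids, is locally nonempty and locally connected, and is a gerbe banded by $\mathcal D_M$: for every object $Q$ over $C$, sending a derivation $d\in \mathrm{Der}_A(C,M)$ to $q\mapsto q+\kappa(e'(d(\bar q)))$, where $\bar q$ is the image of $q$ in $C$, is an isomorphism $\mathrm{Der}_A(C,M)\cong\mathrm{Aut}(Q)$, compatibly with pullback and with isomorphisms of objects. In particular $\underline{\mathrm{Split}}(\xi)=\underline{\mathrm{Isom}}(\xi,\overline 0)$, where $\overline 0$ has its trivial $A$-algebra structure, is a gerbe banded by $\mathcal D_M$. -/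

import Mathlib

open CategoryTheory Opposite
universe u
namespace Butterflies
variable {T : Type u} [SmallCategory T] {J : GrothendieckTopology T}

/-- Sheaves of commutative rings on a small site. -/
abbrev RingSheaf (J : GrothendieckTopology T) := Sheaf J CommRingCat.{u}

/-- Sections over an object of the site. -/
abbrev RingSheaf.Sec (R : RingSheaf J) (U : T) : Type u := R.obj.obj (op U)

/-- Restriction of sections. -/
def RingSheaf.res (R : RingSheaf J) {U V : T} (h : V ⟶ U) : R.Sec U →+* R.Sec V :=
  (R.obj.map h.op).hom

/-- The map on sections of a morphism of sheaves of rings. -/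
def ap {R S : RingSheaf J} (φ : R ⟶ S) (U : T) : R.Sec U →+* S.Sec U := (φ.hom.app (op U)).hom

theorem ap_res {R S : RingSheaf J} (φ : R ⟶ S) {U V : T} (h : V ⟶ U) (r : R.Sec U) :
    ap φ V (R.res h r) = S.res h (ap φ U r) :=
  congrArg (fun t => t.hom r) (φ.hom.naturality h.op)

@[simp] theorem ap_comp {R S S' : RingSheaf J} (φ : R ⟶ S) (ψ : S ⟶ S') (U : T) (r : R.Sec U) :
    ap (φ ≫ ψ) U r = ap ψ U (ap φ U r) := rfl

@[simp] theorem ap_id (R : RingSheaf J) (U : T) (r : R.Sec U) : ap (𝟙 R) U r = r := rfl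

theorem RingSheaf.res_id (R : RingSheaf J) (U : T) (r : R.Sec U) : R.res (𝟙 U) r = r :=
  congrArg (fun t => t.hom r) (R.obj.map_id (op U))

theorem RingSheaf.res_comp (R : RingSheaf J) {U V W : T} (h : V ⟶ U) (k : W ⟶ V) (r : R.Sec U) :
    R.res (k ≫ h) r = R.res k (R.res h r) :=
  congrArg (fun t => t.hom r) (R.obj.map_comp h.op k.op)

theorem ringHom_ext {R S : RingSheaf J} {φ ψ : R ⟶ S} (H : ∀ U r, ap φ U r = ap ψ U r) : φ = ψ := by
  apply ObjectProperty.hom_ext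
  ext U r
  exact H U.unop r

/-- `P` holds after restriction along the members of some covering sieve of `U`. -/
def Locally (J : GrothendieckTopology T) (U : T) (P : ∀ ⦃V : T⦄, (V ⟶ U) → Prop) : Prop :=
  ∃ S ∈ J U, ∀ ⦃V : T⦄ (h : V ⟶ U), S.arrows h → P h

theorem RingSheaf.isSheaf (R : RingSheaf J) : Presieve.IsSheaf J (R.obj ⋙ forget CommRingCat) :=
  (isSheaf_iff_isSheaf_of_type _ _).1 ((Presheaf.isSheaf_iff_isSheaf_forget J R.obj (forget _)).1 R.property)

theorem RingSheaf.eq_of_locally (R : RingSheaf J) {U : T} {r r' : R.Sec U}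
    (H : Locally J U fun _ h => R.res h r = R.res h r') : r = r' := by
  obtain ⟨S, hS, H⟩ := H
  exact (R.isSheaf S hS).isSeparatedFor.ext fun V h hh => H h hh

def fiberProdPresheaf {R S B : RingSheaf J} (φ : R ⟶ B) (ψ : S ⟶ B) : Tᵒᵖ ⥤ CommRingCat.{u} where
  obj U := CommRingCat.of (RingHom.eqLocus
    ((ap φ U.unop).comp (RingHom.fst (R.Sec U.unop) (S.Sec U.unop)))
    ((ap ψ U.unop).comp (RingHom.snd (R.Sec U.unop) (S.Sec U.unop))))
  map {U V} h := CommRingCat.ofHom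
    { toFun := fun x => ⟨(R.res h.unop x.1.1, S.res h.unop x.1.2), by
        have := x.2
        simp only [RingHom.mem_eqLocus, RingHom.comp_apply, RingHom.coe_fst, RingHom.coe_snd] at this ⊢
        rw [ap_res, ap_res, this]⟩
      map_one' := by ext <;> simp
      map_mul' := fun x y => by ext <;> simp
      map_zero' := by ext <;> simp
      map_add' := fun x y => by ext <;> simp }
  map_id U := by
    refine CommRingCat.hom_ext (RingHom.ext fun x => Subtype.ext (Prod.ext ?_ ?_))
    · exact R.res_id _ x.1.1
    · exact S.res_id _ x.1.2
  map_comp h k := by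
    refine CommRingCat.hom_ext (RingHom.ext fun x => Subtype.ext (Prod.ext ?_ ?_))
    · exact R.res_comp _ _ x.1.1
    · exact S.res_comp _ _ x.1.2

/-- The fibre product `R ×_B S` of sheaves of rings; its sections over `U` are the pairs
`(r, s)` with `φ r = ψ s`. -/
def fiberProd {R S B : RingSheaf J} (φ : R ⟶ B) (ψ : S ⟶ B) : RingSheaf J where
  obj := fiberProdPresheaf φ ψ
  property := by
    rw [Presheaf.isSheaf_iff_isSheaf_forget J _ (forget CommRingCat), isSheaf_iff_isSheaf_of_type]
    intro U Z hZ x hx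
    have h1 : Presieve.FamilyOfElements.Compatible (P := R.obj ⋙ forget CommRingCat)
        (fun V h hh => (x h hh).1.1 : Presieve.FamilyOfElements _ Z.arrows) := by
      intro V V' W g g' f f' hf hf' e
      exact congrArg (fun t => t.1.1) (hx g g' hf hf' e)
    have h2 : Presieve.FamilyOfElements.Compatible (P := S.obj ⋙ forget CommRingCat)
        (fun V h hh => (x h hh).1.2 : Presieve.FamilyOfElements _ Z.arrows) := by
      intro V V' W g g' f f' hf hf' e
      exact congrArg (fun t => t.1.2) (hx g g' hf hf' e)
    obtain ⟨r, hr, -⟩ := R.isSheaf Z hZ _ h1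
    obtain ⟨s, hs, -⟩ := S.isSheaf Z hZ _ h2
    have key : ap φ U r = ap ψ U s := by
      refine B.eq_of_locally ⟨Z, hZ, fun V h hh => ?_⟩
      change B.res h (ap φ U r) = B.res h (ap ψ U s)
      rw [← ap_res, ← ap_res]
      have e1 : R.res h r = (x h hh).1.1 := hr h hh
      have e2 : S.res h s = (x h hh).1.2 := hs h hh
      rw [e1, e2]
      exact (x h hh).2
    refine ⟨⟨(r, s), key⟩, fun V h hh => Subtype.ext (Prod.ext (hr h hh) (hs h hh)), ?_⟩
    intro y hy
    refine Subtype.ext (Prod.ext ?_ ?_)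
    · exact R.eq_of_locally ⟨Z, hZ, fun V h hh =>
        (congrArg (fun t => t.1.1) (hy h hh)).trans (hr h hh).symm⟩
    · exact S.eq_of_locally ⟨Z, hZ, fun V h hh =>
        (congrArg (fun t => t.1.2) (hy h hh)).trans (hs h hh).symm⟩

namespace fiberProd
variable {R S B : RingSheaf J} (φ : R ⟶ B) (ψ : S ⟶ B)

def fst : fiberProd φ ψ ⟶ R :=
  ⟨{ app := fun U => CommRingCat.ofHom ((RingHom.fst _ _).comp (Subring.subtype _)) }⟩

def snd : fiberProd φ ψ ⟶ S :=
  ⟨{ app := fun U => CommRingCat.ofHom ((RingHom.snd _ _).comp (Subring.subtype _)) }⟩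

variable {φ ψ}

/-- The section of the fibre product given by a pair of sections. -/
def mk {U : T} (r : R.Sec U) (s : S.Sec U) (H : ap φ U r = ap ψ U s) : (fiberProd φ ψ).Sec U :=
  ⟨(r, s), H⟩

@[simp] theorem fst_mk {U : T} (r : R.Sec U) (s : S.Sec U) (H : ap φ U r = ap ψ U s) :
    ap (fst φ ψ) U (mk r s H) = r := rfl

@[simp] theorem snd_mk {U : T} (r : R.Sec U) (s : S.Sec U) (H : ap φ U r = ap ψ U s) :
    ap (snd φ ψ) U (mk r s H) = s := rfl

theorem ext {U : T} {x y : (fiberProd φ ψ).Sec U} (h1 : ap (fst φ ψ) U x = ap (fst φ ψ) U y)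
    (h2 : ap (snd φ ψ) U x = ap (snd φ ψ) U y) : x = y :=
  Subtype.ext (Prod.ext h1 h2)

theorem condition : fst φ ψ ≫ φ = snd φ ψ ≫ ψ := ringHom_ext fun _ x => x.2

def lift {Q : RingSheaf J} (a : Q ⟶ R) (b : Q ⟶ S) (H : a ≫ φ = b ≫ ψ) : Q ⟶ fiberProd φ ψ :=
  ⟨{ app := fun U => CommRingCat.ofHom
      { toFun := fun q => mk (φ := φ) (ψ := ψ) (ap a U.unop q) (ap b U.unop q)
          (congrArg (fun t => ap t U.unop q) H)
        map_one' := Subtype.ext (Prod.ext (map_one _) (map_one _))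
        map_mul' := fun x y => Subtype.ext (Prod.ext (map_mul _ x y) (map_mul _ x y))
        map_zero' := Subtype.ext (Prod.ext (map_zero _) (map_zero _))
        map_add' := fun x y => Subtype.ext (Prod.ext (map_add _ x y) (map_add _ x y)) }
     naturality := fun U V h => by
      ext q
      exact ext (ap_res a h.unop q) (ap_res b h.unop q) }⟩

@[simp] theorem lift_fst {Q : RingSheaf J} (a : Q ⟶ R) (b : Q ⟶ S)
    (H : a ≫ φ = b ≫ ψ) : lift a b H ≫ fst φ ψ = a := rfl

@[simp] theorem lift_snd {Q : RingSheaf J} (a : Q ⟶ R) (b : Q ⟶ S)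
    (H : a ≫ φ = b ≫ ψ) : lift a b H ≫ snd φ ψ = b := rfl

theorem hom_ext {Q : RingSheaf J} {a b : Q ⟶ fiberProd φ ψ} (h1 : a ≫ fst φ ψ = b ≫ fst φ ψ)
    (h2 : a ≫ snd φ ψ = b ≫ snd φ ψ) : a = b :=
  ringHom_ext fun U q => ext (congrArg (fun t => ap t U q) h1) (congrArg (fun t => ap t U q) h2)

end fiberProd

/-- A sheaf of modules over a sheaf of commutative rings: a sheaf of abelian groups whose sections
are modules over the sections of `R`, compatibly with restriction. -/
structure ModSheaf (R : RingSheaf J) where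
  ab : Sheaf J AddCommGrpCat.{u}
  module : ∀ U : T, Module (R.Sec U) (ab.obj.obj (op U))
  map_smul : ∀ {U V : T} (h : V ⟶ U) (r : R.Sec U) (m : ab.obj.obj (op U)),
    (ab.obj.map h.op).hom (r • m) = R.res h r • (ab.obj.map h.op).hom m

namespace ModSheaf

/-- Sections over an object of the site. -/
abbrev Sec {R : RingSheaf J} (M : ModSheaf R) (U : T) : Type u := M.ab.obj.obj (op U)

instance {R : RingSheaf J} (M : ModSheaf R) (U : T) : Module (R.Sec U) (M.Sec U) := M.module U

/-- Restriction of sections. -/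
def res {R : RingSheaf J} (M : ModSheaf R) {U V : T} (h : V ⟶ U) : M.Sec U →+ M.Sec V :=
  (M.ab.obj.map h.op).hom

theorem res_smul {R : RingSheaf J} (M : ModSheaf R) {U V : T} (h : V ⟶ U) (r : R.Sec U)
    (m : M.Sec U) : M.res h (r • m) = R.res h r • M.res h m := M.map_smul h r m

theorem res_id {R : RingSheaf J} (M : ModSheaf R) (U : T) (r : M.Sec U) : M.res (𝟙 U) r = r :=
  congrArg (fun t => t.hom r) (M.ab.obj.map_id (op U))

theorem res_comp {R : RingSheaf J} (M : ModSheaf R) {U V W : T} (h : V ⟶ U) (k : W ⟶ V)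
    (r : M.Sec U) : M.res (k ≫ h) r = M.res k (M.res h r) :=
  congrArg (fun t => t.hom r) (M.ab.obj.map_comp h.op k.op)

/-- Restriction of scalars along a morphism of sheaves of rings. -/
abbrev restrict {R S : RingSheaf J} (M : ModSheaf R) (φ : S ⟶ R) : ModSheaf S where
  ab := M.ab
  module U := Module.compHom (M.Sec U) (ap φ U)
  map_smul h s m := by
    change M.res h (ap φ _ s • m) = ap φ _ (S.res h s) • M.res h m
    rw [ap_res]
    exact M.map_smul h _ m

end ModSheaf

/-- A crossed ring `f : N → R`: a sheaf of commutative rings `R`, an `R`-module `N` with the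
structure of a non-unital commutative `R`-algebra, and an `R`-linear multiplicative map `f` with
`x y = f(x) • y`. -/
structure CrossedRing (J : GrothendieckTopology T) where
  R : RingSheaf J
  N : ModSheaf R
  mul : ∀ U : T, N.Sec U → N.Sec U → N.Sec U
  mul_comm : ∀ U x y, mul U x y = mul U y x
  mul_assoc : ∀ U x y z, mul U (mul U x y) z = mul U x (mul U y z)
  add_mul : ∀ U x y z, mul U (x + y) z = mul U x z + mul U y z
  smul_mul : ∀ U (r : R.Sec U) x y, mul U (r • x) y = r • mul U x y
  res_mul : ∀ {U V : T} (h : V ⟶ U) x y, N.res h (mul U x y) = mul V (N.res h x) (N.res h y)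
  f : ∀ U : T, N.Sec U →ₗ[R.Sec U] R.Sec U
  f_res : ∀ {U V : T} (h : V ⟶ U) x, f V (N.res h x) = R.res h (f U x)
  f_mul : ∀ U x y, f U (mul U x y) = f U x * f U y
  crossed : ∀ U x y, mul U x y = f U x • y

/-- A 2-extension `0 → M → N → R → B → 0` of the sheaf of rings `B` by the `B`-module `M`: an exact
sequence with `f : N → R` a crossed ring, `g : R → B` a surjection of rings and `e : M → N` linear
over `R`. -/
structure TwoExt (B : RingSheaf J) (M : ModSheaf B) extends CrossedRing J where
  g : R ⟶ B
  e : ∀ U : T, M.Sec U →+ N.Sec U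
  e_res : ∀ {U V : T} (h : V ⟶ U) m, e V (M.res h m) = N.res h (e U m)
  e_smul : ∀ U (r : R.Sec U) (m : M.Sec U), e U (ap g U r • m) = r • e U m
  e_injective : ∀ U, Function.Injective (e U)
  exact_N : ∀ U (n : N.Sec U), f U n = 0 ↔ ∃ m, e U m = n
  exact_R : ∀ U (r : R.Sec U), ap g U r = 0 ↔
    Locally J U fun V h => ∃ n : N.Sec V, f V n = R.res h r
  g_surjective : ∀ U (b : B.Sec U), Locally J U fun V h => ∃ r : R.Sec V, ap g V r = B.res h b

theorem Locally.mono {U : T} {P Q : ∀ ⦃V : T⦄, (V ⟶ U) → Prop} (H : Locally J U P)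
    (HPQ : ∀ ⦃V⦄ (h : V ⟶ U), P h → Q h) : Locally J U Q := by
  obtain ⟨S, hS, H⟩ := H
  exact ⟨S, hS, fun V h hh => HPQ h (H h hh)⟩

theorem Locally.of_forall {U : T} {P : ∀ ⦃V : T⦄, (V ⟶ U) → Prop}
    (H : ∀ ⦃V⦄ (h : V ⟶ U), P h) : Locally J U P :=
  ⟨⊤, J.top_mem U, fun _ h _ => H h⟩

namespace TwoExt
variable {B : RingSheaf J} {M : ModSheaf B}

/-- The pullback `0 → M → N → R ×_B C → C → 0` of a 2-extension along `h : C → B`. -/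
abbrev pullback (ξ : TwoExt B M) {C : RingSheaf J} (h : C ⟶ B) : TwoExt C (M.restrict h) where
  R := fiberProd ξ.g h
  N := ξ.N.restrict (fiberProd.fst ξ.g h)
  mul := ξ.mul
  mul_comm := ξ.mul_comm
  mul_assoc := ξ.mul_assoc
  add_mul := ξ.add_mul
  smul_mul U r x y := ξ.smul_mul U (ap (fiberProd.fst ξ.g h) U r) x y
  res_mul := ξ.res_mul
  f U :=
    { toFun := fun n => fiberProd.mk (ξ.f U n) 0 (by
        rw [map_zero, ξ.exact_R]
        exact Locally.of_forall fun V k => ⟨ξ.N.res k n, ξ.f_res k n⟩)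
      map_add' := fun x y => fiberProd.ext ((ξ.f U).map_add x y) (add_zero _).symm
      map_smul' := fun r x => fiberProd.ext
        ((ξ.f U).map_smul (ap (fiberProd.fst ξ.g h) U r) x) (mul_zero _).symm }
  f_res k x := fiberProd.ext (ξ.f_res k x) (map_zero (C.res k)).symm
  f_mul U x y := fiberProd.ext (ξ.f_mul U x y) (mul_zero _).symm
  crossed U x y := ξ.crossed U x y
  g := fiberProd.snd ξ.g h
  e := ξ.e
  e_res := ξ.e_res
  e_smul U r m := by
    refine Eq.trans ?_ (ξ.e_smul U (ap (fiberProd.fst ξ.g h) U r) m)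
    exact congrArg (fun b : B.Sec U => ξ.e U (b • (show M.Sec U from m))) r.2.symm
  e_injective := ξ.e_injective
  exact_N U n := by
    rw [← ξ.exact_N U n]
    exact ⟨fun H => congrArg (ap (fiberProd.fst ξ.g h) U) H, fun H => fiberProd.ext H rfl⟩
  exact_R U r := by
    constructor
    · intro H
      have h1 : ap ξ.g U (ap (fiberProd.fst ξ.g h) U r) = 0 := by
        have := r.2
        refine Eq.trans this ?_
        refine Eq.trans ?_ (map_zero (ap h U))
        exact congrArg (ap h U) H
      refine ((ξ.exact_R U _).1 h1).mono ?_
      rintro V k ⟨n, hn⟩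
      refine ⟨n, fiberProd.ext (hn.trans (ap_res _ _ _).symm) ?_⟩
      refine Eq.trans ?_ (ap_res (fiberProd.snd ξ.g h) k r).symm
      rw [H]
      exact (map_zero (C.res k)).symm
    · intro H
      refine C.eq_of_locally (H.mono ?_)
      rintro V k ⟨n, hn⟩
      refine (ap_res (fiberProd.snd ξ.g h) k r).symm.trans ?_
      rw [← hn]
      exact (map_zero (C.res k)).symm
  g_surjective U c := by
    refine (ξ.g_surjective U (ap h U c)).mono ?_
    rintro V k ⟨r, hr⟩
    exact ⟨fiberProd.mk r (C.res k c) (hr.trans (ap_res _ _ _).symm), rfl⟩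

/-- The trivial 2-extension `0 → M = M → B = B → 0`, with zero map in the middle. -/
abbrev trivial (B : RingSheaf J) (M : ModSheaf B) : TwoExt B M where
  R := B
  N := M
  mul _ _ _ := 0
  mul_comm _ _ _ := rfl
  mul_assoc _ _ _ _ := rfl
  add_mul _ _ _ _ := (add_zero _).symm
  smul_mul _ _ _ _ := (smul_zero _).symm
  res_mul h _ _ := map_zero (M.res h)
  f _ := 0
  f_res h _ := (map_zero (B.res h)).symm
  f_mul _ _ _ := (mul_zero _).symm
  crossed _ _ _ := (zero_smul _ _).symm
  g := 𝟙 B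
  e U := AddMonoidHom.id _
  e_res _ _ := rfl
  e_smul _ _ _ := rfl
  e_injective _ := Function.injective_id
  exact_N U n := ⟨fun _ => ⟨n, rfl⟩, fun _ => rfl⟩
  exact_R U r := by
    constructor
    · intro H
      refine Locally.of_forall fun V k => ⟨0, ?_⟩
      rw [show r = 0 from H]
      exact (map_zero (B.res k)).symm
    · intro H
      refine B.eq_of_locally (H.mono ?_)
      rintro V k ⟨n, hn⟩
      exact hn.symm.trans (map_zero (B.res k)).symm
  g_surjective U b := Locally.of_forall fun V k => ⟨B.res k b, rfl⟩

end TwoExt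

/-- A butterfly `ξ → η` between 2-extensions of `B` by `M` which restricts to the identities of `M`
and `B` (these are exactly the invertible butterflies that are 1-morphisms between 2-extensions of
`B` by `M`).

The middle term is a ring `Q`, with maps `ι : N → Q` (north-west), `κ : N' → Q` (south-west),
`ρ : Q → R` (north-east) and `π : Q → R'` (south-east). The triangle `N' → Q → R'` anticommutes and
all the rest commutes. The crossed ring structures of `ι` and `κ` are induced from those of `N` and
`N'`: `Q` acts on `N` through `ρ` and on `N'` through `π`, and `ι`, `κ` are linear over `Q`. -/
structure Butterfly {B : RingSheaf J} {M : ModSheaf B} (ξ η : TwoExt B M) where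
  Q : RingSheaf J
  ι : ∀ U : T, ξ.N.Sec U →+ Q.Sec U
  κ : ∀ U : T, η.N.Sec U →+ Q.Sec U
  ρ : Q ⟶ ξ.R
  π : Q ⟶ η.R
  ι_res : ∀ {U V : T} (h : V ⟶ U) n, ι V (ξ.N.res h n) = Q.res h (ι U n)
  κ_res : ∀ {U V : T} (h : V ⟶ U) n, κ V (η.N.res h n) = Q.res h (κ U n)
  ι_smul : ∀ U (q : Q.Sec U) (n : ξ.N.Sec U), ι U (ap ρ U q • n) = q * ι U n
  κ_smul : ∀ U (q : Q.Sec U) (n : η.N.Sec U), κ U (ap π U q • n) = q * κ U n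
  ρ_ι : ∀ U n, ap ρ U (ι U n) = ξ.f U n
  π_κ : ∀ U n, ap π U (κ U n) = - η.f U n
  π_ι : ∀ U n, ap π U (ι U n) = 0
  ι_e : ∀ U m, ι U (ξ.e U m) = κ U (η.e U m)
  ρ_g : ρ ≫ ξ.g = π ≫ η.g
  κ_injective : ∀ U, Function.Injective (κ U)
  exact_Q : ∀ U (q : Q.Sec U), ap ρ U q = 0 ↔ ∃ n, κ U n = q
  ρ_surjective : ∀ U (r : ξ.R.Sec U), Locally J U fun V h => ∃ q : Q.Sec V, ap ρ V q = ξ.R.res h r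

namespace Butterfly
variable {B : RingSheaf J} {M : ModSheaf B}

/-- A morphism of butterflies: a ring map of the middle terms that commutes with all four
structure maps. -/
@[ext] structure Hom {ξ η : TwoExt B M} (X Y : Butterfly ξ η) where
  φ : X.Q ⟶ Y.Q
  φ_ι : ∀ U n, ap φ U (X.ι U n) = Y.ι U n
  φ_κ : ∀ U n, ap φ U (X.κ U n) = Y.κ U n
  φ_ρ : φ ≫ Y.ρ = X.ρ
  φ_π : φ ≫ Y.π = X.π

/-- A morphism from the composite `(X.Q ×_{R'} Y.Q) / N'` of the butterflies `X : ξ → ξ'` and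
`Y : ξ' → ξ''` to a butterfly `Z : ξ → ξ''`. Here `N'` is embedded as the ideal of the elements
`(κ n, - ι n)` and the structure maps of the composite are `n ↦ (ι n, 0)`, `n ↦ (0, κ n)`,
`(x, y) ↦ ρ x` and `(x, y) ↦ π y`. By the universal property of the quotient sheaf, such a morphism
is a ring map on `X.Q ×_{R'} Y.Q` which kills `N'` and commutes with the structure maps. (As for all
morphisms of butterflies, it is automatically an isomorphism.) -/
@[ext] structure CompHom {ξ ξ' ξ'' : TwoExt B M} (X : Butterfly ξ ξ') (Y : Butterfly ξ' ξ'')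
    (Z : Butterfly ξ ξ'') where
  α : fiberProd X.π Y.ρ ⟶ Z.Q
  α_zero : ∀ U (n : ξ'.N.Sec U), ap α U (fiberProd.mk (X.κ U n) (- Y.ι U n)
    (by rw [X.π_κ, map_neg, Y.ρ_ι])) = 0
  α_ι : ∀ U (n : ξ.N.Sec U), ap α U (fiberProd.mk (X.ι U n) 0 (by rw [X.π_ι, map_zero])) = Z.ι U n
  α_κ : ∀ U (n : ξ''.N.Sec U), ap α U (fiberProd.mk 0 (Y.κ U n)
    (by rw [map_zero, (Y.exact_Q U _).2 ⟨n, rfl⟩])) = Z.κ U n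
  α_ρ : α ≫ Z.ρ = fiberProd.fst X.π Y.ρ ≫ X.ρ
  α_π : α ≫ Z.π = fiberProd.snd X.π Y.ρ ≫ Y.π

end Butterfly


namespace fiberProd

/-- Functoriality of the fibre product in the first factor. -/
def mapLeft {R R' S B : RingSheaf J} {φ : R ⟶ B} {φ' : R' ⟶ B} {ψ : S ⟶ B} (a : R ⟶ R')
    (H : a ≫ φ' = φ) : fiberProd φ ψ ⟶ fiberProd φ' ψ :=
  lift (fst φ ψ ≫ a) (snd φ ψ) (by rw [Category.assoc, H, condition])

end fiberProd

namespace Butterfly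
variable {B C C' : RingSheaf J} {M : ModSheaf B} {ξ η : TwoExt B M} {h : C ⟶ B}

/-- The pullback `Q ×_C C'` along `k : C' → C` of a butterfly `Q : ξ|_C → η|_C`, as a butterfly
`ξ|_{C'} → η|_{C'}`. -/
abbrev restrict (X : Butterfly (ξ.pullback h) (η.pullback h)) (k : C' ⟶ C) (h' : C' ⟶ B)
    (w : k ≫ h = h') : Butterfly (ξ.pullback h') (η.pullback h') where
  Q := fiberProd (X.ρ ≫ (ξ.pullback h).g) k
  ι U :=
    { toFun := fun n => fiberProd.mk (X.ι U n) 0 (by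
        rw [map_zero, ap_comp, X.ρ_ι]; rfl)
      map_zero' := fiberProd.ext (map_zero (X.ι U)) rfl
      map_add' := fun x y => fiberProd.ext (map_add (X.ι U) x y) (add_zero _).symm }
  κ U :=
    { toFun := fun n => fiberProd.mk (X.κ U n) 0 (by
        rw [map_zero, X.ρ_g, ap_comp, X.π_κ, map_neg]; exact neg_zero)
      map_zero' := fiberProd.ext (map_zero (X.κ U)) rfl
      map_add' := fun x y => fiberProd.ext (map_add (X.κ U) x y) (add_zero _).symm }
  ρ := fiberProd.lift (fiberProd.fst _ _ ≫ X.ρ ≫ fiberProd.fst _ _) (fiberProd.snd _ _) (by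
    rw [← w, Category.assoc, Category.assoc, fiberProd.condition, ← Category.assoc (fiberProd.snd _ k),
      ← fiberProd.condition (φ := X.ρ ≫ (ξ.pullback h).g)]
    simp only [Category.assoc])
  π := fiberProd.lift (fiberProd.fst _ _ ≫ X.π ≫ fiberProd.fst _ _) (fiberProd.snd _ _) (by
    rw [← w, Category.assoc, Category.assoc, fiberProd.condition, ← Category.assoc (fiberProd.snd _ k),
      ← fiberProd.condition (φ := X.ρ ≫ (ξ.pullback h).g), X.ρ_g]
    simp only [Category.assoc])
  ι_res t n := fiberProd.ext (X.ι_res t n) (map_zero (C'.res t)).symm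
  κ_res t n := fiberProd.ext (X.κ_res t n) (map_zero (C'.res t)).symm
  ι_smul U q n := fiberProd.ext (X.ι_smul U (ap (fiberProd.fst _ _) U q) n) (mul_zero _).symm
  κ_smul U q n := fiberProd.ext (X.κ_smul U (ap (fiberProd.fst _ _) U q) n) (mul_zero _).symm
  ρ_ι U n := fiberProd.ext (congrArg (ap (fiberProd.fst ξ.g h) U) (X.ρ_ι U n)) rfl
  π_κ U n := fiberProd.ext (congrArg (ap (fiberProd.fst η.g h) U) (X.π_κ U n)) neg_zero.symm
  π_ι U n := fiberProd.ext (congrArg (ap (fiberProd.fst η.g h) U) (X.π_ι U n)) rfl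
  ι_e U m := fiberProd.ext (X.ι_e U m) rfl
  ρ_g := rfl
  κ_injective U x y H := X.κ_injective U (congrArg (ap (fiberProd.fst _ _) U) H)
  exact_Q U q := by
    constructor
    · intro H
      have h2 : ap (fiberProd.snd _ k) U q = 0 := congrArg (ap (fiberProd.snd ξ.g h') U) H
      have h1 : ap X.ρ U (ap (fiberProd.fst _ k) U q) = 0 := by
        refine fiberProd.ext (congrArg (ap (fiberProd.fst ξ.g h') U) H) ?_
        refine Eq.trans (show _ = ap k U (ap (fiberProd.snd _ k) U q) from q.2) ?_
        rw [h2, map_zero, map_zero]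
      obtain ⟨n, hn⟩ := (X.exact_Q U _).1 h1
      exact ⟨n, fiberProd.ext hn h2.symm⟩
    · rintro ⟨n, rfl⟩
      exact fiberProd.ext
        (congrArg (ap (fiberProd.fst ξ.g h) U) ((X.exact_Q U _).2 ⟨n, rfl⟩)) rfl
  ρ_surjective U r := by
    have hr : ap ξ.g U (ap (fiberProd.fst _ _) U r) = ap h U (ap k U (ap (fiberProd.snd _ _) U r)) := by
      subst w
      exact r.2
    refine (X.ρ_surjective U (fiberProd.mk _ _ hr)).mono ?_
    rintro V t ⟨q, hq⟩
    refine ⟨fiberProd.mk q (C'.res t (ap (fiberProd.snd _ _) U r)) ?_, fiberProd.ext ?_ rfl⟩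
    · rw [ap_comp, hq, ap_res]
      exact (ap_res k t _).symm
    · exact congrArg (ap (fiberProd.fst ξ.g h) V) hq

end Butterfly

namespace fiberProd

theorem mapLeft_fst {R R' S B : RingSheaf J} {φ : R ⟶ B} {φ' : R' ⟶ B} {ψ : S ⟶ B} (a : R ⟶ R')
    (H : a ≫ φ' = φ) : mapLeft (ψ := ψ) a H ≫ fst φ' ψ = fst φ ψ ≫ a := lift_fst _ _ _

theorem mapLeft_snd {R R' S B : RingSheaf J} {φ : R ⟶ B} {φ' : R' ⟶ B} {ψ : S ⟶ B} (a : R ⟶ R')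
    (H : a ≫ φ' = φ) : mapLeft (ψ := ψ) a H ≫ snd φ' ψ = snd φ ψ := lift_snd _ _ _

end fiberProd

namespace Butterfly
variable {B C C' : RingSheaf J} {M : ModSheaf B} {ξ η : TwoExt B M} {h : C ⟶ B}

instance (ξ η : TwoExt B M) : Category (Butterfly ξ η) where
  Hom X Y := Hom X Y
  id X := ⟨𝟙 X.Q, fun _ _ => rfl, fun _ _ => rfl, Category.id_comp _, Category.id_comp _⟩
  comp {X Y Z} f g := ⟨f.φ ≫ g.φ,
    fun U n => (congrArg (ap g.φ U) (f.φ_ι U n)).trans (g.φ_ι U n),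
    fun U n => (congrArg (ap g.φ U) (f.φ_κ U n)).trans (g.φ_κ U n),
    by rw [Category.assoc, g.φ_ρ, f.φ_ρ], by rw [Category.assoc, g.φ_π, f.φ_π]⟩

@[ext] theorem hom_ext {ξ η : TwoExt B M} {X Y : Butterfly ξ η} {f g : X ⟶ Y} (H : f.φ = g.φ) :
    f = g := Hom.ext H

@[simp] theorem id_φ {ξ η : TwoExt B M} (X : Butterfly ξ η) : Hom.φ (𝟙 X) = 𝟙 X.Q := rfl

@[simp] theorem comp_φ {ξ η : TwoExt B M} {X Y Z : Butterfly ξ η} (f : X ⟶ Y) (g : Y ⟶ Z) :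
    (f ≫ g).φ = f.φ ≫ g.φ := rfl

/-- The pullback of a morphism of butterflies. -/
def restrictMap {X Y : Butterfly (ξ.pullback h) (η.pullback h)} (f : X ⟶ Y) (k : C' ⟶ C)
    (h' : C' ⟶ B) (w : k ≫ h = h') : X.restrict k h' w ⟶ Y.restrict k h' w where
  φ := fiberProd.mapLeft f.φ (by rw [← Category.assoc, f.φ_ρ])
  φ_ι U n := fiberProd.ext (f.φ_ι U n) rfl
  φ_κ U n := fiberProd.ext (f.φ_κ U n) rfl
  φ_ρ := ringHom_ext fun U q => by
    refine fiberProd.ext ?_ ?_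
    · exact congrArg (fun t => ap (fiberProd.fst ξ.g h) U
        (ap t U (ap (fiberProd.fst _ k) U q))) f.φ_ρ
    · rfl
  φ_π := ringHom_ext fun U q => by
    refine fiberProd.ext ?_ ?_
    · exact congrArg (fun t => ap (fiberProd.fst η.g h) U
        (ap t U (ap (fiberProd.fst _ k) U q))) f.φ_π
    · rfl

/-- The projection `Q ×_C C → Q`. -/
def restrictIdHom (X : Butterfly (ξ.pullback h) (η.pullback h)) (w : 𝟙 C ≫ h = h) :
    X.restrict (𝟙 C) h w ⟶ X where
  φ := fiberProd.fst _ _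
  φ_ι := fun _ _ => rfl
  φ_κ := fun _ _ => rfl
  φ_ρ := ringHom_ext fun _ q => fiberProd.ext rfl q.2
  φ_π := ringHom_ext fun U q => fiberProd.ext rfl
    ((congrArg (fun t => ap t U (ap (fiberProd.fst _ (𝟙 C)) U q)) X.ρ_g.symm).trans q.2)

/-- The inverse `Q → Q ×_C C` of the projection. -/
def restrictIdInv (X : Butterfly (ξ.pullback h) (η.pullback h)) (w : 𝟙 C ≫ h = h) :
    X ⟶ X.restrict (𝟙 C) h w where
  φ := fiberProd.lift (𝟙 _) (X.ρ ≫ (ξ.pullback h).g) rfl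
  φ_ι := fun U n => fiberProd.ext rfl
    (congrArg (ap (fiberProd.snd ξ.g h) U) (X.ρ_ι U n))
  φ_κ := fun U n => fiberProd.ext rfl
    (congrArg (ap (fiberProd.snd ξ.g h) U) ((X.exact_Q U _).2 ⟨n, rfl⟩))
  φ_ρ := ringHom_ext fun _ _ => by
    refine fiberProd.ext ?_ ?_ <;> rfl
  φ_π := ringHom_ext fun U q => fiberProd.ext rfl (congrArg (fun t => ap t U q) X.ρ_g)

/-- The canonical isomorphism `Q ×_C C ≅ Q`. -/
def restrictId (X : Butterfly (ξ.pullback h) (η.pullback h)) (w : 𝟙 C ≫ h = h) :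
    X.restrict (𝟙 C) h w ≅ X where
  hom := X.restrictIdHom w
  inv := X.restrictIdInv w
  hom_inv_id := hom_ext (ringHom_ext fun _ q => fiberProd.ext rfl q.2)
  inv_hom_id := hom_ext (ringHom_ext fun _ _ => rfl)

section
variable {C'' : RingSheaf J} (X : Butterfly (ξ.pullback h) (η.pullback h)) (k : C' ⟶ C)
    (h' : C' ⟶ B) (w : k ≫ h = h') (k' : C'' ⟶ C') (h'' : C'' ⟶ B) (w' : k' ≫ h' = h'')
    (l : C'' ⟶ C) (hl : k' ≫ k = l) (wl : l ≫ h = h'')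

/-- The canonical map `(Q ×_C C') ×_{C'} C'' → Q ×_C C''`. -/
def restrictCompHom : (X.restrict k h' w).restrict k' h'' w' ⟶ X.restrict l h'' wl where
  φ := fiberProd.lift (fiberProd.fst _ _ ≫ fiberProd.fst _ _) (fiberProd.snd _ _)
    (ringHom_ext fun U q => by
      subst hl
      exact (show _ = ap k U _ from q.1.1.2).trans (congrArg (ap k U) q.2))
  φ_ι := fun _ _ => rfl
  φ_κ := fun _ _ => rfl
  φ_ρ := ringHom_ext fun _ _ => by
    refine fiberProd.ext ?_ ?_ <;> rfl
  φ_π := ringHom_ext fun _ _ => by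
    refine fiberProd.ext ?_ ?_ <;> rfl

/-- The inverse `Q ×_C C'' → (Q ×_C C') ×_{C'} C''` of the canonical map. -/
def restrictCompInv : X.restrict l h'' wl ⟶ (X.restrict k h' w).restrict k' h'' w' where
  φ := fiberProd.lift (fiberProd.lift (fiberProd.fst _ _) (fiberProd.snd _ _ ≫ k') (by
    subst hl; rw [fiberProd.condition, Category.assoc])) (fiberProd.snd _ _) rfl
  φ_ι := fun U n => fiberProd.ext (fiberProd.ext rfl (map_zero (ap k' U))) rfl
  φ_κ := fun U n => fiberProd.ext (fiberProd.ext rfl (map_zero (ap k' U))) rfl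
  φ_ρ := ringHom_ext fun _ _ => by
    refine fiberProd.ext ?_ ?_ <;> rfl
  φ_π := ringHom_ext fun _ _ => by
    refine fiberProd.ext ?_ ?_ <;> rfl

/-- The canonical isomorphism `(Q ×_C C') ×_{C'} C'' ≅ Q ×_C C''`. -/
def restrictComp : (X.restrict k h' w).restrict k' h'' w' ≅ X.restrict l h'' wl where
  hom := X.restrictCompHom k h' w k' h'' w' l hl wl
  inv := X.restrictCompInv k h' w k' h'' w' l hl wl
  hom_inv_id := hom_ext (ringHom_ext fun _ q => fiberProd.ext (fiberProd.ext rfl q.2.symm) rfl)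
  inv_hom_id := hom_ext (ringHom_ext fun _ _ => by
    refine fiberProd.ext ?_ ?_ <;> rfl)

end

/-- Precomposition of a morphism out of a composite with a morphism in the first factor. -/
def CompHom.precomp {ξ ξ' ξ'' : TwoExt B M} {X X' : Butterfly ξ ξ'} {Y : Butterfly ξ' ξ''}
    {Z : Butterfly ξ ξ''} (c : CompHom X' Y Z) (f : X ⟶ X') : CompHom X Y Z where
  α := fiberProd.mapLeft f.φ f.φ_π ≫ c.α
  α_zero U n := by
    rw [← c.α_zero U n]
    exact congrArg (ap c.α U) (fiberProd.ext (f.φ_κ U n) rfl)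
  α_ι U n := by
    rw [← c.α_ι U n]
    exact congrArg (ap c.α U) (fiberProd.ext (f.φ_ι U n) rfl)
  α_κ U n := by
    rw [← c.α_κ U n]
    exact congrArg (ap c.α U) (fiberProd.ext (map_zero (ap f.φ U)) rfl)
  α_ρ := by
    rw [Category.assoc, c.α_ρ, ← f.φ_ρ]
    rfl
  α_π := by
    rw [Category.assoc, c.α_π]
    rfl

end Butterfly

namespace Butterfly
variable {B C C' C'' : RingSheaf J} {M : ModSheaf B} {ξ η : TwoExt B M} {h : C ⟶ B}

@[simp] theorem CompHom.precomp_id {ξ ξ' ξ'' : TwoExt B M} {X : Butterfly ξ ξ'}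
    {Y : Butterfly ξ' ξ''} {Z : Butterfly ξ ξ''} (c : CompHom X Y Z) : c.precomp (𝟙 X) = c :=
  CompHom.ext (ringHom_ext fun _ _ => rfl)

theorem CompHom.precomp_comp {ξ ξ' ξ'' : TwoExt B M} {X X' X'' : Butterfly ξ ξ'}
    {Y : Butterfly ξ' ξ''} {Z : Butterfly ξ ξ''} (c : CompHom X'' Y Z) (f : X ⟶ X') (g : X' ⟶ X'') :
    c.precomp (f ≫ g) = (c.precomp g).precomp f :=
  CompHom.ext (ringHom_ext fun _ _ => rfl)

theorem restrictMap_id (X : Butterfly (ξ.pullback h) (η.pullback h)) (k : C' ⟶ C) (h' : C' ⟶ B)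
    (w : k ≫ h = h') : restrictMap (𝟙 X) k h' w = 𝟙 _ :=
  hom_ext (ringHom_ext fun _ _ => by refine fiberProd.ext ?_ ?_ <;> rfl)

theorem restrictMap_comp {X Y Z : Butterfly (ξ.pullback h) (η.pullback h)} (f : X ⟶ Y) (g : Y ⟶ Z)
    (k : C' ⟶ C) (h' : C' ⟶ B) (w : k ≫ h = h') :
    restrictMap (f ≫ g) k h' w = restrictMap f k h' w ≫ restrictMap g k h' w :=
  hom_ext (ringHom_ext fun _ _ => by refine fiberProd.ext ?_ ?_ <;> rfl)

theorem restrictIdHom_naturality {X Y : Butterfly (ξ.pullback h) (η.pullback h)} (f : X ⟶ Y)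
    (w : 𝟙 C ≫ h = h) :
    restrictMap f (𝟙 C) h w ≫ Y.restrictIdHom w = X.restrictIdHom w ≫ f :=
  hom_ext (ringHom_ext fun _ _ => rfl)

theorem restrictMap_restrictIdHom (X : Butterfly (ξ.pullback h) (η.pullback h)) (w : 𝟙 C ≫ h = h)
    (k : C' ⟶ C) (h' : C' ⟶ B) (w' : k ≫ h = h') (hk : k ≫ 𝟙 C = k) :
    restrictMap (X.restrictIdHom w) k h' w' = X.restrictCompHom (𝟙 C) h w k h' w' k hk w' :=
  hom_ext (ringHom_ext fun _ _ => by refine fiberProd.ext ?_ ?_ <;> rfl)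

theorem restrictMap_restrictIdInv (X : Butterfly (ξ.pullback h) (η.pullback h)) (w : 𝟙 C ≫ h = h)
    (k : C' ⟶ C) (h' : C' ⟶ B) (w' : k ≫ h = h') (hk : k ≫ 𝟙 C = k) :
    restrictMap (X.restrictIdInv w) k h' w' ≫ X.restrictCompHom (𝟙 C) h w k h' w' k hk w' = 𝟙 _ :=
  hom_ext (ringHom_ext fun _ _ => by refine fiberProd.ext ?_ ?_ <;> rfl)

theorem restrictCompHom_naturality {X Y : Butterfly (ξ.pullback h) (η.pullback h)} (f : X ⟶ Y)
    (k : C' ⟶ C) (h' : C' ⟶ B) (w : k ≫ h = h') (k' : C'' ⟶ C') (h'' : C'' ⟶ B)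
    (w' : k' ≫ h' = h'') (l : C'' ⟶ C) (hl : k' ≫ k = l) (wl : l ≫ h = h'') :
    restrictMap (restrictMap f k h' w) k' h'' w' ≫ Y.restrictCompHom k h' w k' h'' w' l hl wl =
      X.restrictCompHom k h' w k' h'' w' l hl wl ≫ restrictMap f l h'' wl :=
  hom_ext (ringHom_ext fun _ _ => by refine fiberProd.ext ?_ ?_ <;> rfl)

theorem restrictCompInv_naturality {X Y : Butterfly (ξ.pullback h) (η.pullback h)} (f : X ⟶ Y)
    (k : C' ⟶ C) (h' : C' ⟶ B) (w : k ≫ h = h') (k' : C'' ⟶ C') (h'' : C'' ⟶ B)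
    (w' : k' ≫ h' = h'') (l : C'' ⟶ C) (hl : k' ≫ k = l) (wl : l ≫ h = h'') :
    restrictMap f l h'' wl ≫ Y.restrictCompInv k h' w k' h'' w' l hl wl =
      X.restrictCompInv k h' w k' h'' w' l hl wl ≫
        restrictMap (restrictMap f k h' w) k' h'' w' :=
  hom_ext (ringHom_ext fun _ _ => by
    refine fiberProd.ext ?_ ?_
    · refine fiberProd.ext ?_ ?_ <;> rfl
    · rfl)

section
variable {D : RingSheaf J} (X : Butterfly (ξ.pullback h) (η.pullback h)) (k : C' ⟶ C) (h' : C' ⟶ B)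
    (w : k ≫ h = h') (k' : C'' ⟶ C') (h'' : C'' ⟶ B) (w' : k' ≫ h' = h'') (l : C'' ⟶ C)
    (hl : k' ≫ k = l) (wl : l ≫ h = h'') (a : D ⟶ C) (a' : D ⟶ C') (a'' : D ⟶ C'') (d : D ⟶ B)
    (wa : a ≫ h = d) (wa' : a' ≫ h' = d) (wa'' : a'' ≫ h'' = d) (e : a'' ≫ k' = a')
    (e' : a' ≫ k = a) (e'' : a'' ≫ l = a)

theorem restrictCompHom_assoc :
    restrictMap (X.restrictCompHom k h' w k' h'' w' l hl wl) a'' d wa'' ≫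
      X.restrictCompHom l h'' wl a'' d wa'' a e'' wa =
    (X.restrict k h' w).restrictCompHom k' h'' w' a'' d wa'' a' e wa' ≫
      X.restrictCompHom k h' w a' d wa' a e' wa :=
  hom_ext (ringHom_ext fun _ _ => by refine fiberProd.ext ?_ ?_ <;> rfl)

theorem restrictCompInv_assoc :
    restrictMap (X.restrictCompInv k h' w k' h'' w' l hl wl) a'' d wa'' ≫
      (X.restrict k h' w).restrictCompHom k' h'' w' a'' d wa'' a' e wa' ≫
      X.restrictCompHom k h' w a' d wa' a e' wa =
    X.restrictCompHom l h'' wl a'' d wa'' a e'' wa :=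
  hom_ext (ringHom_ext fun _ _ => by refine fiberProd.ext ?_ ?_ <;> rfl)

end

end Butterfly

section Algebras
variable {A : RingSheaf J}

/-- The structure map of an `A`-algebra. -/
abbrev str (B : Under A) : A ⟶ B.right := B.hom

/-- A 2-extension of `A`-algebras of `B` by `M`: a 2-extension of `B` by `M` with a splitting of its
pullback to `A`. -/
structure AlgTwoExt (B : Under A) (M : ModSheaf B.right) where
  ext : TwoExt B.right M
  split : Butterfly (ext.pullback (str B)) (TwoExt.trivial A (M.restrict (str B)))

variable {B : Under A}

/-- The map `C → B` of an `A`-algebra over `B`. -/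
abbrev toBase (C : Over B) : C.left.right ⟶ B.right := C.hom.right

/-- The ring map underlying a morphism of `A`-algebras over `B`. -/
abbrev ringMap {C' C : Over B} (k : C' ⟶ C) : C'.left.right ⟶ C.left.right := k.left.right

theorem str_toBase (C : Over B) : str C.left ≫ toBase C = str B := Under.w C.hom

theorem ringMap_toBase {C' C : Over B} (k : C' ⟶ C) : ringMap k ≫ toBase C = toBase C' :=
  congrArg (fun t => t.right) (Over.w k)

theorem str_ringMap {C' C : Over B} (k : C' ⟶ C) : str C'.left ≫ ringMap k = str C.left :=
  Under.w k.left

variable {M : ModSheaf B.right}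

/-- A morphism (automatically invertible) `ξ|_C → η|_C` of 2-extensions of `A`-algebras: a butterfly
with an isomorphism from the composite `ξ|_A → η|_A → 0` of its pullback to `A` and of the given
splitting of `η|_A` to the given splitting of `ξ|_A`. -/
structure AlgButterfly (ξ η : AlgTwoExt B M) (C : Over B) where
  bf : Butterfly (ξ.ext.pullback (toBase C)) (η.ext.pullback (toBase C))
  α : Butterfly.CompHom (bf.restrict (str C.left) (str B) (str_toBase C)) η.split ξ.split

namespace AlgButterfly
variable {ξ η : AlgTwoExt B M}

/-- A morphism of butterflies of 2-extensions of `A`-algebras: a morphism of butterflies that is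
compatible with the isomorphisms over `A`. -/
@[ext] structure Hom {C : Over B} (X Y : AlgButterfly ξ η C) where
  f : X.bf ⟶ Y.bf
  comm : Y.α.precomp (Butterfly.restrictMap f (str C.left) (str B) (str_toBase C)) = X.α

instance (C : Over B) : Category (AlgButterfly ξ η C) where
  Hom X Y := Hom X Y
  id X := ⟨𝟙 X.bf, by rw [Butterfly.restrictMap_id, Butterfly.CompHom.precomp_id]⟩
  comp {X Y Z} f g := ⟨f.f ≫ g.f, by
    rw [Butterfly.restrictMap_comp, Butterfly.CompHom.precomp_comp, g.comm, f.comm]⟩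

@[ext] theorem hom_ext {C : Over B} {X Y : AlgButterfly ξ η C} {f g : X ⟶ Y} (H : f.f.φ = g.f.φ) :
    f = g := Hom.ext (Butterfly.hom_ext H)

@[simp] theorem id_f {C : Over B} (X : AlgButterfly ξ η C) : Hom.f (𝟙 X) = 𝟙 X.bf := rfl

@[simp] theorem comp_f {C : Over B} {X Y Z : AlgButterfly ξ η C} (f : X ⟶ Y) (g : Y ⟶ Z) :
    (f ≫ g).f = f.f ≫ g.f := rfl

/-- Pullback along a morphism of `A`-algebras over `B`. -/
def restrictObj {C' C : Over B} (k : C' ⟶ C) (X : AlgButterfly ξ η C) : AlgButterfly ξ η C' where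
  bf := X.bf.restrict (ringMap k) (toBase C') (ringMap_toBase k)
  α := X.α.precomp (X.bf.restrictCompHom (ringMap k) (toBase C') (ringMap_toBase k) (str C'.left)
    (str B) (str_toBase C') (str C.left) (str_ringMap k) (str_toBase C))

/-- Pullback along a morphism of `A`-algebras over `B`. -/
def restrict {C' C : Over B} (k : C' ⟶ C) : AlgButterfly ξ η C ⥤ AlgButterfly ξ η C' where
  obj X := restrictObj k X
  map {X Y} f := ⟨Butterfly.restrictMap f.f (ringMap k) (toBase C') (ringMap_toBase k), by
    refine (Butterfly.CompHom.precomp_comp _ _ _).symm.trans ?_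
    refine (congrArg Y.α.precomp (Butterfly.restrictCompHom_naturality f.f _ _ _ _ _ _ _
      (str_ringMap k) _)).trans ?_
    refine (Butterfly.CompHom.precomp_comp _ _ _).trans ?_
    rw [f.comm]
    rfl⟩
  map_id X := Hom.ext (Butterfly.restrictMap_id _ _ _ _)
  map_comp f g := Hom.ext (Butterfly.restrictMap_comp _ _ _ _ _)

/-- Pullback along the identity is isomorphic to the identity. -/
def restrictId (C : Over B) : restrict (ξ := ξ) (η := η) (𝟙 C) ≅ 𝟭 _ :=
  NatIso.ofComponents (fun X =>
    { hom := ⟨X.bf.restrictIdHom (ringMap_toBase (𝟙 C)),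
        congrArg X.α.precomp (Butterfly.restrictMap_restrictIdHom _ _ _ _ _ _)⟩
      inv := ⟨X.bf.restrictIdInv (ringMap_toBase (𝟙 C)),
        (Butterfly.CompHom.precomp_comp _ _ _).symm.trans ((congrArg X.α.precomp
          (Butterfly.restrictMap_restrictIdInv _ _ _ _ _ _)).trans X.α.precomp_id)⟩
      hom_inv_id := Hom.ext (X.bf.restrictId _).hom_inv_id
      inv_hom_id := Hom.ext (X.bf.restrictId _).inv_hom_id })
    (fun f => Hom.ext (Butterfly.restrictIdHom_naturality f.f _))

/-- Pullback along a composite is isomorphic to the iterated pullback. -/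
def restrictComp {C C' C'' : Over B} (k : C' ⟶ C) (k' : C'' ⟶ C') :
    restrict (ξ := ξ) (η := η) (k' ≫ k) ≅ restrict k ⋙ restrict k' :=
  NatIso.ofComponents (fun X =>
    { hom := ⟨X.bf.restrictCompInv (ringMap k) _ (ringMap_toBase k) (ringMap k') _
        (ringMap_toBase k') (ringMap (k' ≫ k)) rfl (ringMap_toBase (k' ≫ k)), by
          refine (Butterfly.CompHom.precomp_comp _ _ _).symm.trans ?_
          refine (Butterfly.CompHom.precomp_comp _ _ _).symm.trans ?_
          exact congrArg X.α.precomp ((Category.assoc _ _ _).trans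
            (Butterfly.restrictCompInv_assoc _ _ _ _ _ _ _ _ _ _ _ _ _ _ _ _ _ _ _ _))⟩
      inv := ⟨X.bf.restrictCompHom (ringMap k) _ (ringMap_toBase k) (ringMap k') _
        (ringMap_toBase k') (ringMap (k' ≫ k)) rfl (ringMap_toBase (k' ≫ k)), by
          refine (Butterfly.CompHom.precomp_comp _ _ _).symm.trans ?_
          refine Eq.trans ?_ (Butterfly.CompHom.precomp_comp _ _ _)
          exact congrArg X.α.precomp
            (Butterfly.restrictCompHom_assoc _ _ _ _ _ _ _ _ _ _ _ _ _ _ _ _ _ _ _ _)⟩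
      hom_inv_id := Hom.ext (X.bf.restrictComp _ _ _ _ _ _ _ _ _).inv_hom_id
      inv_hom_id := Hom.ext (X.bf.restrictComp _ _ _ _ _ _ _ _ _).hom_inv_id })
    (fun f => Hom.ext (Butterfly.restrictCompInv_naturality f.f _ _ _ _ _ _ _ rfl _))

end AlgButterfly

theorem AlgButterfly.eqToHom_fst {ξ η : AlgTwoExt B M} {C C' : Over B} {k k' : C' ⟶ C} (e : k = k')
    (H : (AlgButterfly.restrict (ξ := ξ) (η := η) k).toCatHom =
      (AlgButterfly.restrict (ξ := ξ) (η := η) k').toCatHom) (X : AlgButterfly ξ η C) :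
    ((eqToHom H).toNatTrans.app X : (restrict k).obj X ⟶ (restrict k').obj X).f.φ ≫
      fiberProd.fst _ _ = fiberProd.fst _ _ := by
  subst e
  rfl

theorem AlgButterfly.eqToHom_snd {ξ η : AlgTwoExt B M} {C C' : Over B} {k k' : C' ⟶ C} (e : k = k')
    (H : (AlgButterfly.restrict (ξ := ξ) (η := η) k).toCatHom =
      (AlgButterfly.restrict (ξ := ξ) (η := η) k').toCatHom) (X : AlgButterfly ξ η C) :
    ((eqToHom H).toNatTrans.app X : (restrict k).obj X ⟶ (restrict k').obj X).f.φ ≫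
      fiberProd.snd _ _ = fiberProd.snd _ _ := by
  subst e
  rfl

/-- The fibered category `Isom(ξ, η)` over `A-alg/B` of invertible butterflies of 2-extensions of
`A`-algebras, as a pseudofunctor: its fibre over `C` consists of the butterflies `ξ|_C → η|_C`. -/
def Isom (ξ η : AlgTwoExt B M) : Pseudofunctor (LocallyDiscrete (Over B)ᵒᵖ) Cat.{u, u + 1} :=
  LocallyDiscrete.mkPseudofunctor
    (fun C => Cat.of (AlgButterfly ξ η C.unop))
    (fun k => (AlgButterfly.restrict k.unop).toCatHom)
    (fun C => Cat.Hom.isoMk (AlgButterfly.restrictId C.unop))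
    (fun k k' => Cat.Hom.isoMk (AlgButterfly.restrictComp k.unop k'.unop))
    (by
      intro C₀ C₁ C₂ C₃ f g h
      ext X
      refine AlgButterfly.hom_ext (fiberProd.hom_ext ?_ ?_)
      · refine Eq.trans ?_ (AlgButterfly.eqToHom_fst (congrArg Quiver.Hom.unop (Category.assoc f g h)) _ X).symm
        rfl
      · refine Eq.trans ?_ (AlgButterfly.eqToHom_snd (congrArg Quiver.Hom.unop (Category.assoc f g h)) _ X).symm
        rfl)
    (by
      intro C₀ C₁ f
      ext X
      refine AlgButterfly.hom_ext (fiberProd.hom_ext ?_ ?_)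
      · refine Eq.trans ?_ (AlgButterfly.eqToHom_fst (congrArg Quiver.Hom.unop (Category.id_comp f)) _ X).symm
        rfl
      · refine Eq.trans ?_ (AlgButterfly.eqToHom_snd (congrArg Quiver.Hom.unop (Category.id_comp f)) _ X).symm
        rfl)
    (by
      intro C₀ C₁ f
      ext X
      refine AlgButterfly.hom_ext (fiberProd.hom_ext ?_ ?_)
      · refine Eq.trans ?_ (AlgButterfly.eqToHom_fst (congrArg Quiver.Hom.unop (Category.comp_id f)) _ X).symm
        rfl
      · refine Eq.trans ?_ (AlgButterfly.eqToHom_snd (congrArg Quiver.Hom.unop (Category.comp_id f)) _ X).symm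
        rfl)

end Algebras

section SquareZero
variable {A : RingSheaf J} (M : ModSheaf A)

instance (U : T) : Module (A.Sec U)ᵐᵒᵖ (M.Sec U) :=
  Module.compHom (M.Sec U) ((RingHom.id (A.Sec U)).fromOpposite mul_comm)

instance (U : T) : IsCentralScalar (A.Sec U) (M.Sec U) := ⟨fun _ _ => rfl⟩

/-- The presheaf `U ↦ A(U) + ε M(U)`. -/
def sqZeroPresheaf : Tᵒᵖ ⥤ CommRingCat.{u} where
  obj U := CommRingCat.of (TrivSqZeroExt (A.Sec U.unop) (M.Sec U.unop))
  map {U V} h := CommRingCat.ofHom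
    { toFun := fun x => (A.res h.unop x.fst, M.res h.unop x.snd)
      map_one' := TrivSqZeroExt.ext (map_one (A.res h.unop)) (map_zero (M.res h.unop))
      map_mul' := fun x y => TrivSqZeroExt.ext (map_mul (A.res h.unop) x.fst y.fst) (by
        change M.res h.unop (x.fst • y.snd + y.fst • x.snd) = A.res h.unop x.fst • M.res h.unop y.snd +
          A.res h.unop y.fst • M.res h.unop x.snd
        rw [map_add, M.res_smul, M.res_smul])
      map_zero' := TrivSqZeroExt.ext (map_zero (A.res h.unop)) (map_zero (M.res h.unop))
      map_add' := fun x y => TrivSqZeroExt.ext (map_add (A.res h.unop) x.fst y.fst)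
        (map_add (M.res h.unop) x.snd y.snd) }
  map_id U := CommRingCat.hom_ext (RingHom.ext fun x =>
    TrivSqZeroExt.ext (A.res_id _ x.fst) (M.res_id _ x.snd))
  map_comp h k := CommRingCat.hom_ext (RingHom.ext fun x =>
    TrivSqZeroExt.ext (A.res_comp _ _ x.fst) (M.res_comp _ _ x.snd))

theorem ModSheaf.isSheaf : Presieve.IsSheaf J (M.ab.obj ⋙ forget AddCommGrpCat) :=
  (isSheaf_iff_isSheaf_of_type _ _).1
    ((Presheaf.isSheaf_iff_isSheaf_forget J M.ab.obj (forget _)).1 M.ab.property)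

/-- The trivial square-zero extension `A + ε M`, with `ε² = 0`. -/
def sqZero : RingSheaf J where
  obj := sqZeroPresheaf M
  property := by
    rw [Presheaf.isSheaf_iff_isSheaf_forget J _ (forget CommRingCat), isSheaf_iff_isSheaf_of_type]
    intro U Z hZ x hx
    have h1 : Presieve.FamilyOfElements.Compatible (P := A.obj ⋙ forget CommRingCat)
        (fun V h hh => (x h hh).1 : Presieve.FamilyOfElements _ Z.arrows) := by
      intro V V' W g g' f f' hf hf' e
      exact congrArg (fun t => t.1) (hx g g' hf hf' e)
    have h2 : Presieve.FamilyOfElements.Compatible (P := M.ab.obj ⋙ forget AddCommGrpCat)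
        (fun V h hh => (x h hh).2 : Presieve.FamilyOfElements _ Z.arrows) := by
      intro V V' W g g' f f' hf hf' e
      exact congrArg (fun t => t.2) (hx g g' hf hf' e)
    obtain ⟨r, hr, hr'⟩ := A.isSheaf Z hZ _ h1
    obtain ⟨s, hs, hs'⟩ := M.isSheaf Z hZ _ h2
    refine ⟨(r, s), fun V h hh => Prod.ext (hr h hh) (hs h hh), ?_⟩
    intro y hy
    refine Prod.ext ?_ ?_
    · exact hr' y.1 fun V h hh => congrArg (fun t => t.1) (hy h hh)
    · exact hs' y.2 fun V h hh => congrArg (fun t => t.2) (hy h hh)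

/-- The projection `A + ε M → A`. -/
def sqZeroFst : sqZero M ⟶ A :=
  ⟨{ app := fun U => CommRingCat.ofHom
      { toFun := fun x => x.fst
        map_one' := rfl
        map_mul' := fun _ _ => rfl
        map_zero' := rfl
        map_add' := fun _ _ => rfl } }⟩

/-- The inclusion `M → A + ε M`. -/
def sqZeroInr (U : T) : M.Sec U →+ (sqZero M).Sec U where
  toFun m := (0, m)
  map_zero' := rfl
  map_add' x y := Prod.ext (add_zero _).symm rfl

end SquareZero

/-- The trivial splitting `A + ε M` of the pullback to `A` of the trivial 2-extension. -/
def trivialSplit {A B : RingSheaf J} (M : ModSheaf B) (a : A ⟶ B) :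
    Butterfly ((TwoExt.trivial B M).pullback a) (TwoExt.trivial A (M.restrict a)) where
  Q := sqZero (M.restrict a)
  ι U := sqZeroInr (M.restrict a) U
  κ U := sqZeroInr (M.restrict a) U
  ρ := fiberProd.lift (sqZeroFst _ ≫ a) (sqZeroFst _) rfl
  π := sqZeroFst _
  ι_res h n := Prod.ext (map_zero (A.res h)).symm rfl
  κ_res h n := Prod.ext (map_zero (A.res h)).symm rfl
  ι_smul U q n := by
    refine TrivSqZeroExt.ext (mul_zero (M₀ := A.Sec U) _).symm ?_
    have hz : (0 : A.Sec U) • (show (M.restrict a).Sec U from q.2) = 0 := zero_smul _ _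
    exact ((congrArg (fun t => (show A.Sec U from q.1) • (show (M.restrict a).Sec U from n) + t)
      hz).trans (add_zero _)).symm
  κ_smul U q n := by
    refine TrivSqZeroExt.ext (mul_zero (M₀ := A.Sec U) _).symm ?_
    have hz : (0 : A.Sec U) • (show (M.restrict a).Sec U from q.2) = 0 := zero_smul _ _
    exact ((congrArg (fun t => (show A.Sec U from q.1) • (show (M.restrict a).Sec U from n) + t)
      hz).trans (add_zero _)).symm
  ρ_ι U n := fiberProd.ext (map_zero (ap a U)) rfl
  π_κ U n := (neg_zero (G := A.Sec U)).symm
  π_ι U n := rfl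
  ι_e U m := rfl
  ρ_g := rfl
  κ_injective _ _ _ H := congrArg (fun t => t.2) H
  exact_Q U q := by
    constructor
    · intro H
      exact ⟨q.2, Prod.ext (congrArg (ap (fiberProd.snd _ a) U) H).symm rfl⟩
    · rintro ⟨n, rfl⟩
      exact fiberProd.ext (map_zero (ap a U)) rfl
  ρ_surjective U r := by
    refine Locally.of_forall fun V h => ?_
    refine ⟨(A.res h (ap (fiberProd.snd _ a) U r), (0 : M.Sec V)), fiberProd.ext ?_ rfl⟩
    refine (ap_res a h _).trans ?_
    exact congrArg (B.res h) r.2.symm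

section Algebras
variable {A : RingSheaf J} {B : Under A}

/-- The trivial 2-extension `0 → M = M → B = B → 0` with its trivial `A`-algebra structure. -/
def AlgTwoExt.trivial (B : Under A) (M : ModSheaf B.right) : AlgTwoExt B M where
  ext := TwoExt.trivial B.right M
  split := trivialSplit M (str B)

/-- The stack `Split(ξ) = Isom(ξ, 0)` of splittings of `ξ`. -/
def Split {M : ModSheaf B.right} (ξ : AlgTwoExt B M) :
    Pseudofunctor (LocallyDiscrete (Over B)ᵒᵖ) Cat.{u, u + 1} :=
  Isom ξ (AlgTwoExt.trivial B M)

/-- A sieve on an `A`-algebra `C` over `B` is covering if for every finite set `Λ` of sections of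
`C` over an object `U` there is a single `f : D → C` in the sieve such that `Λ` lifts to sections of
`D` over a covering of `U`. -/
def IsCovering {C : Over B} (S : Sieve C) : Prop :=
  ∀ (U : T) (Λ : Finset (C.left.right.Sec U)), ∃ (D : Over B) (f : D ⟶ C), S f ∧
    Locally J U fun V h => ∀ c ∈ Λ, ∃ d : D.left.right.Sec V,
      ap (ringMap f) V d = C.left.right.res h c

/-- The topology on `A-alg/B` generated by the covering families. -/
def algTopology (B : Under A) : GrothendieckTopology (Over B) :=
  sInf {K | ∀ (C : Over B) (S : Sieve C), IsCovering S → S ∈ K C}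

/-- The group `Der_A(C, M)` of `A`-derivations from the sheaf of `A`-algebras `C` over `B` to the
`B`-module `M`. -/
def Der (M : ModSheaf B.right) (C : Over B) :
    AddSubgroup (∀ U : T, C.left.right.Sec U →+ M.Sec U) where
  carrier := {d | (∀ {U V : T} (h : V ⟶ U) x, d V (C.left.right.res h x) = M.res h (d U x)) ∧
    (∀ (U : T) (x y : C.left.right.Sec U), d U (x * y) =
      ap (toBase C) U x • d U y + ap (toBase C) U y • d U x) ∧
    ∀ (U : T) (a : A.Sec U), d U (ap (str C.left) U a) = 0}
  zero_mem' := ⟨fun h x => (map_zero (M.res h)).symm, fun U x y => by simp, fun U a => rfl⟩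
  add_mem' {d d'} hd hd' := ⟨fun h x => by simp [hd.1, hd'.1],
    fun U x y => by
      simp only [Pi.add_apply, AddMonoidHom.add_apply, hd.2.1, hd'.2.1, smul_add]
      abel,
    fun U a => by simp [hd.2.2, hd'.2.2]⟩
  neg_mem' {d} hd := ⟨fun h x => by simp [hd.1],
    fun U x y => by
      simp only [Pi.neg_apply, AddMonoidHom.neg_apply, hd.2.1, smul_neg]
      abel,
    fun U a => by simp [hd.2.2]⟩

/-- Restriction of derivations along a morphism of `A`-algebras over `B`. -/
def Der.comp (M : ModSheaf B.right) {C' C : Over B} (k : C' ⟶ C) : Der M C →+ Der M C' where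
  toFun d := ⟨fun U => (d.1 U).comp (ap (ringMap k) U).toAddMonoidHom,
    fun {U V} h x => (congrArg (d.1 V) (ap_res (ringMap k) h x)).trans (d.2.1 h _),
    fun U x y => by
      refine (congrArg (d.1 U) (map_mul (ap (ringMap k) U) x y)).trans ((d.2.2.1 U _ _).trans ?_)
      rw [← ringMap_toBase k]
      rfl,
    fun U a => by
      refine Eq.trans ?_ (d.2.2.2 U a)
      rw [← str_ringMap k]
      rfl⟩
  map_zero' := rfl
  map_add' _ _ := rfl

/-- The presheaf `C ↦ Der_A(C, M)` on `A-alg/B`. -/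
def derPresheaf (B : Under A) (M : ModSheaf B.right) : (Over B)ᵒᵖ ⥤ AddCommGrpCat.{u} where
  obj C := AddCommGrpCat.of (Der M C.unop)
  map k := AddCommGrpCat.ofHom (Der.comp M k.unop)

end Algebras

section Gerbes
universe v w v' w'
variable {𝒞 : Type w} [Category.{v} 𝒞]

/-- A gerbe: a stack in groupoids which is locally nonempty and any two objects of which are
locally isomorphic. -/
structure IsGerbe (K : GrothendieckTopology 𝒞)
    (F : Pseudofunctor (LocallyDiscrete 𝒞ᵒᵖ) Cat.{v', w'}) : Prop where
  isStack : F.IsStack K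
  isIso : ∀ (C : 𝒞) (x y : F.obj (.mk (op C))) (f : x ⟶ y), IsIso f
  locally_nonempty : ∀ C : 𝒞, ∃ S ∈ K C, ∀ ⦃D : 𝒞⦄ (f : D ⟶ C), S f →
    Nonempty (F.obj (.mk (op D)))
  locally_connected : ∀ (C : 𝒞) (x y : F.obj (.mk (op C))), ∃ S ∈ K C, ∀ ⦃D : 𝒞⦄ (f : D ⟶ C), S f →
    Nonempty ((F.map f.op.toLoc).toFunctor.obj x ≅ (F.map f.op.toLoc).toFunctor.obj y)

/-- A banding of `F` by the presheaf of abelian groups `G`: isomorphisms of `G(C)` with the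
automorphism groups of all objects `x` of `F(C)`, compatible with isomorphisms of objects and with
pullback. -/
structure Banding (F : Pseudofunctor (LocallyDiscrete 𝒞ᵒᵖ) Cat.{v', w'})
    (G : 𝒞ᵒᵖ ⥤ AddCommGrpCat.{u}) where
  iso : ∀ (C : 𝒞) (x : F.obj (.mk (op C))), Multiplicative (G.obj (op C)) ≃* Aut x
  comm : ∀ (C : 𝒞) (x y : F.obj (.mk (op C))) (f : x ⟶ y) (d : G.obj (op C)),
    (iso C x (.ofAdd d)).hom ≫ f = f ≫ (iso C y (.ofAdd d)).hom
  map : ∀ (C D : 𝒞) (k : D ⟶ C) (x : F.obj (.mk (op C))) (d : G.obj (op C)),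
    (F.map k.op.toLoc).toFunctor.map (iso C x (.ofAdd d)).hom =
      (iso D ((F.map k.op.toLoc).toFunctor.obj x) (.ofAdd (G.map k.op d))).hom

/-- `F` is a gerbe banded by the sheaf of abelian groups `G`. -/
structure IsGerbeBandedBy (K : GrothendieckTopology 𝒞)
    (F : Pseudofunctor (LocallyDiscrete 𝒞ᵒᵖ) Cat.{v', w'}) (G : 𝒞ᵒᵖ ⥤ AddCommGrpCat.{u}) : Prop where
  isGerbe : IsGerbe K F
  isSheaf : Presheaf.IsSheaf K G
  banding : Nonempty (Banding F G)

end Gerbes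
end Butterflies

open Butterflies

/-! Let P and P' be the middle terms of the given splittings of ξ and η over A. The kernel of P ×_A
P' → A is N × N'. If α is an isomorphism from the composite of Q|_A with P' to P, then (x, y) ↦
(α(x, y), y) is bijective onto P ×_A P', because P' is invertible. Solving for x turns the
A-structure of a butterfly Q into a ring map μ : P ×_A P' → Q over R, R' and C, with μ(ι n, 0) = ι n
and μ(0, -ι n') = κ n' (`AlgButterfly.IsSec`, `sec`, `ofSec`). The source of μ does not depend on Q,
so a morphism respects the A-structures if and only if it carries μ to μ (`comm_iff`).

Band. An endomorphism f of Q fixes N and N', and these generate the kernel of Q → C locally. Hence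
f(q) - q depends only on the image of q in C. It has zero image in R, R' and C, so it lies in M.
Since M has square zero in Q, multiplicativity of f is the Leibniz rule. Since f fixes the image of
μ, the resulting map vanishes on A (`derHom`, `derOfHom`, `derIso`).

Local connectedness. Given two butterflies X and Y over C, divide the ring of pairs of sections with
the same images in R, R' and C by the ideal of the sections (ι n + κ n', ι n + κ n'). The quotient D
maps onto C, and the ring of pairs is the pullback of X to D. Its second projection therefore gives
a morphism X|_D → Y|_D, and every morphism of butterflies is invertible (`pairFst_bijective`,
`diffIso`).

Local nonemptiness. Let E be the multiplicative monoid of R ×_B R' ×_B C. The algebra A[E] maps onto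
C because R and R' map onto B. The kernel of (P ×_A P')[E] → A[E] consists of the combinations with
coefficients in N × N', and these can be evaluated in N × N'. Dividing (P ×_A P')[E] by the
combinations whose value lies in the diagonal copy of M gives a ring whose kernel to A[E] is (N ×
N')/M. This is the middle term of a butterfly over A[E], and the constants give its μ (`genBf`,
`isSec_genSec`).

Stack. The sieves to which finite sets of sections lift locally form a topology containing the
generating sieves, so it suffices to treat this `liftTopology`. Two sections over members of a
covering family with the same image in C form one section of the fibre product. Therefore
derivations, morphisms and finally the middle terms themselves glue section by section. A descent
datum becomes an equivalence relation between sections of the middle terms, compatible with the ring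
operations. The quotient, sheafified, is the middle term of the descended butterfly
(`Realization.Rel`, `RingGluing`, `Amalgam`). -/

namespace Butterflies
variable {T : Type u} [SmallCategory T] {J : GrothendieckTopology T}

/-! ### Local properties on the site and gluing of sections. -/

namespace Locally
variable {U : T}

theorem and {P Q : ∀ ⦃V : T⦄, (V ⟶ U) → Prop} (hP : Locally J U P) (hQ : Locally J U Q) :
    Locally J U fun _ h => P h ∧ Q h := by
  obtain ⟨S, hS, H⟩ := hP
  obtain ⟨S', hS', H'⟩ := hQ
  exact ⟨S ⊓ S', J.intersection_covering hS hS', fun V h hh => ⟨H h hh.1, H' h hh.2⟩⟩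

theorem bind {P : ∀ ⦃V : T⦄, (V ⟶ U) → Prop}
    (hP : Locally J U fun V h => Locally J V fun _ k => P (k ≫ h)) : Locally J U P := by
  obtain ⟨S, hS, H⟩ := hP
  choose Z hZ HZ using H
  refine ⟨Sieve.bind S fun V h hh => Z h hh, J.bind_covering hS fun V h hh => hZ h hh, ?_⟩
  rintro W _ ⟨V, k, h, hh, hk, rfl⟩
  exact HZ h hh k hk

theorem pull {P : ∀ ⦃V : T⦄, (V ⟶ U) → Prop} (hP : Locally J U P) {V : T} (h : V ⟶ U) :
    Locally J V fun _ k => P (k ≫ h) := by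
  obtain ⟨S, hS, H⟩ := hP
  exact ⟨S.pullback h, J.pullback_stable h hS, fun W k hk => H _ hk⟩

/-- Pass to a covering twice. -/
theorem bind' {P Q : ∀ ⦃V : T⦄, (V ⟶ U) → Prop} (hP : Locally J U P)
    (H : ∀ ⦃V : T⦄ (h : V ⟶ U), P h → Locally J V fun _ k => Q (k ≫ h)) : Locally J U Q :=
  bind (hP.mono H)

end Locally

/-- Sections of a sheaf that are determined locally by a condition stable under restriction exist
globally. -/
theorem exists_of_locally_unique {F : Tᵒᵖ ⥤ Type u} (hF : Presieve.IsSheaf J F) {U : T}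
    (Φ : ∀ ⦃V : T⦄, (V ⟶ U) → F.obj (op V) → Prop)
    (stab : ∀ ⦃V⦄ (h : V ⟶ U) ⦃W⦄ (k : W ⟶ V) x, Φ h x → Φ (k ≫ h) (F.map k.op x))
    (uniq : ∀ ⦃V⦄ (h : V ⟶ U) x y, Φ h x → Φ h y → x = y)
    (ex : Locally J U fun _ h => ∃ x, Φ h x) :
    ∃ x : F.obj (op U), Locally J U fun _ h => Φ h (F.map h.op x) := by
  obtain ⟨S, hS, H⟩ := ex
  choose x hx using H
  have hc : Presieve.FamilyOfElements.Compatible (P := F)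
      (fun V h hh => x h hh : Presieve.FamilyOfElements _ S.arrows) := by
    intro V V' W g g' f f' hf hf' e
    refine uniq (g ≫ f) _ _ (stab _ _ _ (hx _ _)) ?_
    rw [e]
    exact stab _ _ _ (hx _ _)
  obtain ⟨y, hy, -⟩ := hF S hS _ hc
  refine ⟨y, S, hS, fun V h hh => ?_⟩
  have e := hy h hh
  exact (congrArg (Φ h) e).mpr (hx h hh)

theorem RingSheaf.exists_of_locally_unique (R : RingSheaf J) {U : T}
    (Φ : ∀ ⦃V : T⦄, (V ⟶ U) → R.Sec V → Prop)
    (stab : ∀ ⦃V⦄ (h : V ⟶ U) ⦃W⦄ (k : W ⟶ V) x, Φ h x → Φ (k ≫ h) (R.res k x))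
    (uniq : ∀ ⦃V⦄ (h : V ⟶ U) x y, Φ h x → Φ h y → x = y)
    (ex : Locally J U fun _ h => ∃ x, Φ h x) :
    ∃ x : R.Sec U, Locally J U fun _ h => Φ h (R.res h x) :=
  Butterflies.exists_of_locally_unique R.isSheaf Φ stab uniq ex

namespace ModSheaf
variable {R : RingSheaf J} (M : ModSheaf R)

theorem exists_of_locally_unique {U : T}
    (Φ : ∀ ⦃V : T⦄, (V ⟶ U) → M.Sec V → Prop)
    (stab : ∀ ⦃V⦄ (h : V ⟶ U) ⦃W⦄ (k : W ⟶ V) x, Φ h x → Φ (k ≫ h) (M.res k x))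
    (uniq : ∀ ⦃V⦄ (h : V ⟶ U) x y, Φ h x → Φ h y → x = y)
    (ex : Locally J U fun _ h => ∃ x, Φ h x) :
    ∃ x : M.Sec U, Locally J U fun _ h => Φ h (M.res h x) :=
  Butterflies.exists_of_locally_unique M.isSheaf Φ stab uniq ex

theorem eq_of_locally {U : T} {r r' : M.Sec U}
    (H : Locally J U fun _ h => M.res h r = M.res h r') : r = r' := by
  obtain ⟨S, hS, H⟩ := H
  exact (M.isSheaf S hS).isSeparatedFor.ext fun V h hh => H h hh

end ModSheaf

/-- Injectivity makes the local preimages unique, so they glue. In the diagram chases below this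
turns preimages on a covering into preimages over the given object. -/
theorem exists_global_preimage_mod {R : RingSheaf J} (N : ModSheaf R) {Q : RingSheaf J}
    (κ : ∀ U : T, N.Sec U →+ Q.Sec U) (κ_res : ∀ {U V : T} (h : V ⟶ U) n, κ V (N.res h n) = Q.res h (κ U n))
    (inj : ∀ U, Function.Injective (κ U)) {U : T} (q : Q.Sec U)
    (H : Locally J U fun V h => ∃ n : N.Sec V, κ V n = Q.res h q) : ∃ n, κ U n = q := by
  obtain ⟨n, hn⟩ := N.exists_of_locally_unique (fun V h n => κ V n = Q.res h q)
    (fun V h W k x hx => by rw [κ_res, hx, Q.res_comp]) (fun V h x y hx hy => inj V (hx.trans hy.symm)) H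
  exact ⟨n, Q.eq_of_locally (hn.mono fun V h hh => by rw [← κ_res, hh])⟩

theorem exists_global_preimage {P Q : RingSheaf J} (φ : P ⟶ Q)
    (inj : ∀ U, Function.Injective (ap φ U)) {U : T} (q : Q.Sec U)
    (H : Locally J U fun V h => ∃ n : P.Sec V, ap φ V n = Q.res h q) : ∃ n, ap φ U n = q := by
  obtain ⟨n, hn⟩ := P.exists_of_locally_unique (fun V h n => ap φ V n = Q.res h q)
    (fun V h W k x hx => by rw [ap_res, hx, Q.res_comp]) (fun V h x y hx hy => inj V (hx.trans hy.symm)) H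
  exact ⟨n, Q.eq_of_locally (hn.mono fun V h hh => by rw [← ap_res, hh])⟩

/-- A morphism of sheaves of rings given by ring maps on sections that commute with restriction. -/
def mkHom {R S : RingSheaf J} (φ : ∀ U : T, R.Sec U →+* S.Sec U)
    (H : ∀ {U V : T} (h : V ⟶ U) r, φ V (R.res h r) = S.res h (φ U r)) : R ⟶ S :=
  ⟨{ app := fun U => CommRingCat.ofHom (φ U.unop)
     naturality := fun U V h => by
      ext q
      exact H h.unop q }⟩

/-- The inverse of a morphism that is bijective on sections. -/
noncomputable def invOfBijective {R S : RingSheaf J} (φ : R ⟶ S) (H : ∀ U, Function.Bijective (ap φ U)) : S ⟶ R :=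
  mkHom (fun U => (RingEquiv.ofBijective (ap φ U) (H U)).symm.toRingHom) (by
    intro U V h s
    apply (H V).1
    obtain ⟨r, rfl⟩ := (H U).2 s
    rw [ap_res]
    change (RingEquiv.ofBijective (ap φ V) (H V)) ((RingEquiv.ofBijective (ap φ V) (H V)).symm _) =
      S.res h (ap φ U ((RingEquiv.ofBijective (ap φ U) (H U)).symm (RingEquiv.ofBijective (ap φ U) (H U) r)))
    rw [RingEquiv.apply_symm_apply, RingEquiv.symm_apply_apply])

@[simp] theorem ap_invOfBijective {R S : RingSheaf J} (φ : R ⟶ S) (H : ∀ U, Function.Bijective (ap φ U))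
    (U : T) (r : R.Sec U) : ap (invOfBijective φ H) U (ap φ U r) = r :=
  (RingEquiv.ofBijective (ap φ U) (H U)).symm_apply_apply r

@[simp] theorem ap_ap_invOfBijective {R S : RingSheaf J} (φ : R ⟶ S) (H : ∀ U, Function.Bijective (ap φ U))
    (U : T) (s : S.Sec U) : ap φ U (ap (invOfBijective φ H) U s) = s :=
  (RingEquiv.ofBijective (ap φ U) (H U)).apply_symm_apply s

/-! ### Ring maps defined on local lifts. -/

section Glue
universe w
variable {I : Type w} {P : RingSheaf J} {Pi : I → RingSheaf J} (c : ∀ i, Pi i ⟶ P)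

/-- Any two sections of `P` lift locally to one member of the family. -/
def PairLift : Prop := ∀ (U : T) (x y : P.Sec U), Locally J U fun V h =>
  ∃ (i : I) (a b : (Pi i).Sec V), ap (c i) V a = P.res h x ∧ ap (c i) V b = P.res h y

variable {c} (hc : PairLift c) {X : RingSheaf J} (w : ∀ i, Pi i ⟶ X)
  (H : ∀ (U : T) (i j : I) (a : (Pi i).Sec U) (b : (Pi j).Sec U), ap (c i) U a = ap (c j) U b →
    ap (w i) U a = ap (w j) U b)

include hc H in
-- By `H` the value of `w` does not depend on the chosen lift, so the local values glue. The
-- property covers every lift over every restriction, so that any convenient lift can later be used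
-- to compute the value.
theorem glueHom_exists (U : T) (x : P.Sec U) : ∃ y : X.Sec U, ∀ (V : T) (h : V ⟶ U) (i : I)
    (a : (Pi i).Sec V), ap (c i) V a = P.res h x → ap (w i) V a = X.res h y := by
  obtain ⟨y, hy⟩ := X.exists_of_locally_unique (fun V h y => ∃ (i : I) (a : (Pi i).Sec V),
      ap (c i) V a = P.res h x ∧ ap (w i) V a = y) (by
      rintro V h W k y ⟨i, a, h1, rfl⟩
      exact ⟨i, (Pi i).res k a, by rw [ap_res, h1, P.res_comp], by rw [ap_res]⟩) (by
      rintro V h y y' ⟨i, a, h1, rfl⟩ ⟨j, b, h2, rfl⟩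
      exact H V i j a b (h1.trans h2.symm)) ((hc U x x).mono fun V h => by
        rintro ⟨i, a, b, h1, -⟩
        exact ⟨_, i, a, h1, rfl⟩)
  refine ⟨y, fun V h i a ha => X.eq_of_locally ((hy.pull h).mono ?_)⟩
  rintro W k ⟨j, b, h1, h2⟩
  rw [← ap_res, ← X.res_comp, ← h2]
  refine H W i j _ _ ?_
  rw [ap_res, ha, h1, P.res_comp]

/-- Glue ring maps along a family of ring maps to which pairs of sections lift locally. -/
noncomputable def glueHom : P ⟶ X :=
  -- Sums and products are checked where a single `c i` lifts both arguments, which reduces them to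
  -- the same identity for `w i`. This is why pairs must lift together.
  have key (U : T) (x : P.Sec U) {V : T} (h : V ⟶ U) (i : I) (a : (Pi i).Sec V)
      (ha : ap (c i) V a = P.res h x) :
      X.res h (glueHom_exists hc w H U x).choose = ap (w i) V a :=
    ((glueHom_exists hc w H U x).choose_spec V h i a ha).symm
  mkHom (fun U =>
    { toFun := fun x => (glueHom_exists hc w H U x).choose
      map_one' := by
        refine X.eq_of_locally ((hc U 1 1).mono ?_)
        rintro V h ⟨i, a, b, h1, -⟩
        rw [key U 1 h i 1 (by rw [map_one, map_one]), map_one, map_one]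
      map_zero' := by
        refine X.eq_of_locally ((hc U 1 1).mono ?_)
        rintro V h ⟨i, a, b, h1, -⟩
        rw [key U 0 h i 0 (by rw [map_zero, map_zero]), map_zero, map_zero]
      map_mul' := fun x y => by
        refine X.eq_of_locally ((hc U x y).mono ?_)
        rintro V h ⟨i, a, b, h1, h2⟩
        rw [key U _ h i (a * b) (by rw [map_mul, map_mul, h1, h2]), map_mul, map_mul,
          key U x h i a h1, key U y h i b h2]
      map_add' := fun x y => by
        refine X.eq_of_locally ((hc U x y).mono ?_)
        rintro V h ⟨i, a, b, h1, h2⟩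
        rw [key U _ h i (a + b) (by rw [map_add, map_add, h1, h2]), map_add, map_add,
          key U x h i a h1, key U y h i b h2] }) (by
    intro U V h x
    refine X.eq_of_locally ((hc V (P.res h x) 1).mono ?_)
    rintro W k ⟨i, a, b, h1, -⟩
    refine (key V _ k i a h1).trans ?_
    rw [← X.res_comp]
    exact (key U x (k ≫ h) i a (by rw [h1, P.res_comp])).symm)

@[simp] theorem ap_glueHom (U : T) (i : I) (a : (Pi i).Sec U) :
    ap (glueHom hc w H) U (ap (c i) U a) = ap (w i) U a := by
  have := ((glueHom_exists hc w H U (ap (c i) U a)).choose_spec U (𝟙 U) i a (P.res_id U _).symm).symm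
  rw [X.res_id] at this
  exact this

include hc in
theorem hom_ext_of_pairLift {φ ψ : P ⟶ X} (h : ∀ i, c i ≫ φ = c i ≫ ψ) : φ = ψ := by
  refine ringHom_ext fun U x => X.eq_of_locally ((hc U x x).mono ?_)
  rintro V k ⟨i, a, b, h1, -⟩
  rw [← ap_res, ← ap_res, ← h1]
  exact congrArg (fun t => ap t V a) (h i)

end Glue

/-- A morphism of sheaves of rings is locally surjective. -/
def LocSurj {R S : RingSheaf J} (φ : R ⟶ S) : Prop :=
  ∀ (U : T) (s : S.Sec U), Locally J U fun V h => ∃ r : R.Sec V, ap φ V r = S.res h s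

theorem LocSurj.pairLift {R S : RingSheaf J} {φ : R ⟶ S} (H : LocSurj φ) :
    PairLift (fun _ : PUnit.{1} => φ) := fun U x y => ((H U x).and (H U y)).mono fun V h => by
  rintro ⟨⟨a, ha⟩, ⟨b, hb⟩⟩
  exact ⟨⟨⟩, a, b, ha, hb⟩

/-- Descend a ring map along a locally surjective ring map. -/
noncomputable def LocSurj.desc {R S X : RingSheaf J} {φ : R ⟶ S} (H : LocSurj φ) (w : R ⟶ X)
    (hw : ∀ (U : T) (r : R.Sec U), ap φ U r = 0 → ap w U r = 0) : S ⟶ X :=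
  glueHom (I := PUnit.{1}) H.pairLift (fun _ => w) (fun U _ _ a b hab => by
    rw [← sub_eq_zero, ← map_sub]
    exact hw U _ (by rw [map_sub, hab, sub_self]))

@[simp] theorem LocSurj.ap_desc {R S X : RingSheaf J} {φ : R ⟶ S} (H : LocSurj φ) (w : R ⟶ X)
    (hw : ∀ (U : T) (r : R.Sec U), ap φ U r = 0 → ap w U r = 0) (U : T) (r : R.Sec U) :
    ap (H.desc w hw) U (ap φ U r) = ap w U r :=
  ap_glueHom (I := PUnit.{1}) H.pairLift (fun _ => w) _ U ⟨⟩ r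

theorem LocSurj.hom_ext {R S X : RingSheaf J} {φ : R ⟶ S} (H : LocSurj φ) {a b : S ⟶ X}
    (h : φ ≫ a = φ ≫ b) : a = b :=
  hom_ext_of_pairLift H.pairLift fun _ => h

/-! ### Sheaves of rings associated with presheaves. -/

section Sheafify
variable (F : Tᵒᵖ ⥤ CommRingCat.{u})

/-- The sheaf of rings associated with a presheaf of rings. -/
noncomputable def ringSheafify : RingSheaf J := (presheafToSheaf J CommRingCat.{u}).obj F

/-- The unit on sections. -/
noncomputable def toSheafSec (U : T) : F.obj (op U) →+* (ringSheafify (J := J) F).Sec U :=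
  ((toSheafify J F).app (op U)).hom

theorem toSheafSec_res {U V : T} (h : V ⟶ U) (x : F.obj (op U)) :
    toSheafSec (J := J) F V ((F.map h.op).hom x) = (ringSheafify F).res h (toSheafSec F U x) :=
  congrArg (fun t => t.hom x) ((toSheafify J F).naturality h.op)

theorem toSheafSec_locally_surj (U : T) (s : (ringSheafify (J := J) F).Sec U) :
    Locally J U fun V h => ∃ x, toSheafSec F V x = (ringSheafify F).res h s := by
  have : Presheaf.IsLocallySurjective J (toSheafify J F) := inferInstance
  refine ⟨_, this.imageSieve_mem (U := U) s, fun V h hh => ?_⟩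
  obtain ⟨t, ht⟩ := hh
  exact ⟨t, ht⟩

theorem locally_eq_of_toSheafSec_eq (U : T) (x y : F.obj (op U))
    (H : toSheafSec (J := J) F U x = toSheafSec F U y) :
    Locally J U fun V h => (F.map h.op).hom x = (F.map h.op).hom y := by
  have : Presheaf.IsLocallyInjective J (toSheafify J F) := inferInstance
  exact ⟨_, this.equalizerSieve_mem (X := op U) x y H, fun V h hh => hh⟩

/-- Maps from the associated sheaf. -/
noncomputable def sheafifyDesc {X : RingSheaf J} (w : F ⟶ X.obj) : ringSheafify F ⟶ X :=
  ⟨sheafifyLift J w X.property⟩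

@[simp] theorem ap_sheafifyDesc {X : RingSheaf J} (w : F ⟶ X.obj) (U : T) (x : F.obj (op U)) :
    ap (sheafifyDesc F w) U (toSheafSec F U x) = (w.app (op U)).hom x :=
  congrArg (fun t => (t.app (op U)).hom x) (toSheafify_sheafifyLift J w X.property)

end Sheafify

end Butterflies

namespace Butterflies
variable {T : Type u} [SmallCategory T] {J : GrothendieckTopology T}

/-! ### Exactness properties of butterflies. -/

namespace TwoExt
variable {B : RingSheaf J} {M : ModSheaf B} (ξ : TwoExt B M)

theorem f_e (U : T) (m : M.Sec U) : ξ.f U (ξ.e U m) = 0 := (ξ.exact_N U _).2 ⟨m, rfl⟩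

theorem g_f (U : T) (n : ξ.N.Sec U) : ap ξ.g U (ξ.f U n) = 0 :=
  (ξ.exact_R U _).2 (Locally.of_forall fun V h => ⟨ξ.N.res h n, ξ.f_res h n⟩)

end TwoExt

namespace Butterfly
variable {B : RingSheaf J} {M : ModSheaf B} {ξ η : TwoExt B M} (X : Butterfly ξ η)

@[simp] theorem ρ_κ (U : T) (n : η.N.Sec U) : ap X.ρ U (X.κ U n) = 0 := (X.exact_Q U _).2 ⟨n, rfl⟩

theorem π_κ_e (U : T) (m : M.Sec U) : ap X.π U (X.κ U (η.e U m)) = 0 := by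
  rw [X.π_κ, η.f_e, neg_zero]

theorem g_ρ (U : T) (q : X.Q.Sec U) : ap ξ.g U (ap X.ρ U q) = ap η.g U (ap X.π U q) :=
  congrArg (fun t => ap t U q) X.ρ_g

/-- An element of N killed in Q is killed by f, so it lies in M, where ι agrees with the injective
map κ ∘ e'. -/
theorem ι_injective (U : T) : Function.Injective (X.ι U) := by
  rw [injective_iff_map_eq_zero]
  intro n hn
  have h1 : ξ.f U n = 0 := by rw [← X.ρ_ι, hn, map_zero]
  obtain ⟨m, rfl⟩ := (ξ.exact_N U n).1 h1
  rw [X.ι_e] at hn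
  have h2 := X.κ_injective U (hn.trans (map_zero _).symm)
  rw [η.e_injective U (h2.trans (map_zero _).symm), map_zero]

theorem κ_e_injective (U : T) : Function.Injective fun m => X.κ U (η.e U m) :=
  (X.κ_injective U).comp (η.e_injective U)

/-- The kernel of ρ is N', and there π is -f', whose kernel is M. Thus M measures what the images in
R and R' leave undetermined. -/
theorem exists_m (U : T) (q : X.Q.Sec U) (h1 : ap X.ρ U q = 0) (h2 : ap X.π U q = 0) :
    ∃ m, X.κ U (η.e U m) = q := by
  obtain ⟨n, rfl⟩ := (X.exact_Q U q).1 h1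
  rw [X.π_κ, neg_eq_zero] at h2
  obtain ⟨m, rfl⟩ := (η.exact_N U n).1 h2
  exact ⟨m, rfl⟩

theorem exists_m_sub (U : T) (q q' : X.Q.Sec U) (h1 : ap X.ρ U q = ap X.ρ U q')
    (h2 : ap X.π U q = ap X.π U q') : ∃ m, q = q' + X.κ U (η.e U m) := by
  obtain ⟨m, hm⟩ := X.exists_m U (q - q') (by rw [map_sub, h1, sub_self]) (by rw [map_sub, h2, sub_self])
  exact ⟨m, by rw [hm, add_sub_cancel]⟩

/-- Sections of `R` and `R'` with the same image in `B` come locally from one section of `Q`. -/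
theorem exists_of_pair (U : T) (r : ξ.R.Sec U) (r' : η.R.Sec U) (H : ap ξ.g U r = ap η.g U r') :
    Locally J U fun V h => ∃ q : X.Q.Sec V, ap X.ρ V q = ξ.R.res h r ∧ ap X.π V q = η.R.res h r' := by
  refine (X.ρ_surjective U r).bind' ?_
  rintro V h ⟨q, hq⟩
  have : ap η.g V (η.R.res h r' - ap X.π V q) = 0 := by
    rw [map_sub, ← X.g_ρ, hq, ap_res, ap_res, H, sub_self]
  -- The lift of r may have the wrong image in R'. The error dies in B, so locally it is f' of a
  -- section of N', and subtracting κ of that section leaves ρ unchanged.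
  refine ((η.exact_R V _).1 this).mono ?_
  rintro W k ⟨n, hn⟩
  refine ⟨X.Q.res k q - X.κ W n, ?_, ?_⟩
  · rw [map_sub, X.ρ_κ, sub_zero, ap_res, hq, ξ.R.res_comp]
  · rw [map_sub, X.π_κ, hn, map_sub, ap_res, η.R.res_comp]
    ring

/-- The kernel of `Q → B` is locally generated by `N` and `N'`. -/
theorem exists_add (U : T) (q : X.Q.Sec U) (H : ap ξ.g U (ap X.ρ U q) = 0) :
    Locally J U fun V h => ∃ (n : ξ.N.Sec V) (n' : η.N.Sec V), X.Q.res h q = X.ι V n + X.κ V n' := by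
  refine ((ξ.exact_R U _).1 H).mono ?_
  rintro V h ⟨n, hn⟩
  obtain ⟨n', hn'⟩ := (X.exact_Q V (X.Q.res h q - X.ι V n)).1 (by
    rw [map_sub, X.ρ_ι, hn, ap_res, sub_self])
  exact ⟨n, n', by rw [hn', add_sub_cancel]⟩

theorem g_ρ_ι (U : T) (n : ξ.N.Sec U) : ap ξ.g U (ap X.ρ U (X.ι U n)) = 0 := by
  rw [X.ρ_ι, ξ.g_f]

/-- The exactness of N → Q → R' reflects the invertibility of the butterfly. Locally q = ι n + κ n',
and applying π gives f'(n') = 0. So n' comes from M, where κ agrees with ι. Injectivity of ι removes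
the localization. -/
theorem exists_ι (U : T) (q : X.Q.Sec U) (H : ap X.π U q = 0) : ∃ n, X.ι U n = q := by
  refine exists_global_preimage_mod ξ.N X.ι X.ι_res X.ι_injective q ?_
  refine (X.exists_add U q (by rw [X.g_ρ, H, map_zero])).mono ?_
  rintro V h ⟨n, n', hn⟩
  have h1 : ap X.π V (X.Q.res h q) = 0 := by rw [ap_res, H, map_zero]
  rw [hn, map_add, X.π_ι, X.π_κ, zero_add, neg_eq_zero] at h1
  obtain ⟨m, rfl⟩ := (η.exact_N V n').1 h1
  exact ⟨n + ξ.e V m, by rw [map_add, X.ι_e, hn]⟩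

theorem locSurj_g_ρ : LocSurj (X.ρ ≫ ξ.g) := by
  intro U b
  refine (ξ.g_surjective U b).bind' ?_
  rintro V h ⟨r, hr⟩
  refine (X.ρ_surjective V r).mono ?_
  rintro W k ⟨q, hq⟩
  exact ⟨q, by rw [ap_comp, hq, ap_res, hr, B.res_comp]⟩

theorem locSurj_π : LocSurj X.π := by
  intro U r
  refine (ξ.g_surjective U (ap η.g U r)).bind' ?_
  rintro V h ⟨s, hs⟩
  refine (X.exists_of_pair V s (η.R.res h r) (by rw [hs, ap_res])).mono ?_
  rintro W k ⟨q, -, hq⟩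
  exact ⟨q, by rw [hq, η.R.res_comp]⟩

section Hom
variable {X} {Y : Butterfly ξ η}

theorem Hom.ap_ρ (φ : Hom X Y) (U : T) (q : X.Q.Sec U) : ap Y.ρ U (ap φ.φ U q) = ap X.ρ U q :=
  congrArg (fun t => ap t U q) φ.φ_ρ

theorem Hom.ap_π (φ : Hom X Y) (U : T) (q : X.Q.Sec U) : ap Y.π U (ap φ.φ U q) = ap X.π U q :=
  congrArg (fun t => ap t U q) φ.φ_π

/-- This is the five lemma for 0 → N' → Q → R → 0. Surjectivity is only local at first, and
injectivity lets the preimages glue. -/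
theorem Hom.bijective (φ : Hom X Y) (U : T) : Function.Bijective (ap φ.φ U) := by
  have inj (V : T) : Function.Injective (ap φ.φ V) := by
    rw [injective_iff_map_eq_zero]
    intro q hq
    have h1 : ap X.ρ V q = 0 := by rw [← φ.ap_ρ, hq, map_zero]
    obtain ⟨n, rfl⟩ := (X.exact_Q V q).1 h1
    rw [φ.φ_κ] at hq
    rw [Y.κ_injective V (hq.trans (map_zero _).symm), map_zero]
  refine ⟨inj U, fun q => exists_global_preimage φ.φ inj q ?_⟩
  refine (X.ρ_surjective U (ap Y.ρ U q)).mono ?_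
  rintro V h ⟨p, hp⟩
  obtain ⟨n, hn⟩ := (Y.exact_Q V (Y.Q.res h q - ap φ.φ V p)).1 (by
    rw [map_sub, φ.ap_ρ, hp, ap_res, sub_self])
  exact ⟨p + X.κ V n, by rw [map_add, φ.φ_κ, hn, add_sub_cancel]⟩

/-- The inverse of a morphism of butterflies. -/
noncomputable def Hom.inv (φ : Hom X Y) : Hom Y X where
  φ := invOfBijective φ.φ φ.bijective
  φ_ι U n := by rw [← φ.φ_ι, ap_invOfBijective]
  φ_κ U n := by rw [← φ.φ_κ, ap_invOfBijective]
  φ_ρ := ringHom_ext fun U q => by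
    obtain ⟨p, rfl⟩ := (φ.bijective U).2 q
    rw [ap_comp, ap_invOfBijective, φ.ap_ρ]
  φ_π := ringHom_ext fun U q => by
    obtain ⟨p, rfl⟩ := (φ.bijective U).2 q
    rw [ap_comp, ap_invOfBijective, φ.ap_π]

theorem Hom.comp_inv (φ : X ⟶ Y) : φ ≫ (Hom.inv φ : Y ⟶ X) = 𝟙 X :=
  hom_ext (ringHom_ext fun U q => by simp [Hom.inv])

theorem Hom.inv_comp (φ : X ⟶ Y) : (Hom.inv φ : Y ⟶ X) ≫ φ = 𝟙 Y :=
  hom_ext (ringHom_ext fun U q => by simp [Hom.inv])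

end Hom

/-! ### Morphisms out of a composite, solved for the first factor. -/

namespace CompHom
variable {ξ ξ' ξ'' : TwoExt B M} {X : Butterfly ξ ξ'} {Y : Butterfly ξ' ξ''} {Z : Butterfly ξ ξ''}
  (c : CompHom X Y Z)

/-- The value of `α` on a pair of sections. -/
def val {U : T} (x : X.Q.Sec U) (y : Y.Q.Sec U) (H : ap X.π U x = ap Y.ρ U y) : Z.Q.Sec U :=
  ap c.α U (fiberProd.mk x y H)

theorem val_add {U : T} (x x' : X.Q.Sec U) (y y' : Y.Q.Sec U) (H : ap X.π U x = ap Y.ρ U y)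
    (H' : ap X.π U x' = ap Y.ρ U y') :
    c.val (x + x') (y + y') (by rw [map_add, H, H', map_add]) = c.val x y H + c.val x' y' H' :=
  map_add (ap c.α U) (fiberProd.mk x y H) (fiberProd.mk x' y' H')

theorem ρ_val {U : T} (x : X.Q.Sec U) (y : Y.Q.Sec U) (H : ap X.π U x = ap Y.ρ U y) :
    ap Z.ρ U (c.val x y H) = ap X.ρ U x :=
  congrArg (fun t => ap t U (fiberProd.mk x y H)) c.α_ρ

theorem π_val {U : T} (x : X.Q.Sec U) (y : Y.Q.Sec U) (H : ap X.π U x = ap Y.ρ U y) :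
    ap Z.π U (c.val x y H) = ap Y.π U y :=
  congrArg (fun t => ap t U (fiberProd.mk x y H)) c.α_π

/-- The pair (κ e' m, 0) is also (ι e m, 0), and α carries ι to ι. Hence α is the identity on M, the
part that ρ and π cannot see. -/
theorem val_add_m {U : T} (x : X.Q.Sec U) (y : Y.Q.Sec U) (H : ap X.π U x = ap Y.ρ U y) (m : M.Sec U) :
    c.val (x + X.κ U (ξ'.e U m)) y (by rw [map_add, X.π_κ_e, add_zero, H]) =
      c.val x y H + Z.κ U (ξ''.e U m) := by
  have h0 : ap X.π U (X.ι U (ξ.e U m)) = ap Y.ρ U 0 := by rw [X.π_ι, map_zero]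
  have h1 : c.val (X.ι U (ξ.e U m)) 0 h0 = Z.κ U (ξ''.e U m) := by
    rw [← Z.ι_e, ← c.α_ι]
    rfl
  rw [← h1, ← c.val_add]
  congr 1
  · rw [X.ι_e]
  · rw [add_zero]

/-- Both ρ x and π x can be read off from α(x, y) and y. So x and x' differ by an element of M, on
which α is injective by `val_add_m`. -/
theorem val_injective {U : T} (x x' : X.Q.Sec U) (y : Y.Q.Sec U) (H : ap X.π U x = ap Y.ρ U y)
    (H' : ap X.π U x' = ap Y.ρ U y) (e : c.val x y H = c.val x' y H') : x = x' := by
  obtain ⟨m, rfl⟩ := X.exists_m_sub U x x' (by rw [← c.ρ_val x y H, e, c.ρ_val]) (H.trans H'.symm)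
  rw [c.val_add_m x' y H', add_eq_left] at e
  have := Z.κ_e_injective U (a₁ := m) (a₂ := 0) (e.trans (by simp))
  rw [this, map_zero, map_zero, add_zero]

/-- Locally some x has the required images on both sides. Then α(x, y) and z differ by an element of
M, which is added to x. The local solutions are unique by `val_injective`, so they glue. -/
theorem exists_val {U : T} (z : Z.Q.Sec U) (y : Y.Q.Sec U) (H : ap Z.π U z = ap Y.π U y) :
    ∃ (x : X.Q.Sec U) (h : ap X.π U x = ap Y.ρ U y), c.val x y h = z := by
  obtain ⟨x, hx⟩ := X.Q.exists_of_locally_unique (U := U)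
    (fun V h x => ∃ h1 : ap X.π V x = ap Y.ρ V (Y.Q.res h y), c.val x _ h1 = Z.Q.res h z) (by
      rintro V h W k x ⟨h1, h2⟩
      have h3 : ap X.π W (X.Q.res k x) = ap Y.ρ W (Y.Q.res (k ≫ h) y) := by
        rw [ap_res, h1, Y.Q.res_comp, ← ap_res]
      refine ⟨h3, ?_⟩
      rw [Z.Q.res_comp, ← h2]
      refine Eq.trans ?_ (ap_res c.α k (fiberProd.mk x _ h1))
      exact congrArg (ap c.α W) (fiberProd.ext rfl (Y.Q.res_comp _ _ _))) (by
      rintro V h x x' ⟨h1, h2⟩ ⟨h3, h4⟩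
      exact c.val_injective _ _ _ h1 h3 (h2.trans h4.symm)) (by
      refine (X.exists_of_pair U (ap Z.ρ U z) (ap Y.ρ U y) (by rw [Z.g_ρ, H, Y.g_ρ])).mono ?_
      rintro V h ⟨x, h1, h2⟩
      have h3 : ap X.π V x = ap Y.ρ V (Y.Q.res h y) := by rw [h2, ap_res]
      obtain ⟨m, hm⟩ := Z.exists_m_sub V (Z.Q.res h z) (c.val x _ h3)
        (by rw [c.ρ_val, h1, ap_res]) (by rw [c.π_val, ap_res, H, ap_res])
      exact ⟨x + X.κ V (ξ'.e V m), by rw [map_add, X.π_κ_e, add_zero, h3], by rw [hm, c.val_add_m x _ h3]⟩)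
  have h1 : ap X.π U x = ap Y.ρ U y := by
    refine ξ'.R.eq_of_locally (hx.mono ?_)
    rintro V h ⟨h2, -⟩
    rw [← ap_res, h2, ap_res]
  refine ⟨x, h1, Z.Q.eq_of_locally (hx.mono ?_)⟩
  rintro V h ⟨h2, h3⟩
  rw [← h3]
  exact (ap_res c.α h (fiberProd.mk x y h1)).symm

theorem ext_val {c c' : CompHom X Y Z} (H : ∀ (U : T) (x : X.Q.Sec U) (y : Y.Q.Sec U)
    (h : ap X.π U x = ap Y.ρ U y), c.val x y h = c'.val x y h) : c = c' :=
  CompHom.ext (ringHom_ext fun U p => H U p.1.1 p.1.2 p.2)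

@[simp] theorem precomp_val {X' : Butterfly ξ ξ'} (f : X' ⟶ X) {U : T} (x : X'.Q.Sec U) (y : Y.Q.Sec U)
    (h : ap X'.π U x = ap Y.ρ U y) :
    (c.precomp f).val x y h = c.val (ap f.φ U x) y (by rw [Hom.ap_π, h]) := rfl

end CompHom

end Butterfly
end Butterflies

namespace Butterflies
variable {T : Type u} [SmallCategory T] {J : GrothendieckTopology T}

/-! ### The A-structure of a butterfly as a ring map from P ×_A P'. -/

namespace Butterfly.CompHom
variable {B : RingSheaf J} {M : ModSheaf B} {ξ ξ' ξ'' : TwoExt B M} {X : Butterfly ξ ξ'}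
  {Y : Butterfly ξ' ξ''} {Z : Butterfly ξ ξ''} (c : CompHom X Y Z)

/-- The map `(x, y) ↦ (α (x, y), y)`. -/
def toPair : fiberProd X.π Y.ρ ⟶ fiberProd Z.π Y.π :=
  fiberProd.lift c.α (fiberProd.snd _ _) c.α_π

theorem toPair_bijective (U : T) : Function.Bijective (ap c.toPair U) := by
  constructor
  · intro p p' H
    have h2 : ap (fiberProd.snd X.π Y.ρ) U p = ap (fiberProd.snd X.π Y.ρ) U p' :=
      congrArg (ap (fiberProd.snd Z.π Y.π) U) H
    refine fiberProd.ext ?_ h2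
    obtain ⟨⟨x, y⟩, hp⟩ := p
    obtain ⟨⟨x', y'⟩, hp'⟩ := p'
    obtain rfl : y = y' := h2
    exact c.val_injective x x' y hp hp' (congrArg (ap (fiberProd.fst Z.π Y.π) U) H)
  · intro q
    obtain ⟨x, h, hx⟩ := c.exists_val q.1.1 q.1.2 q.2
    exact ⟨fiberProd.mk x q.1.2 h, fiberProd.ext hx rfl⟩

/-- The map sending `(z, y)` to the section `x` with `α (x, y) = z`. -/
noncomputable def sec : fiberProd Z.π Y.π ⟶ X.Q := invOfBijective c.toPair c.toPair_bijective ≫ fiberProd.fst _ _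

theorem sec_val {U : T} (x : X.Q.Sec U) (y : Y.Q.Sec U) (H : ap X.π U x = ap Y.ρ U y)
    (H' : ap Z.π U (c.val x y H) = ap Y.π U y) : ap c.sec U (fiberProd.mk (c.val x y H) y H') = x :=
  congrArg (ap (fiberProd.fst X.π Y.ρ) U) (ap_invOfBijective c.toPair c.toPair_bijective U (fiberProd.mk x y H))

theorem sec_eq_of_val {U : T} (x : X.Q.Sec U) (y : Y.Q.Sec U) (z : Z.Q.Sec U) (H : ap X.π U x = ap Y.ρ U y)
    (e : c.val x y H = z) (H' : ap Z.π U z = ap Y.π U y) : ap c.sec U (fiberProd.mk z y H') = x := by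
  subst e
  exact c.sec_val x y H H'

theorem π_sec {U : T} (z : Z.Q.Sec U) (y : Y.Q.Sec U) (H : ap Z.π U z = ap Y.π U y) :
    ap X.π U (ap c.sec U (fiberProd.mk z y H)) = ap Y.ρ U y := by
  obtain ⟨x, h, rfl⟩ := c.exists_val z y H
  rw [c.sec_val, h]

theorem val_sec {U : T} (z : Z.Q.Sec U) (y : Y.Q.Sec U) (H : ap Z.π U z = ap Y.π U y) :
    c.val (ap c.sec U (fiberProd.mk z y H)) y (c.π_sec z y H) = z := by
  obtain ⟨x, h, hx⟩ := c.exists_val z y H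
  have := c.sec_eq_of_val x y z h hx H
  simp only [this, hx]

theorem ρ_sec {U : T} (z : Z.Q.Sec U) (y : Y.Q.Sec U) (H : ap Z.π U z = ap Y.π U y) :
    ap X.ρ U (ap c.sec U (fiberProd.mk z y H)) = ap Z.ρ U z := by
  rw [← c.ρ_val _ y (c.π_sec z y H), c.val_sec]

end Butterfly.CompHom

section Algebras
variable {A : RingSheaf J} {B : Under A} {M : ModSheaf B.right}

/-- The map from the middle term of a butterfly `ξ|_C → η|_C` to `R`. -/
abbrev Butterfly.toR {B C : RingSheaf J} {M : ModSheaf B} {ξ η : TwoExt B M} {h : C ⟶ B}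
    (X : Butterfly (ξ.pullback h) (η.pullback h)) : X.Q ⟶ ξ.R := X.ρ ≫ fiberProd.fst ξ.g h

/-- The map from the middle term of a butterfly `ξ|_C → η|_C` to `R'`. -/
abbrev Butterfly.toR' {B C : RingSheaf J} {M : ModSheaf B} {ξ η : TwoExt B M} {h : C ⟶ B}
    (X : Butterfly (ξ.pullback h) (η.pullback h)) : X.Q ⟶ η.R := X.π ≫ fiberProd.fst η.g h

/-- The map from the middle term of a butterfly `ξ|_C → η|_C` to `C`. -/
abbrev Butterfly.bar {B C : RingSheaf J} {M : ModSheaf B} {ξ η : TwoExt B M} {h : C ⟶ B}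
    (X : Butterfly (ξ.pullback h) (η.pullback h)) : X.Q ⟶ C := X.ρ ≫ (ξ.pullback h).g

namespace Butterfly
variable {B C : RingSheaf J} {M : ModSheaf B} {ξ η : TwoExt B M} {h : C ⟶ B}
    (X : Butterfly (ξ.pullback h) (η.pullback h))

theorem bar_eq (U : T) (q : X.Q.Sec U) : ap (fiberProd.snd η.g h) U (ap X.π U q) = ap X.bar U q :=
  (X.g_ρ U q).symm

@[simp] theorem bar_ι (U : T) (n : ξ.N.Sec U) : ap X.bar U (X.ι U n) = 0 := X.g_ρ_ι U n

@[simp] theorem bar_κ (U : T) (n : η.N.Sec U) : ap X.bar U (X.κ U n) = 0 := by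
  change ap (ξ.pullback h).g U (ap X.ρ U (X.κ U n)) = 0
  rw [X.ρ_κ, map_zero]

@[simp] theorem toR_ι (U : T) (n : ξ.N.Sec U) : ap X.toR U (X.ι U n) = ξ.f U n :=
  congrArg (ap (fiberProd.fst ξ.g h) U) (X.ρ_ι U n)

@[simp] theorem toR_κ (U : T) (n : η.N.Sec U) : ap X.toR U (X.κ U n) = 0 := by
  change ap (fiberProd.fst ξ.g h) U (ap X.ρ U (X.κ U n)) = 0
  rw [X.ρ_κ, map_zero]

@[simp] theorem toR'_ι (U : T) (n : ξ.N.Sec U) : ap X.toR' U (X.ι U n) = 0 := by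
  change ap (fiberProd.fst η.g h) U (ap X.π U (X.ι U n)) = 0
  rw [X.π_ι, map_zero]

@[simp] theorem toR'_κ (U : T) (n : η.N.Sec U) : ap X.toR' U (X.κ U n) = - η.f U n :=
  congrArg (ap (fiberProd.fst η.g h) U) (X.π_κ U n)

theorem ρ_ext {U : T} {q q' : X.Q.Sec U} (h1 : ap X.toR U q = ap X.toR U q')
    (h2 : ap X.bar U q = ap X.bar U q') : ap X.ρ U q = ap X.ρ U q' := fiberProd.ext h1 h2

theorem π_ext {U : T} {q q' : X.Q.Sec U} (h1 : ap X.toR' U q = ap X.toR' U q')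
    (h2 : ap X.bar U q = ap X.bar U q') : ap X.π U q = ap X.π U q' := by
  refine fiberProd.ext h1 ?_
  rw [bar_eq, bar_eq, h2]

theorem g_toR (U : T) (q : X.Q.Sec U) : ap ξ.g U (ap X.toR U q) = ap h U (ap X.bar U q) :=
  (ap X.ρ U q).2

theorem g_toR' (U : T) (q : X.Q.Sec U) : ap η.g U (ap X.toR' U q) = ap h U (ap X.bar U q) := by
  rw [← X.bar_eq]
  exact (ap X.π U q).2

theorem ι_smul' (U : T) (q : X.Q.Sec U) (n : ξ.N.Sec U) : X.ι U (ap X.toR U q • n) = q * X.ι U n :=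
  X.ι_smul U q n

theorem κ_smul' (U : T) (q : X.Q.Sec U) (n : η.N.Sec U) : X.κ U (ap X.toR' U q • n) = q * X.κ U n :=
  X.κ_smul U q n

theorem κ_e_smul (U : T) (q : X.Q.Sec U) (m : M.Sec U) :
    X.κ U (η.e U (ap h U (ap X.bar U q) • m)) = q * X.κ U (η.e U m) := by
  rw [← X.g_toR', η.e_smul, X.κ_smul']

theorem ι_e' (U : T) (m : M.Sec U) : X.ι U (ξ.e U m) = X.κ U (η.e U m) := X.ι_e U m

theorem exists_m_sub' (U : T) (q q' : X.Q.Sec U) (h1 : ap X.toR U q = ap X.toR U q')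
    (h2 : ap X.toR' U q = ap X.toR' U q') (h3 : ap X.bar U q = ap X.bar U q') :
    ∃ m : M.Sec U, q = q' + X.κ U (η.e U m) :=
  X.exists_m_sub U q q' (X.ρ_ext h1 h3) (X.π_ext h2 h3)

theorem exists_m' (U : T) (q : X.Q.Sec U) (h1 : ap X.toR U q = 0)
    (h2 : ap X.toR' U q = 0) (h3 : ap X.bar U q = 0) :
    ∃ m : M.Sec U, X.κ U (η.e U m) = q := by
  obtain ⟨m, hm⟩ := X.exists_m_sub' U q 0 (by rw [h1, map_zero]) (by rw [h2, map_zero]) (by rw [h3, map_zero])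
  exact ⟨m, by rw [hm, zero_add]⟩

theorem exists_of_triple (U : T) (r : ξ.R.Sec U) (r' : η.R.Sec U) (c : C.Sec U) (H : ap ξ.g U r = ap h U c)
    (H' : ap η.g U r' = ap h U c) : Locally J U fun V k => ∃ q : X.Q.Sec V, ap X.toR V q = ξ.R.res k r ∧
      ap X.toR' V q = η.R.res k r' ∧ ap X.bar V q = C.res k c := by
  refine (X.exists_of_pair U (fiberProd.mk r c H) (fiberProd.mk r' c H') rfl).mono ?_
  rintro V k ⟨q, h1, h2⟩
  exact ⟨q, congrArg (ap (fiberProd.fst ξ.g h) V) h1, congrArg (ap (fiberProd.fst η.g h) V) h2,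
    congrArg (ap (fiberProd.snd ξ.g h) V) h1⟩

theorem exists_add' (U : T) (q : X.Q.Sec U) (H : ap X.bar U q = 0) :
    Locally J U fun V k => ∃ (n : ξ.N.Sec V) (n' : η.N.Sec V), X.Q.res k q = X.ι V n + X.κ V n' :=
  X.exists_add U q H

theorem locSurj_bar : LocSurj X.bar := X.locSurj_g_ρ

theorem exists_ι' (U : T) (q : X.Q.Sec U) (H : ap X.toR' U q = 0) (H' : ap X.bar U q = 0) :
    ∃ n : ξ.N.Sec U, X.ι U n = q :=
  X.exists_ι U q (fiberProd.ext H (by rw [bar_eq, H', map_zero]))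

section
variable {X} {Y : Butterfly (ξ.pullback h) (η.pullback h)} (φ : Hom X Y)

theorem Hom.ap_bar (U : T) (q : X.Q.Sec U) : ap Y.bar U (ap φ.φ U q) = ap X.bar U q :=
  congrArg (ap (fiberProd.snd ξ.g h) U) (φ.ap_ρ U q)

theorem Hom.ap_toR (U : T) (q : X.Q.Sec U) : ap Y.toR U (ap φ.φ U q) = ap X.toR U q :=
  congrArg (ap (fiberProd.fst ξ.g h) U) (φ.ap_ρ U q)

theorem Hom.ap_toR' (U : T) (q : X.Q.Sec U) : ap Y.toR' U (ap φ.φ U q) = ap X.toR' U q :=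
  congrArg (ap (fiberProd.fst η.g h) U) (φ.ap_π U q)

end

/-- A morphism of butterflies over `C` from its effect on sections. -/
def homMk {X Y : Butterfly (ξ.pullback h) (η.pullback h)} (φ : X.Q ⟶ Y.Q)
    (hι : ∀ U (n : ξ.N.Sec U), ap φ U (X.ι U n) = Y.ι U n)
    (hκ : ∀ U (n : η.N.Sec U), ap φ U (X.κ U n) = Y.κ U n)
    (h1 : ∀ U q, ap Y.toR U (ap φ U q) = ap X.toR U q) (h2 : ∀ U q, ap Y.toR' U (ap φ U q) = ap X.toR' U q)
    (h3 : ∀ U q, ap Y.bar U (ap φ U q) = ap X.bar U q) : X ⟶ Y where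
  φ := φ
  φ_ι := hι
  φ_κ := hκ
  φ_ρ := ringHom_ext fun U q => fiberProd.ext (h1 U q) (h3 U q)
  φ_π := ringHom_ext fun U q => fiberProd.ext (h2 U q) (by
    have := h3 U q
    rw [← X.bar_eq, ← Y.bar_eq] at this
    exact this)

end Butterfly

namespace AlgButterfly
variable {ξ η : AlgTwoExt B M} {C : Over B}

/-- The ring `P ×_A P'` of pairs of sections of the given splittings with the same image in `A`. -/
abbrev SplitPair (ξ η : AlgTwoExt B M) : RingSheaf J := fiberProd ξ.split.π η.split.π

/-- The ring map `P ×_A P' → Q` encoding the splitting over `A` of a butterfly of algebras. -/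
noncomputable def sec (X : AlgButterfly ξ η C) : SplitPair ξ η ⟶ X.bf.Q := X.α.sec ≫ fiberProd.fst _ _

variable (X : AlgButterfly ξ η C) {U : T} (p : ξ.split.Q.Sec U) (p' : η.split.Q.Sec U)
  (H : ap ξ.split.π U p = ap η.split.π U p')

theorem toR_sec : ap X.bf.toR U (ap X.sec U (fiberProd.mk p p' H)) = ap (ξ.split.ρ ≫ fiberProd.fst _ _) U p :=
  congrArg (ap (fiberProd.fst ξ.ext.g (str B)) U) (X.α.ρ_sec p p' H)

theorem toR'_sec : ap X.bf.toR' U (ap X.sec U (fiberProd.mk p p' H)) = ap (η.split.ρ ≫ fiberProd.fst _ _) U p' :=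
  congrArg (ap (fiberProd.fst η.ext.g (str B)) U) (X.α.π_sec p p' H)

theorem bar_split (ξ : AlgTwoExt B M) (p : ξ.split.Q.Sec U) :
    ap (fiberProd.snd ξ.ext.g (str B)) U (ap ξ.split.ρ U p) = ap ξ.split.π U p :=
  ξ.split.g_ρ U p

theorem bar_sec : ap X.bf.bar U (ap X.sec U (fiberProd.mk p p' H)) = ap (str C.left) U (ap ξ.split.π U p) := by
  refine (ap X.α.sec U (fiberProd.mk p p' H)).2.trans ?_
  refine congrArg (ap (str C.left) U) ?_
  rw [← bar_split]
  exact congrArg (ap (fiberProd.snd ξ.ext.g (str B)) U) (X.α.ρ_sec p p' H)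

theorem sec_ι (n : ξ.ext.N.Sec U) (H : ap ξ.split.π U (ξ.split.ι U n) = ap η.split.π U 0) :
    ap X.sec U (fiberProd.mk (ξ.split.ι U n) 0 H) = X.bf.ι U n :=
  congrArg (ap (fiberProd.fst _ (str C.left)) U)
    (X.α.sec_eq_of_val ((X.bf.restrict (str C.left) (str B) (str_toBase C)).ι U n) 0 (ξ.split.ι U n) _ (X.α.α_ι U n) H)

/-- This is the relation α(κ n, -ι n) = 0 of the composite, solved for its first component. -/
theorem sec_κ (n : η.ext.N.Sec U) (H : ap ξ.split.π U 0 = ap η.split.π U (- η.split.ι U n)) :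
    ap X.sec U (fiberProd.mk 0 (- η.split.ι U n) H) = X.bf.κ U n :=
  congrArg (ap (fiberProd.fst _ (str C.left)) U)
    (X.α.sec_eq_of_val ((X.bf.restrict (str C.left) (str B) (str_toBase C)).κ U n) (- η.split.ι U n) 0 _ (X.α.α_zero U n) H)

theorem snd_α_sec : ap (fiberProd.snd _ (str C.left)) U (ap X.α.sec U (fiberProd.mk p p' H)) = ap η.split.π U p' :=
  (congrArg (ap (fiberProd.snd η.ext.g (str B)) U) (X.α.π_sec p p' H)).trans (bar_split η p')

end AlgButterfly

/-- If x solves α(f x, y) = z, then f x is the solution for α itself, and solutions are unique. -/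
theorem Butterfly.CompHom.sec_precomp {B : RingSheaf J} {M : ModSheaf B} {ξ ξ' ξ'' : TwoExt B M}
    {X X' : Butterfly ξ ξ'} {Y : Butterfly ξ' ξ''} {Z : Butterfly ξ ξ''} (c : CompHom X Y Z) (f : X' ⟶ X)
    {U : T} (z : (fiberProd Z.π Y.π).Sec U) :
    ap f.φ U (ap (c.precomp f).sec U z) = ap c.sec U z := by
  obtain ⟨⟨z, y⟩, H⟩ := z
  obtain ⟨x, h, rfl⟩ := (c.precomp f).exists_val z y H
  refine (congrArg (ap f.φ U) ((c.precomp f).sec_val x y h H)).trans ?_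
  exact (c.sec_eq_of_val (ap f.φ U x) y _ (by rw [Hom.ap_π, h]) rfl H).symm

namespace AlgButterfly
variable {ξ η : AlgTwoExt B M} {C : Over B}

/-- A map out of the composite and its solution map determine each other. The gain is that P ×_A P'
is the same for both butterflies, so compatibility over A becomes an equation between maps out of
one fixed ring. -/
theorem comm_iff {X Y : AlgButterfly ξ η C} (f : X.bf ⟶ Y.bf) :
    Y.α.precomp (Butterfly.restrictMap f (str C.left) (str B) (str_toBase C)) = X.α ↔
      ∀ U z, ap f.φ U (ap X.sec U z) = ap Y.sec U z := by
  constructor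
  · intro e U z
    have := Y.α.sec_precomp (Butterfly.restrictMap f (str C.left) (str B) (str_toBase C)) z
    rw [e] at this
    exact congrArg (ap (fiberProd.fst _ (str C.left)) U) this
  · intro e
    refine Butterfly.CompHom.ext_val fun U x y h => ?_
    have H' : ap ξ.split.π U (X.α.val x y h) = ap η.split.π U y := X.α.π_val x y h
    have h1 := X.α.sec_val x y h H'
    have h2 := e U (fiberProd.mk _ y H')
    have h3 : ap Y.α.sec U (fiberProd.mk _ y H') =
        ap (Butterfly.Hom.φ (Butterfly.restrictMap f (str C.left) (str B) (str_toBase C))) U x := by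
      refine fiberProd.ext ?_ ?_
      · refine h2.symm.trans ?_
        exact congrArg (fun t => ap f.φ U (ap (fiberProd.fst _ (str C.left)) U t)) h1
      -- The component in A is the image of y for both butterflies, so only the component in the
      -- middle term carries information.
      · refine (Y.snd_α_sec _ y H').trans ?_
        refine (X.snd_α_sec _ y H').symm.trans ?_
        exact congrArg (ap (fiberProd.snd _ (str C.left)) U) h1
    have h4 := Y.α.val_sec _ y H'
    rw [Butterfly.CompHom.precomp_val, ← h4]
    congr 1
    exact h3.symm

theorem Hom.ap_sec {X Y : AlgButterfly ξ η C} (f : X ⟶ Y) (U : T) (z : (SplitPair ξ η).Sec U) :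
    ap (Hom.f f).φ U (ap X.sec U z) = ap Y.sec U z := (comm_iff (Hom.f f)).1 f.comm U z

/-- A morphism of butterflies of algebras from a morphism of butterflies. -/
def homMk {X Y : AlgButterfly ξ η C} (f : X.bf ⟶ Y.bf) (H : ∀ U z, ap f.φ U (ap X.sec U z) = ap Y.sec U z) :
    X ⟶ Y := ⟨f, (comm_iff f).2 H⟩

theorem isIso {X Y : AlgButterfly ξ η C} (f : X ⟶ Y) : IsIso f := by
  refine ⟨homMk (Butterfly.Hom.inv (Hom.f f)) ?_, Hom.ext ?_, Hom.ext ?_⟩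
  · intro U z
    rw [← Hom.ap_sec f]
    exact ap_invOfBijective _ _ _ _
  · exact Butterfly.Hom.comp_inv _
  · exact Butterfly.Hom.inv_comp _

section OfSec
variable (X : Butterfly (ξ.ext.pullback (toBase C)) (η.ext.pullback (toBase C))) (μ : SplitPair ξ η ⟶ X.Q)

/-- The properties of the ring map `P ×_A P' → Q` encoding a splitting over `A` of a butterfly. -/
structure IsSec : Prop where
  toR : ∀ (U : T) (z : (SplitPair ξ η).Sec U), ap X.toR U (ap μ U z) = ap (fiberProd.fst _ _ ≫ ξ.split.ρ ≫ fiberProd.fst _ _) U z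
  toR' : ∀ (U : T) (z : (SplitPair ξ η).Sec U), ap X.toR' U (ap μ U z) = ap (fiberProd.snd _ _ ≫ η.split.ρ ≫ fiberProd.fst _ _) U z
  bar : ∀ (U : T) (z : (SplitPair ξ η).Sec U), ap X.bar U (ap μ U z) = ap (str C.left) U (ap (fiberProd.fst _ _ ≫ ξ.split.π) U z)
  ι : ∀ (U : T) (n : ξ.ext.N.Sec U), ap μ U (fiberProd.mk (ξ.split.ι U n) 0 (by rw [ξ.split.π_ι, map_zero])) = X.ι U n
  κ : ∀ (U : T) (n : η.ext.N.Sec U), ap μ U (fiberProd.mk 0 (- η.split.ι U n) (by rw [map_neg, η.split.π_ι, map_zero, neg_zero])) = X.κ U n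

theorem isSec_sec (X : AlgButterfly ξ η C) : IsSec X.bf X.sec where
  toR U z := X.toR_sec z.1.1 z.1.2 z.2
  toR' U z := X.toR'_sec z.1.1 z.1.2 z.2
  bar U z := X.bar_sec z.1.1 z.1.2 z.2
  ι U n := X.sec_ι n _
  κ U n := X.sec_κ n _

variable {X μ}

/-- The pair is the difference of (ι e m, 0) and (0, -ι e' m), whose values ι e m and κ e' m
coincide in Q. -/
theorem IsSec.ι_κ_e (hμ : IsSec X μ) (U : T) (m : M.Sec U) (H : ap ξ.split.π U (ξ.split.ι U (ξ.ext.e U m)) = ap η.split.π U (η.split.ι U (η.ext.e U m))) :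
    ap μ U (fiberProd.mk (ξ.split.ι U (ξ.ext.e U m)) (η.split.ι U (η.ext.e U m)) H) = 0 := by
  have h1 := hμ.ι U (ξ.ext.e U m)
  have h2 := hμ.κ U (η.ext.e U m)
  rw [X.ι_e', ← h2, ← sub_eq_zero, ← map_sub] at h1
  rw [← h1]
  congr 1
  refine fiberProd.ext ?_ ?_
  · exact (sub_zero _).symm
  · change η.split.ι U (η.ext.e U m) = 0 - - η.split.ι U (η.ext.e U m)
    rw [zero_sub, neg_neg]

/-- The map from `P ×_A P'` to the pullback of `Q` to `A`. -/
def secRestrict (hμ : IsSec X μ) : SplitPair ξ η ⟶ (X.restrict (str C.left) (str B) (str_toBase C)).Q :=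
  fiberProd.lift μ (fiberProd.fst _ _ ≫ ξ.split.π) (ringHom_ext hμ.bar)

/-- The inverse of the isomorphism encoding the splitting. -/
def secPair (hμ : IsSec X μ) : SplitPair ξ η ⟶ fiberProd (X.restrict (str C.left) (str B) (str_toBase C)).π η.split.ρ :=
  fiberProd.lift (secRestrict hμ) (fiberProd.snd _ _) (ringHom_ext fun U z =>
    fiberProd.ext (hμ.toR' U z) (z.2.trans (bar_split η z.1.2).symm))

/-- For injectivity, a pair (p, 0) in the kernel has p = ι n, and μ sends it to ι n, so n = 0. For
surjectivity, choose locally some p over the image of p' in A. The error q - μ(p, p') vanishes in R'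
and C, so it equals ι n, and p is replaced by p + ι n. -/
theorem secPair_bijective (hμ : IsSec X μ) (U : T) : Function.Bijective (ap (secPair hμ) U) := by
  have inj (V : T) : Function.Injective (ap (secPair hμ) V) := by
    rw [injective_iff_map_eq_zero]
    rintro ⟨⟨p, p'⟩, H⟩ hz
    obtain rfl : p' = 0 := congrArg (ap (fiberProd.snd _ _) V) hz
    have hμ0 : ap μ V ⟨(p, 0), H⟩ = 0 := congrArg (fun t => ap (fiberProd.fst _ _) V (ap (fiberProd.fst _ _) V t)) hz
    obtain ⟨n, hn⟩ := ξ.split.exists_ι V p (Eq.trans H (map_zero (ap η.split.π V)))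
    have hn' : ξ.split.ι V n = p := hn
    subst hn'
    have h1 := (hμ.ι V n).symm.trans hμ0
    have h2 := X.ι_injective V (h1.trans (map_zero _).symm)
    subst h2
    exact fiberProd.ext (map_zero (ξ.split.ι V)) rfl
  refine ⟨inj U, fun x => exists_global_preimage _ inj x ?_⟩
  obtain ⟨⟨⟨⟨q, a⟩, hq⟩, p'⟩, hx⟩ := x
  have hq' : ap X.bar U q = ap (str C.left) U a := hq
  have hx1 : ap X.toR' U q = ap (η.split.ρ ≫ fiberProd.fst _ _) U p' := congrArg (ap (fiberProd.fst _ _) U) hx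
  have hx2 : a = ap η.split.π U p' := (congrArg (ap (fiberProd.snd _ _) U) hx).trans (bar_split η p')
  subst hx2
  refine (ξ.split.locSurj_π U (ap η.split.π U p')).mono ?_
  rintro V h ⟨p, hp⟩
  have hp' : ap ξ.split.π V p = ap η.split.π V (η.split.Q.res h p') := by rw [hp, ap_res]
  obtain ⟨n, hn⟩ := X.exists_ι' V (X.Q.res h q - ap μ V (fiberProd.mk p (η.split.Q.res h p') hp')) (by
      rw [map_sub, sub_eq_zero, hμ.toR', ap_res, hx1, ← ap_res]
      rfl) (by
      rw [map_sub, sub_eq_zero, hμ.bar, ap_res, hq', ← ap_res]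
      exact congrArg (ap (str C.left) V) hp.symm)
  have hz : ap ξ.split.π V (p + ξ.split.ι V n) = ap η.split.π V (η.split.Q.res h p') := by
    rw [map_add, ξ.split.π_ι, add_zero, hp']
  refine ⟨fiberProd.mk (p + ξ.split.ι V n) (η.split.Q.res h p') hz, fiberProd.ext (fiberProd.ext ?_ ?_) rfl⟩
  · change ap μ V _ = X.Q.res h q
    rw [← hμ.ι] at hn
    rw [eq_comm, ← sub_add_cancel (X.Q.res h q), ← hn, ← map_add]
    congr 1
    refine fiberProd.ext (add_comm _ _) (zero_add _).symm |>.symm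
  · exact hz.trans (ap_res η.split.π h p')

theorem invSecPair (hμ : IsSec X μ) (U : T)
    (x : (fiberProd (X.restrict (str C.left) (str B) (str_toBase C)).π η.split.ρ).Sec U)
    (z : (SplitPair ξ η).Sec U) (h : ap (secPair hμ) U z = x) :
    ap (invOfBijective _ (secPair_bijective hμ) ≫ fiberProd.fst _ _) U x = ap (fiberProd.fst _ _) U z := by
  subst h
  rw [ap_comp, ap_invOfBijective]

/-- A butterfly of algebras from a butterfly and the ring map encoding its splitting. -/
noncomputable def ofSec (hμ : IsSec X μ) : AlgButterfly ξ η C where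
  bf := X
  α :=
    { α := invOfBijective _ (secPair_bijective hμ) ≫ fiberProd.fst _ _
      α_zero := fun U n => by
        refine invSecPair hμ U _ (fiberProd.mk 0 (- η.split.ι U n) (by
          rw [map_neg, η.split.π_ι, map_zero, neg_zero])) (fiberProd.ext (fiberProd.ext (hμ.κ U n) ?_) rfl)
        exact map_zero (ap ξ.split.π U)
      α_ι := fun U n => by
        refine invSecPair hμ U _ (fiberProd.mk (ξ.split.ι U n) 0 (by
          rw [ξ.split.π_ι, map_zero])) (fiberProd.ext (fiberProd.ext (hμ.ι U n) ?_) rfl)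
        exact ξ.split.π_ι U n
      -- The target of the splittings is the trivial extension, so κ m = ι(e m) in P and similarly
      -- in P'. By `ι_κ_e` the pair of these sections goes to 0 in Q, which is the required first
      -- component.
      α_κ := fun U m => by
        have h := ξ.split.ι_e U m
        have h' := η.split.ι_e U m
        have H : ap ξ.split.π U (ξ.split.κ U m) = ap η.split.π U (η.split.κ U m) :=
          (ξ.split.π_κ U m).trans (η.split.π_κ U m).symm
        refine invSecPair hμ U _ (fiberProd.mk (ξ.split.κ U m) (η.split.κ U m) H)
          (fiberProd.ext (fiberProd.ext ?_ ?_) rfl)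
        · have H' : ap ξ.split.π U (ξ.split.ι U (ξ.ext.e U m)) = ap η.split.π U (η.split.ι U (η.ext.e U m)) :=
            (ξ.split.π_ι U _).trans (η.split.π_ι U _).symm
          have e : (fiberProd.mk (ξ.split.κ U m) (η.split.κ U m) H : (SplitPair ξ η).Sec U) =
              fiberProd.mk (ξ.split.ι U (ξ.ext.e U m)) (η.split.ι U (η.ext.e U m)) H' :=
            fiberProd.ext h.symm h'.symm
          exact (congrArg (ap μ U) e).trans (hμ.ι_κ_e U m H')
        · exact (ξ.split.π_κ U m).trans neg_zero
      α_ρ := ringHom_ext fun U x => by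
        obtain ⟨z, rfl⟩ := (secPair_bijective hμ U).2 x
        have := invSecPair hμ U _ z rfl
        rw [ap_comp, this]
        refine fiberProd.ext (hμ.toR U z).symm (bar_split ξ z.1.1)
      α_π := ringHom_ext fun U x => by
        obtain ⟨z, rfl⟩ := (secPair_bijective hμ U).2 x
        have := invSecPair hμ U _ z rfl
        rw [ap_comp, this]
        exact z.2 }

theorem sec_ofSec (hμ : IsSec X μ) : (ofSec hμ).sec = μ := ringHom_ext fun U z => by
  have h1 := (ofSec hμ).α.sec_eq_of_val (ap (secRestrict hμ) U z) z.1.2 z.1.1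
    ((ap (secPair hμ) U z).2) (invSecPair hμ U _ z rfl) z.2
  exact congrArg (ap (fiberProd.fst _ (str C.left)) U) h1

end OfSec

end AlgButterfly
end Algebras
end Butterflies

namespace Butterflies
variable {T : Type u} [SmallCategory T] {J : GrothendieckTopology T}

/-! ### Automorphisms of butterflies and derivations. -/

section Algebras
variable {A : RingSheaf J} {B : Under A} {M : ModSheaf B.right}

namespace AlgButterfly
variable {ξ η : AlgTwoExt B M} {C : Over B} (X : AlgButterfly ξ η C)

/-- The inclusion `M → Q`. -/
abbrev inc (X : AlgButterfly ξ η C) (U : T) : M.Sec U →+ X.bf.Q.Sec U := (X.bf.κ U).comp (η.ext.e U)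

theorem inc_injective (U : T) : Function.Injective (X.inc U) := X.bf.κ_e_injective U

theorem inc_res {U V : T} (h : V ⟶ U) (m : M.Sec U) : X.inc V (M.res h m) = X.bf.Q.res h (X.inc U m) :=
  (congrArg (X.bf.κ V) (η.ext.e_res h m)).trans (X.bf.κ_res h _)

theorem mul_inc (U : T) (q : X.bf.Q.Sec U) (m : M.Sec U) :
    q * X.inc U m = X.inc U (ap (toBase C) U (ap X.bf.bar U q) • m) := (X.bf.κ_e_smul U q m).symm

/-- Q acts on M through its image in C, and M goes to 0 there. -/
theorem inc_mul_inc (U : T) (m m' : M.Sec U) : X.inc U m * X.inc U m' = 0 := by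
  refine (X.mul_inc U _ m').trans ?_
  rw [show ap X.bf.bar U (X.inc U m) = 0 from X.bf.bar_κ U _, map_zero, zero_smul, map_zero]

/-- The ring endomorphism of `Q` defined by a derivation. -/
def derMap (d : Der M C) : X.bf.Q ⟶ X.bf.Q :=
  mkHom (fun U =>
    { toFun := fun q => q + X.inc U (d.1 U (ap X.bf.bar U q))
      map_one' := by
        have h := d.2.2.2 U 1
        rw [map_one] at h
        rw [map_one, h, map_zero, add_zero]
      map_zero' := by rw [map_zero, map_zero, map_zero, add_zero]
      map_add' := fun x y => by rw [map_add, map_add, map_add]; abel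
      map_mul' := fun x y => by
        rw [map_mul, d.2.2.1, map_add, ← X.mul_inc, ← X.mul_inc]
        -- The Leibniz rule supplies the two cross terms, and the remaining product of the two
        -- corrections vanishes because M has square zero.
        linear_combination -(X.inc_mul_inc U (d.1 U (ap X.bf.bar U x)) (d.1 U (ap X.bf.bar U y))) })
    (fun {U V} h q => by
      change X.bf.Q.res h q + X.inc V (d.1 V (ap X.bf.bar V (X.bf.Q.res h q))) = X.bf.Q.res h (q + _)
      rw [map_add, ap_res, d.2.1, X.inc_res])

theorem ap_derMap (d : Der M C) (U : T) (q : X.bf.Q.Sec U) :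
    ap (X.derMap d) U q = q + X.inc U (d.1 U (ap X.bf.bar U q)) := rfl

/-- The endomorphism of a butterfly defined by a derivation. -/
def derHom (d : Der M C) : X ⟶ X :=
  homMk (Butterfly.homMk (X.derMap d)
    (fun U n => by rw [ap_derMap, X.bf.bar_ι, map_zero, map_zero, add_zero])
    (fun U n => by rw [ap_derMap, X.bf.bar_κ, map_zero, map_zero, add_zero])
    (fun U q => by
      rw [ap_derMap, map_add]
      exact (congrArg _ (X.bf.toR_κ U _)).trans (add_zero _))
    (fun U q => by
      rw [ap_derMap, map_add]
      refine (congrArg _ (X.bf.toR'_κ U _)).trans ?_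
      rw [η.ext.f_e, neg_zero, add_zero])
    (fun U q => by
      rw [ap_derMap, map_add]
      exact (congrArg _ (X.bf.bar_κ U _)).trans (add_zero _)))
    -- Sections coming from P ×_A P' lie over the image of A in C, where d is zero.
    (fun U z => by
      change ap (X.derMap d) U _ = _
      rw [ap_derMap, (isSec_sec X).bar, d.2.2.2, map_zero, add_zero])

theorem derHom_f (d : Der M C) (U : T) (q : X.bf.Q.Sec U) :
    ap (Hom.f (X.derHom d)).φ U q = q + X.inc U (d.1 U (ap X.bf.bar U q)) := rfl

section
variable {X} (f : X ⟶ X)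

/-- An endomorphism fixes ι N and κ N', and these locally generate the kernel of Q → C. -/
theorem sub_eq_of_bar_eq {U : T} (q q' : X.bf.Q.Sec U) (h : ap X.bf.bar U q = ap X.bf.bar U q') :
    ap (Hom.f f).φ U q - q = ap (Hom.f f).φ U q' - q' := by
  refine X.bf.Q.eq_of_locally ((X.bf.exists_add' U (q - q') (by rw [map_sub, h, sub_self])).mono ?_)
  rintro V k ⟨n, n', hn⟩
  have h1 : ap (Hom.f f).φ V (X.bf.Q.res k (q - q')) = X.bf.Q.res k (q - q') := by
    rw [hn, map_add, (Hom.f f).φ_ι, (Hom.f f).φ_κ]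
  rw [map_sub, map_sub] at h1
  rw [map_sub, map_sub, ← ap_res, ← ap_res]
  linear_combination h1

theorem exists_m_of_hom {U : T} (q : X.bf.Q.Sec U) : ∃ m : M.Sec U, X.inc U m = ap (Hom.f f).φ U q - q :=
  X.bf.exists_m' U _ (by rw [map_sub, Butterfly.Hom.ap_toR, sub_self])
    (by rw [map_sub, Butterfly.Hom.ap_toR', sub_self]) (by rw [map_sub, Butterfly.Hom.ap_bar, sub_self])

/-- The difference f(q) - q lies in M and depends only on the image of q in C, so its values on
local lifts of c glue. Because the formula holds for every lift, each axiom of a derivation can be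
checked on lifts chosen for the purpose. -/
theorem exists_der (U : T) (c : C.left.right.Sec U) : ∃ m : M.Sec U, ∀ (V : T) (h : V ⟶ U)
    (q : X.bf.Q.Sec V), ap X.bf.bar V q = C.left.right.res h c →
      ap (Hom.f f).φ V q = q + X.inc V (M.res h m) := by
  obtain ⟨m, hm⟩ := M.exists_of_locally_unique (U := U) (fun V h m => ∃ q : X.bf.Q.Sec V,
      ap X.bf.bar V q = C.left.right.res h c ∧ ap (Hom.f f).φ V q - q = X.inc V m) (by
      rintro V h W k m ⟨q, h1, h2⟩
      exact ⟨X.bf.Q.res k q, by rw [ap_res, h1, RingSheaf.res_comp], by rw [ap_res, ← map_sub, h2, X.inc_res]⟩) (by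
      rintro V h m m' ⟨q, h1, h2⟩ ⟨q', h1', h2'⟩
      exact X.inc_injective V (h2.symm.trans ((sub_eq_of_bar_eq f q q' (h1.trans h1'.symm)).trans h2')))
      ((X.bf.locSurj_bar U c).mono (by
      rintro V h ⟨q, hq⟩
      obtain ⟨m, hm⟩ := exists_m_of_hom f q
      exact ⟨m, q, hq, hm.symm⟩))
  refine ⟨m, fun V h q hq => X.bf.Q.eq_of_locally ((hm.pull h).mono ?_)⟩
  rintro W k ⟨q', h1, h2⟩
  have := sub_eq_of_bar_eq f (X.bf.Q.res k q) q' (by rw [ap_res, hq, h1, RingSheaf.res_comp])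
  rw [h2, ap_res, sub_eq_iff_eq_add'] at this
  rw [this, map_add, ← X.inc_res, M.res_comp]

/-- The value at a section of the derivation defined by an endomorphism of a butterfly. -/
noncomputable def derFun (U : T) (c : C.left.right.Sec U) : M.Sec U := (exists_der f U c).choose

theorem inc_derFun {U : T} (c : C.left.right.Sec U) {V : T} (h : V ⟶ U) (q : X.bf.Q.Sec V)
    (hq : ap X.bf.bar V q = C.left.right.res h c) :
    X.inc V (M.res h (derFun f U c)) = ap (Hom.f f).φ V q - q := by
  rw [derFun, (exists_der f U c).choose_spec V h q hq, add_sub_cancel_left]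

theorem derFun_add (U : T) (x y : C.left.right.Sec U) : derFun f U (x + y) = derFun f U x + derFun f U y := by
  refine M.eq_of_locally (((X.bf.locSurj_bar U x).and (X.bf.locSurj_bar U y)).mono ?_)
  rintro V h ⟨⟨q, hq⟩, ⟨q', hq'⟩⟩
  apply X.inc_injective
  rw [map_add, map_add, inc_derFun f x h q hq, inc_derFun f y h q' hq', inc_derFun f (x + y) h (q + q') (by
    rw [map_add, hq, hq', map_add]), map_add]
  ring

theorem derFun_res {U V : T} (h : V ⟶ U) (x : C.left.right.Sec U) :
    derFun f V (C.left.right.res h x) = M.res h (derFun f U x) := by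
  refine M.eq_of_locally ((X.bf.locSurj_bar V (C.left.right.res h x)).mono ?_)
  rintro W k ⟨q, hq⟩
  apply X.inc_injective
  rw [← M.res_comp]
  refine (inc_derFun f _ k q hq).trans (inc_derFun f x (k ≫ h) q ?_).symm
  rw [hq, RingSheaf.res_comp]

theorem derFun_mul (U : T) (x y : C.left.right.Sec U) : derFun f U (x * y) =
    ap (toBase C) U x • derFun f U y + ap (toBase C) U y • derFun f U x := by
  refine M.eq_of_locally (((X.bf.locSurj_bar U x).and (X.bf.locSurj_bar U y)).mono ?_)
  rintro V h ⟨⟨q, hq⟩, ⟨q', hq'⟩⟩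
  apply X.inc_injective
  have h1 := inc_derFun f x h q hq
  have h2 := inc_derFun f y h q' hq'
  -- If f(q) = q + a and f(q') = q' + b, then f(qq') - qq' = qb + q'a + ab, and ab = 0.
  have h3 := X.inc_mul_inc V (M.res h (derFun f U x)) (M.res h (derFun f U y))
  rw [inc_derFun f (x * y) h (q * q') (by rw [map_mul, hq, hq', map_mul]), map_add, map_add, M.res_smul,
    M.res_smul, ← ap_res, ← ap_res, ← hq, ← hq', ← X.mul_inc, ← X.mul_inc, h1, h2, map_mul]
  rw [h1, h2] at h3
  linear_combination h3

/-- Locally a lifts to P ×_A P', whose image in Q supplies a lift of a that f fixes. -/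
theorem derFun_str (U : T) (a : A.Sec U) : derFun f U (ap (str C.left) U a) = 0 := by
  refine M.eq_of_locally ((ξ.split.locSurj_π U a).bind' ?_)
  rintro V h ⟨p, hp⟩
  refine (η.split.locSurj_π V (A.res h a)).mono ?_
  rintro W k ⟨p', hp'⟩
  have H : ap ξ.split.π W (ξ.split.Q.res k p) = ap η.split.π W p' := by
    rw [ap_res, hp, hp']
  apply X.inc_injective
  refine (inc_derFun f _ (k ≫ h) (ap X.sec W (fiberProd.mk _ p' H)) ?_).trans ?_
  · rw [X.bar_sec, ap_res, hp]
    refine (congrArg (ap (str C.left) W) (A.res_comp h k a).symm).trans (ap_res _ _ _)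
  · rw [Hom.ap_sec, sub_self, map_zero, map_zero]

/-- The derivation defined by an endomorphism of a butterfly. -/
noncomputable def derOfHom : Der M C :=
  ⟨fun U => AddMonoidHom.mk' (derFun f U) (derFun_add f U), derFun_res f, derFun_mul f, derFun_str f⟩

theorem derOfHom_spec {U : T} (q : X.bf.Q.Sec U) :
    ap (Hom.f f).φ U q = q + X.inc U ((derOfHom f).1 U (ap X.bf.bar U q)) := by
  have := (exists_der f U (ap X.bf.bar U q)).choose_spec U (𝟙 U) q (RingSheaf.res_id _ _ _).symm
  rw [M.res_id] at this
  exact this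

theorem derHom_derOfHom : X.derHom (derOfHom f) = f :=
  hom_ext (ringHom_ext fun U q => (derOfHom_spec f q).symm)

end

theorem derHom_injective {d d' : Der M C} (H : X.derHom d = X.derHom d') : d = d' := by
  refine Subtype.ext (funext fun U => AddMonoidHom.ext fun c => M.eq_of_locally ((X.bf.locSurj_bar U c).mono ?_))
  rintro V h ⟨q, hq⟩
  have h1 := congrArg (fun t : X ⟶ X => ap (Hom.f t).φ V q) H
  change q + _ = q + _ at h1
  have h2 := X.inc_injective V (add_left_cancel h1)
  have h2' : d.1 V (ap X.bf.bar V q) = d'.1 V (ap X.bf.bar V q) := h2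
  rw [hq, d.2.1, d'.2.1] at h2'
  exact h2'

theorem derHom_comp (d d' : Der M C) : X.derHom d ≫ X.derHom d' = X.derHom (d + d') := by
  refine hom_ext (ringHom_ext fun U q => ?_)
  change ap (X.derMap d') U (ap (X.derMap d) U q) = _
  rw [ap_derMap, derHom_f, show ap X.bf.bar U (ap (X.derMap d) U q) = ap X.bf.bar U q from
    Butterfly.Hom.ap_bar (Hom.f (X.derHom d)) U q, ap_derMap]
  change _ = q + X.inc U (d.1 U _ + d'.1 U _)
  rw [map_add, add_assoc]

theorem derHom_zero : X.derHom 0 = 𝟙 X := by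
  refine hom_ext (ringHom_ext fun U q => ?_)
  rw [derHom_f]
  exact (congrArg (q + ·) (map_zero (X.inc U))).trans (add_zero q)

/-- The isomorphism of `Der_A(C, M)` with the automorphism group of a butterfly over `C`. -/
noncomputable def derIso : Multiplicative (Der M C) ≃* Aut X where
  toFun d := ⟨X.derHom d.toAdd, X.derHom (-d.toAdd), by rw [derHom_comp, add_neg_cancel, derHom_zero],
    by rw [derHom_comp, neg_add_cancel, derHom_zero]⟩
  invFun f := .ofAdd (derOfHom f.hom)
  left_inv d := X.derHom_injective (derHom_derOfHom _)
  right_inv f := Iso.ext (derHom_derOfHom _)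
  map_mul' d d' := Iso.ext (by
    -- Multiplication in `Aut` is composition in the opposite order, hence the exchange of the
    -- summands.
    change X.derHom (d.toAdd + d'.toAdd) = X.derHom d'.toAdd ≫ X.derHom d.toAdd
    rw [derHom_comp, add_comm])

theorem derHom_comm {X Y : AlgButterfly ξ η C} (f : X ⟶ Y) (d : Der M C) :
    X.derHom d ≫ f = f ≫ Y.derHom d := by
  refine hom_ext (ringHom_ext fun U q => ?_)
  change ap (Hom.f f).φ U (q + X.inc U (d.1 U (ap X.bf.bar U q))) = ap (Hom.f f).φ U q +
    Y.inc U (d.1 U (ap Y.bf.bar U (ap (Hom.f f).φ U q)))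
  rw [map_add, Butterfly.Hom.ap_bar]
  exact congrArg _ ((Hom.f f).φ_κ U _)

theorem derHom_restrict {D : Over B} (k : D ⟶ C) (d : Der M C) :
    (restrict k).map (X.derHom d) = (restrictObj k X).derHom (Der.comp M k d) := by
  refine hom_ext (ringHom_ext fun U q => fiberProd.ext ?_ ?_)
  · obtain ⟨⟨q, c⟩, hq⟩ := q
    have hq' : ap X.bf.bar U q = ap (ringMap k) U c := hq
    refine congrArg (fun t => q + X.inc U (d.1 U t)) hq'
  · obtain ⟨⟨q, c⟩, hq⟩ := q
    exact (add_zero c).symm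

end AlgButterfly

/-- The banding of `Isom(ξ, η)` by derivations. -/
noncomputable def isomBanding (ξ η : AlgTwoExt B M) : Banding (Isom ξ η) (derPresheaf B M) where
  iso C x := AlgButterfly.derIso (C := C) (ξ := ξ) (η := η) x
  comm C x y f d := AlgButterfly.derHom_comm (C := C) (ξ := ξ) (η := η) f d
  map C D k x d := AlgButterfly.derHom_restrict (C := C) (ξ := ξ) (η := η) x k d

end Algebras
end Butterflies

namespace Butterflies
variable {T : Type u} [SmallCategory T] {J : GrothendieckTopology T}

/-! ### Quotient sheaves by presheaves of ideals. -/

section Quotient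
variable (F : Tᵒᵖ ⥤ CommRingCat.{u}) (I : ∀ U : T, Ideal (F.obj (op U)))
  (hI : ∀ {U V : T} (h : V ⟶ U) x, x ∈ I U → (F.map h.op).hom x ∈ I V)

/-- The quotient of a presheaf of rings by a presheaf of ideals. -/
def quotPresheaf : Tᵒᵖ ⥤ CommRingCat.{u} where
  obj U := CommRingCat.of (F.obj U ⧸ I U.unop)
  map {U V} h := CommRingCat.ofHom (Ideal.quotientMap (I V.unop) (F.map h).hom fun x hx => hI h.unop x hx)
  map_id U := by
    refine CommRingCat.hom_ext (RingHom.ext fun x => ?_)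
    obtain ⟨x, rfl⟩ := Ideal.Quotient.mk_surjective x
    exact congrArg (fun t => Ideal.Quotient.mk (I U.unop) (t.hom x)) (F.map_id U)
  map_comp h k := by
    refine CommRingCat.hom_ext (RingHom.ext fun x => ?_)
    obtain ⟨x, rfl⟩ := Ideal.Quotient.mk_surjective x
    exact congrArg (fun t => Ideal.Quotient.mk (I _) (t.hom x)) (F.map_comp h k)

/-- The quotient sheaf of a presheaf of rings by a presheaf of ideals. -/
noncomputable def quotSheaf : RingSheaf J := ringSheafify (quotPresheaf F I hI)

/-- The projection to the quotient sheaf. -/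
noncomputable def toQuot (U : T) : F.obj (op U) →+* (quotSheaf (J := J) F I hI).Sec U :=
  (toSheafSec (quotPresheaf F I hI) U).comp (Ideal.Quotient.mk (I U))

theorem toQuot_res {U V : T} (h : V ⟶ U) (x : F.obj (op U)) :
    toQuot (J := J) F I hI V ((F.map h.op).hom x) = (quotSheaf F I hI).res h (toQuot F I hI U x) :=
  toSheafSec_res (quotPresheaf F I hI) h (Ideal.Quotient.mk (I U) x)

theorem toQuot_locally_surj (U : T) (s : (quotSheaf (J := J) F I hI).Sec U) :
    Locally J U fun V h => ∃ x, toQuot F I hI V x = (quotSheaf F I hI).res h s :=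
  (toSheafSec_locally_surj (quotPresheaf F I hI) U s).mono (by
    rintro V h ⟨x, hx⟩
    obtain ⟨x, rfl⟩ := Ideal.Quotient.mk_surjective x
    exact ⟨x, hx⟩)

theorem toQuot_eq_zero_iff (U : T) (x : F.obj (op U)) :
    toQuot (J := J) F I hI U x = 0 ↔ Locally J U fun V h => (F.map h.op).hom x ∈ I V := by
  constructor
  · intro H
    refine (locally_eq_of_toSheafSec_eq (quotPresheaf F I hI) U (Ideal.Quotient.mk (I U) x) 0
      (H.trans (map_zero _).symm)).mono fun V h hh => ?_
    rw [map_zero] at hh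
    exact Ideal.Quotient.eq_zero_iff_mem.1 hh
  · intro H
    refine RingSheaf.eq_of_locally _ (H.mono fun V h hh => ?_)
    rw [← toQuot_res, map_zero]
    exact (congrArg (toSheafSec (quotPresheaf F I hI) V) (Ideal.Quotient.eq_zero_iff_mem.2 hh)).trans (map_zero _)

variable {F I} {X : RingSheaf J} (w : ∀ U : T, F.obj (op U) →+* X.Sec U)
  (w_res : ∀ {U V : T} (h : V ⟶ U) x, w V ((F.map h.op).hom x) = X.res h (w U x))
  (hw : ∀ U x, x ∈ I U → w U x = 0)

/-- Maps from the quotient sheaf. -/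
noncomputable def quotDesc : quotSheaf F I hI ⟶ X :=
  sheafifyDesc (quotPresheaf F I hI)
    { app := fun U => CommRingCat.ofHom (Ideal.Quotient.lift (I U.unop) (w U.unop) (hw U.unop))
      naturality := fun U V h => by
        refine CommRingCat.hom_ext (RingHom.ext fun x => ?_)
        obtain ⟨x, rfl⟩ := Ideal.Quotient.mk_surjective x
        exact w_res h.unop x }

@[simp] theorem ap_quotDesc (U : T) (x : F.obj (op U)) :
    ap (quotDesc hI w w_res hw) U (toQuot F I hI U x) = w U x :=
  ap_sheafifyDesc (quotPresheaf F I hI) _ U (Ideal.Quotient.mk (I U) x)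

end Quotient

/-! ### Local connectedness: the algebra of differences of two butterflies. -/

section Algebras
variable {A : RingSheaf J} {B : Under A} {M : ModSheaf B.right}

/-- The algebra over `B` defined by a ring `D` with maps `A → D → C`. -/
abbrev overMk {C : Over B} {D : RingSheaf J} (s : A ⟶ D) (g : D ⟶ C.left.right) (w : s ≫ g = str C.left) : Over B :=
  Over.mk ((Under.homMk g w : Under.mk s ⟶ C.left) ≫ C.hom)

/-- The structure map of `overMk`. -/
abbrev overProj {C : Over B} {D : RingSheaf J} (s : A ⟶ D) (g : D ⟶ C.left.right) (w : s ≫ g = str C.left) :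
    overMk s g w ⟶ C :=
  Over.homMk (Under.homMk g w : Under.mk s ⟶ C.left) rfl

/-- Inside Q the images of N and N' meet only in M: applying ρ gives f(n) = 0, so n comes from M,
and injectivity of κ then determines n'. -/
theorem Butterfly.exists_m_of_add_eq_zero {B : RingSheaf J} {M : ModSheaf B} {ξ η : TwoExt B M} (X : Butterfly ξ η)
    {U : T} (n : ξ.N.Sec U) (n' : η.N.Sec U) (H : X.ι U n + X.κ U n' = 0) :
    ∃ m, n = ξ.e U m ∧ n' = - η.e U m := by
  have h1 : ξ.f U n = 0 := by rw [← X.ρ_ι, eq_neg_of_add_eq_zero_left H, map_neg, X.ρ_κ, neg_zero]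
  obtain ⟨m, rfl⟩ := (ξ.exact_N U n).1 h1
  refine ⟨m, rfl, ?_⟩
  rw [X.ι_e, ← map_add] at H
  exact (neg_eq_of_add_eq_zero_right (X.κ_injective U (H.trans (map_zero _).symm))).symm

namespace AlgButterfly
variable {ξ η : AlgTwoExt B M} {C : Over B}

theorem fst_sec_restrictObj {D : Over B} (k : D ⟶ C) (X : AlgButterfly ξ η C) (U : T) (z : (SplitPair ξ η).Sec U) :
    ap (fiberProd.fst _ (ringMap k)) U (ap (restrictObj k X).sec U z) = ap X.sec U z :=
  congrArg (ap (fiberProd.fst _ (str C.left)) U) (X.α.sec_precomp (X.bf.restrictCompHom (ringMap k) (toBase D)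
    (ringMap_toBase k) (str D.left) (str B) (str_toBase D) (str C.left) (str_ringMap k) (str_toBase C)) z)

theorem snd_sec_restrictObj {D : Over B} (k : D ⟶ C) (X : AlgButterfly ξ η C) (U : T) (z : (SplitPair ξ η).Sec U) :
    ap (fiberProd.snd _ (ringMap k)) U (ap (restrictObj k X).sec U z) =
      ap (str D.left) U (ap (fiberProd.fst _ _ ≫ ξ.split.π) U z) :=
  (isSec_sec (restrictObj k X)).bar U z

/-- Both splittings map onto A locally. Maps out of A can therefore be defined, and compared, on P
×_A P'. -/
theorem splitPair_locSurj (ξ η : AlgTwoExt B M) : LocSurj (fiberProd.fst ξ.split.π η.split.π ≫ ξ.split.π) := by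
  intro U a
  refine (ξ.split.locSurj_π U a).bind' ?_
  rintro V h ⟨p, hp⟩
  refine (η.split.locSurj_π V (A.res h a)).mono ?_
  rintro W k ⟨p', hp'⟩
  have H : ap ξ.split.π W (ξ.split.Q.res k p) = ap η.split.π W p' := by
    rw [ap_res, hp, hp']
  exact ⟨fiberProd.mk _ p' H, by rw [ap_comp, fiberProd.fst_mk, ap_res, hp]; exact (A.res_comp h k a).symm⟩

theorem IsSec.ι_ι {X : Butterfly (ξ.ext.pullback (toBase C)) (η.ext.pullback (toBase C))} {μ : SplitPair ξ η ⟶ X.Q}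
    (hμ : IsSec X μ) (U : T) (n : ξ.ext.N.Sec U) (n' : η.ext.N.Sec U)
    (H : ap ξ.split.π U (ξ.split.ι U n) = ap η.split.π U (η.split.ι U n')) :
    ap μ U (fiberProd.mk (ξ.split.ι U n) (η.split.ι U n') H) = X.ι U n - X.κ U n' := by
  rw [← hμ.ι, ← hμ.κ, ← map_sub]
  congr 1
  refine fiberProd.ext (sub_zero _).symm ?_
  change η.split.ι U n' = 0 - - η.split.ι U n'
  rw [zero_sub, neg_neg]

theorem exists_ι_of_π_eq_zero {U : T} (z : (SplitPair ξ η).Sec U)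
    (h : ap (fiberProd.fst ξ.split.π η.split.π ≫ ξ.split.π) U z = 0) :
    ∃ (n : ξ.ext.N.Sec U) (n' : η.ext.N.Sec U) (H : ap ξ.split.π U (ξ.split.ι U n) = ap η.split.π U (η.split.ι U n')),
      z = fiberProd.mk (ξ.split.ι U n) (η.split.ι U n') H := by
  obtain ⟨⟨p, p'⟩, H⟩ := z
  obtain ⟨n, rfl⟩ := ξ.split.exists_ι U p h
  obtain ⟨n', rfl⟩ := η.split.exists_ι U p' (Eq.trans (Eq.symm H) h)
  exact ⟨n, n', H, rfl⟩

section Diff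
variable (X Y : AlgButterfly ξ η C)

/-- The ring of pairs of sections of the middle terms with the same images in `R` and `R'`. -/
abbrev pairRing : RingSheaf J :=
  fiberProd (fiberProd.lift X.bf.ρ X.bf.π X.bf.ρ_g) (fiberProd.lift Y.bf.ρ Y.bf.π Y.bf.ρ_g)

variable {X Y} in
theorem pairRing_toR {U : T} (z : (pairRing X Y).Sec U) : ap X.bf.toR U z.1.1 = ap Y.bf.toR U z.1.2 :=
  congrArg (fun t => ap (fiberProd.fst _ _ ≫ fiberProd.fst _ _) U t) z.2

variable {X Y} in
theorem pairRing_toR' {U : T} (z : (pairRing X Y).Sec U) : ap X.bf.toR' U z.1.1 = ap Y.bf.toR' U z.1.2 :=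
  congrArg (fun t => ap (fiberProd.snd _ _ ≫ fiberProd.fst _ _) U t) z.2

variable {X Y} in
theorem pairRing_bar {U : T} (z : (pairRing X Y).Sec U) : ap X.bf.bar U z.1.1 = ap Y.bf.bar U z.1.2 :=
  congrArg (fun t => ap (fiberProd.fst _ _ ≫ fiberProd.snd _ _) U t) z.2

/-- Sections of `pairRing`. -/
def pairMk {U : T} (q : X.bf.Q.Sec U) (q' : Y.bf.Q.Sec U) (h1 : ap X.bf.toR U q = ap Y.bf.toR U q')
    (h2 : ap X.bf.toR' U q = ap Y.bf.toR' U q') (h3 : ap X.bf.bar U q = ap Y.bf.bar U q') : (pairRing X Y).Sec U :=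
  fiberProd.mk q q' (fiberProd.ext (fiberProd.ext h1 h3) (fiberProd.ext h2 (by
    rw [← X.bf.bar_eq, ← Y.bf.bar_eq] at h3
    exact h3)))

/-- The section `(ι n + κ n', ι n + κ n')`. -/
def pairDiag {U : T} (n : ξ.ext.N.Sec U) (n' : η.ext.N.Sec U) : (pairRing X Y).Sec U :=
  pairMk X Y (X.bf.ι U n + X.bf.κ U n') (Y.bf.ι U n + Y.bf.κ U n')
    (by rw [map_add, map_add, X.bf.toR_ι, Y.bf.toR_ι, X.bf.toR_κ, Y.bf.toR_κ])
    (by rw [map_add, map_add, X.bf.toR'_ι, Y.bf.toR'_ι, X.bf.toR'_κ, Y.bf.toR'_κ])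
    (by rw [map_add, map_add, X.bf.bar_ι, Y.bf.bar_ι, X.bf.bar_κ, Y.bf.bar_κ])

/-- The ideal of the sections `(ι n + κ n', ι n + κ n')`. -/
def diagIdeal (U : T) : Ideal ((pairRing X Y).Sec U) where
  carrier := {z | ∃ n n', z = pairDiag X Y n n'}
  zero_mem' := ⟨0, 0, fiberProd.ext
    (show (0 : X.bf.Q.Sec U) = X.bf.ι U 0 + X.bf.κ U 0 by rw [map_zero, map_zero, add_zero])
    (show (0 : Y.bf.Q.Sec U) = Y.bf.ι U 0 + Y.bf.κ U 0 by rw [map_zero, map_zero, add_zero])⟩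
  add_mem' := by
    rintro _ _ ⟨a, a', rfl⟩ ⟨b, b', rfl⟩
    refine ⟨a + b, a' + b', fiberProd.ext ?_ ?_⟩
    · change (X.bf.ι U a + X.bf.κ U a') + (X.bf.ι U b + X.bf.κ U b') = X.bf.ι U (a + b) + X.bf.κ U (a' + b')
      rw [map_add, map_add]; ring
    · change (Y.bf.ι U a + Y.bf.κ U a') + (Y.bf.ι U b + Y.bf.κ U b') = Y.bf.ι U (a + b) + Y.bf.κ U (a' + b')
      rw [map_add, map_add]; ring
  -- The two components of a pair have the same images in R and R'. They act on N and N' in the same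
  -- way, so the product is again diagonal.
  smul_mem' := by
    rintro z _ ⟨a, a', rfl⟩
    refine ⟨ap X.bf.toR U z.1.1 • a, ap X.bf.toR' U z.1.1 • a', fiberProd.ext ?_ ?_⟩
    · change z.1.1 * (X.bf.ι U a + X.bf.κ U a') = X.bf.ι U _ + X.bf.κ U _
      rw [X.bf.ι_smul', X.bf.κ_smul', mul_add]
    · change z.1.2 * (Y.bf.ι U a + Y.bf.κ U a') = Y.bf.ι U _ + Y.bf.κ U _
      rw [pairRing_toR, pairRing_toR', Y.bf.ι_smul', Y.bf.κ_smul', mul_add]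

theorem diagIdeal_res {U V : T} (h : V ⟶ U) (z : (pairRing X Y).Sec U) (hz : z ∈ diagIdeal X Y U) :
    (pairRing X Y).res h z ∈ diagIdeal X Y V := by
  obtain ⟨a, a', rfl⟩ := hz
  refine ⟨ξ.ext.N.res h a, η.ext.N.res h a', fiberProd.ext ?_ ?_⟩
  · change X.bf.Q.res h (X.bf.ι U a + X.bf.κ U a') = _
    rw [map_add, ← X.bf.ι_res, ← X.bf.κ_res]
    rfl
  · change Y.bf.Q.res h (Y.bf.ι U a + Y.bf.κ U a') = _
    rw [map_add, ← Y.bf.ι_res, ← Y.bf.κ_res]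
    rfl

/-- The algebra of the differences of two butterflies, a square-zero extension of `C` by `M`. -/
noncomputable def diffRing : RingSheaf J := quotSheaf (pairRing X Y).obj (diagIdeal X Y) (diagIdeal_res X Y)

/-- The projection to the algebra of differences. -/
noncomputable def toDiff : pairRing X Y ⟶ diffRing X Y :=
  mkHom (toQuot (pairRing X Y).obj (diagIdeal X Y) (diagIdeal_res X Y)) (fun h x => toQuot_res _ _ _ h x)

theorem toDiff_locSurj : LocSurj (toDiff X Y) := toQuot_locally_surj _ _ _

theorem toDiff_eq_zero {U : T} (z : (pairRing X Y).Sec U) (H : ap (toDiff X Y) U z = 0) :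
    Locally J U fun V h => ∃ n n', (pairRing X Y).res h z = pairDiag X Y n n' :=
  (toQuot_eq_zero_iff _ _ (diagIdeal_res X Y) U z).1 H

theorem toDiff_diag {U : T} (n : ξ.ext.N.Sec U) (n' : η.ext.N.Sec U) : ap (toDiff X Y) U (pairDiag X Y n n') = 0 :=
  (toQuot_eq_zero_iff _ _ (diagIdeal_res X Y) U _).2 (Locally.of_forall fun _ h =>
    diagIdeal_res X Y h _ ⟨n, n', rfl⟩)

theorem desc_of_diag {R : RingSheaf J} (w : pairRing X Y ⟶ R)
    (hw : ∀ (U : T) n n', ap w U (pairDiag X Y n n') = 0) (U : T) (r) (h : ap (toDiff X Y) U r = 0) :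
    ap w U r = 0 := by
  refine R.eq_of_locally ((toDiff_eq_zero X Y r h).mono ?_)
  rintro V k ⟨n, n', hn⟩
  rw [← ap_res, hn, hw, map_zero]

/-- The projection of the algebra of differences to `C`. -/
noncomputable def diffBar : diffRing X Y ⟶ C.left.right :=
  (toDiff_locSurj X Y).desc (fiberProd.fst _ _ ≫ X.bf.bar) (desc_of_diag X Y _ (by
    intro U n n'
    change ap X.bf.bar U (X.bf.ι U n + X.bf.κ U n') = 0
    rw [map_add, X.bf.bar_ι, X.bf.bar_κ, add_zero]))

theorem diffBar_toDiff {U : T} (z : (pairRing X Y).Sec U) :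
    ap (diffBar X Y) U (ap (toDiff X Y) U z) = ap X.bf.bar U z.1.1 :=
  LocSurj.ap_desc _ _ _ U z

/-- The pair of the splittings over `A`. -/
noncomputable def pairSec : SplitPair ξ η ⟶ pairRing X Y :=
  fiberProd.lift X.sec Y.sec (ringHom_ext fun U z => (pairMk X Y (ap X.sec U z) (ap Y.sec U z)
    (by rw [(isSec_sec X).toR, (isSec_sec Y).toR]) (by rw [(isSec_sec X).toR', (isSec_sec Y).toR'])
    (by rw [(isSec_sec X).bar, (isSec_sec Y).bar])).2)

/-- The structure of `A`-algebra on the algebra of differences. -/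
noncomputable def diffStr : A ⟶ diffRing X Y :=
  (splitPair_locSurj ξ η).desc (pairSec X Y ≫ toDiff X Y) (by
    intro U z hz
    -- The kernel of P ×_A P' → A is N × N'. In both butterflies (n, n') goes to ι n - κ n', so the
    -- pair of images is the diagonal section of n and -n'.
    obtain ⟨n, n', H, rfl⟩ := exists_ι_of_π_eq_zero z hz
    rw [← toDiff_diag X Y n (-n'), ap_comp]
    congr 1
    refine fiberProd.ext ?_ ?_
    · refine ((isSec_sec X).ι_ι U n n' H).trans ?_
      rw [sub_eq_add_neg, ← map_neg]
      rfl
    · refine ((isSec_sec Y).ι_ι U n n' H).trans ?_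
      rw [sub_eq_add_neg, ← map_neg]
      rfl)

theorem diffStr_π {U : T} (z : (SplitPair ξ η).Sec U) :
    ap (diffStr X Y) U (ap (fiberProd.fst ξ.split.π η.split.π ≫ ξ.split.π) U z) =
      ap (toDiff X Y) U (ap (pairSec X Y) U z) := LocSurj.ap_desc _ _ _ U z

theorem diffStr_diffBar : diffStr X Y ≫ diffBar X Y = str C.left := by
  refine (splitPair_locSurj ξ η).hom_ext (ringHom_ext fun U z => ?_)
  refine (congrArg (ap (diffBar X Y) U) (diffStr_π X Y z)).trans ((diffBar_toDiff X Y _).trans ?_)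
  exact (isSec_sec X).bar U z

/-- A local lift of c to the first butterfly has images in R, R' and C that agree in B, and locally
some section of the second butterfly has the same three images. -/
theorem diffBar_locSurj : LocSurj (diffBar X Y) := by
  intro U c
  refine (X.bf.locSurj_bar U c).bind' ?_
  rintro V h ⟨q, hq⟩
  refine (Y.bf.exists_of_triple V (ap X.bf.toR V q) (ap X.bf.toR' V q) (ap X.bf.bar V q)
    (X.bf.g_toR V q) (X.bf.g_toR' V q)).mono ?_
  rintro W k ⟨q', h1, h2, h3⟩
  refine ⟨ap (toDiff X Y) W (pairMk X Y (X.bf.Q.res k q) q' (by rw [h1, ap_res]) (by rw [h2, ap_res])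
    (by rw [h3, ap_res])), ?_⟩
  rw [diffBar_toDiff]
  change ap X.bf.bar W (X.bf.Q.res k q) = _
  rw [ap_res, hq, RingSheaf.res_comp]

/-- The algebra of differences as an algebra over `B`. -/
noncomputable abbrev diffAlg : Over B := overMk (diffStr X Y) (diffBar X Y) (diffStr_diffBar X Y)

/-- The projection of the algebra of differences to `C`. -/
noncomputable abbrev diffProj : diffAlg X Y ⟶ C := overProj (diffStr X Y) (diffBar X Y) (diffStr_diffBar X Y)

/-- The isomorphism of the ring of pairs with the pullback of the first butterfly. -/
noncomputable def pairFst : pairRing X Y ⟶ (restrictObj (diffProj X Y) X).bf.Q :=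
  fiberProd.lift (fiberProd.fst _ _) (toDiff X Y) (ringHom_ext fun _ z => (diffBar_toDiff X Y z).symm)

/-- The isomorphism of the ring of pairs with the pullback of the second butterfly. -/
noncomputable def pairSnd : pairRing X Y ⟶ (restrictObj (diffProj X Y) Y).bf.Q :=
  fiberProd.lift (fiberProd.snd _ _) (toDiff X Y) (ringHom_ext fun _ z =>
    (pairRing_bar z).symm.trans (diffBar_toDiff X Y z).symm)

/-- For injectivity, a pair with zero class is locally diagonal. If its first component ι n + κ n'
vanishes, then n = e m and n' = -e' m, so the second component vanishes as well. For surjectivity,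
represent the given class by a pair z. The section q and the first component of z have the same
image in C, so locally they differ by some ι n + κ n', and adding the corresponding diagonal section
corrects z without changing its class. -/
theorem pairFst_bijective (U : T) : Function.Bijective (ap (pairFst X Y) U) := by
  have inj (V : T) : Function.Injective (ap (pairFst X Y) V) := by
    rw [injective_iff_map_eq_zero]
    intro z hz
    have h1 : z.1.1 = 0 := congrArg (ap (fiberProd.fst _ _) V) hz
    have h2 : ap (toDiff X Y) V z = 0 := congrArg (ap (fiberProd.snd _ _) V) hz
    refine fiberProd.ext h1 (Y.bf.Q.eq_of_locally ((toDiff_eq_zero X Y z h2).mono ?_))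
    rintro W h ⟨n, n', hn⟩
    have h3 : X.bf.Q.res h z.1.1 = X.bf.ι W n + X.bf.κ W n' := congrArg (fun t => t.1.1) hn
    have h4 : Y.bf.Q.res h z.1.2 = Y.bf.ι W n + Y.bf.κ W n' := congrArg (fun t => t.1.2) hn
    rw [h1, map_zero] at h3
    obtain ⟨m, rfl, rfl⟩ := X.bf.exists_m_of_add_eq_zero n n' h3.symm
    refine h4.trans ?_
    rw [map_neg, Y.bf.ι_e, add_neg_cancel]
    exact (map_zero (Y.bf.Q.res h)).symm
  refine ⟨inj U, fun x => exists_global_preimage _ inj x ?_⟩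
  obtain ⟨⟨q, δ⟩, hq⟩ := x
  have hq' : ap X.bf.bar U q = ap (diffBar X Y) U δ := hq
  refine (toDiff_locSurj X Y U δ).bind' ?_
  rintro V h ⟨z, hz⟩
  refine (X.bf.exists_add' V (X.bf.Q.res h q - z.1.1) (by
    rw [map_sub, ap_res, hq', ← ap_res, ← hz, diffBar_toDiff, sub_self])).mono ?_
  rintro W k ⟨n, n', hn⟩
  refine ⟨(pairRing X Y).res k z + pairDiag X Y n n', fiberProd.ext ?_ ?_⟩
  · change X.bf.Q.res k z.1.1 + (X.bf.ι W n + X.bf.κ W n') = X.bf.Q.res (k ≫ h) q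
    refine (congrArg (X.bf.Q.res k z.1.1 + ·) hn.symm).trans ?_
    rw [map_sub, add_sub_cancel, RingSheaf.res_comp]
  · change ap (toDiff X Y) W _ = (diffRing X Y).res (k ≫ h) δ
    rw [map_add, toDiff_diag, add_zero, ap_res, hz, RingSheaf.res_comp]

/-- The isomorphism of two butterflies over the algebra of their differences. -/
noncomputable def diffIso : restrictObj (diffProj X Y) X ⟶ restrictObj (diffProj X Y) Y :=
  have key (U : T) (q) (z) (h : ap (pairFst X Y) U z = q) :
      ap (invOfBijective _ (pairFst_bijective X Y) ≫ pairSnd X Y) U q = ap (pairSnd X Y) U z := by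
    rw [ap_comp, ← h, ap_invOfBijective]
  -- Only the first projection has to be inverted, since morphisms of butterflies are automatically
  -- invertible.
  homMk (Butterfly.homMk (invOfBijective _ (pairFst_bijective X Y) ≫ pairSnd X Y)
    (fun U n => by
      refine (key U ((restrictObj (diffProj X Y) X).bf.ι U n) (pairDiag X Y n 0) (fiberProd.ext ?_ (toDiff_diag X Y n 0))).trans
        (fiberProd.ext ?_ (toDiff_diag X Y n 0))
      · exact (congrArg (_ + ·) (map_zero (X.bf.κ U))).trans (add_zero _)
      · exact (congrArg (_ + ·) (map_zero (Y.bf.κ U))).trans (add_zero _))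
    (fun U n => by
      refine (key U ((restrictObj (diffProj X Y) X).bf.κ U n) (pairDiag X Y 0 n) (fiberProd.ext ?_ (toDiff_diag X Y 0 n))).trans
        (fiberProd.ext ?_ (toDiff_diag X Y 0 n))
      · exact (congrArg (· + _) (map_zero (X.bf.ι U))).trans (zero_add _)
      · exact (congrArg (· + _) (map_zero (Y.bf.ι U))).trans (zero_add _))
    (fun U q => by
      obtain ⟨z, rfl⟩ := (pairFst_bijective X Y U).2 q
      rw [key U _ z rfl]
      exact (pairRing_toR z).symm)
    (fun U q => by
      obtain ⟨z, rfl⟩ := (pairFst_bijective X Y U).2 q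
      rw [key U _ z rfl]
      exact (pairRing_toR' z).symm)
    (fun U q => by
      obtain ⟨z, rfl⟩ := (pairFst_bijective X Y U).2 q
      rw [key U _ z rfl]
      rfl))
    (fun U z => by
      refine (key U _ (ap (pairSec X Y) U z) (fiberProd.ext ?_ ?_)).trans (fiberProd.ext ?_ ?_)
      · exact (fst_sec_restrictObj (diffProj X Y) X U z).symm
      · exact (diffStr_π X Y z).symm.trans (snd_sec_restrictObj (diffProj X Y) X U z).symm
      · exact (fst_sec_restrictObj (diffProj X Y) Y U z).symm
      · exact (diffStr_π X Y z).symm.trans (snd_sec_restrictObj (diffProj X Y) Y U z).symm)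

end Diff
end AlgButterfly

/-- The sieve generated by a locally surjective map is covering. -/
theorem generate_mem_algTopology {C D : Over B} (k : D ⟶ C) (hk : LocSurj (ringMap k)) :
    Sieve.generate (Presieve.singleton k) ∈ algTopology B C := by
  have : IsCovering (Sieve.generate (Presieve.singleton k)) := by
    intro U Λ
    refine ⟨D, k, ⟨D, 𝟙 D, k, Presieve.singleton.mk, Category.id_comp k⟩, ?_⟩
    classical
    -- Each section of Λ lifts on its own covering, and finitely many coverings have a common
    -- refinement.
    induction Λ using Finset.induction_on with
    | empty => exact Locally.of_forall fun _ _ c hc => by simp at hc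
    | insert c Λ _ ih =>
      refine ((hk U c).and ih).mono ?_
      rintro V h ⟨h1, h2⟩ c' hc'
      rcases Finset.mem_insert.1 hc' with rfl | hc'
      · exact h1
      · exact h2 c' hc'
  exact (GrothendieckTopology.mem_sInf _ _).2 fun K hK => hK C _ this

end Algebras
end Butterflies

namespace Butterflies
variable {T : Type u} [SmallCategory T] {J : GrothendieckTopology T}

/-! ### Presheaves of monoid algebras. -/

section MonAlg

/-- The ring map on a monoid algebra defined by a ring map and a monoid map. -/
noncomputable def monLift {S E X : Type u} [CommRing S] [CommMonoid E] [CommRing X] (f : S →+* X) (g : E →* X) :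
    MonoidAlgebra S E →+* X :=
  MonoidAlgebra.liftNCRingHom f g fun _ _ => Commute.all _ _

@[simp] theorem monLift_single {S E X : Type u} [CommRing S] [CommMonoid E] [CommRing X] (f : S →+* X) (g : E →* X)
    (e : E) (s : S) : monLift f g (MonoidAlgebra.single e s) = f s * g e :=
  MonoidAlgebra.liftNC_single _ _ _ _

/-- Functoriality of monoid algebras. -/
noncomputable def monMap {S E S' E' : Type u} [CommRing S] [CommMonoid E] [CommRing S'] [CommMonoid E']
    (f : S →+* S') (g : E →* E') : MonoidAlgebra S E →+* MonoidAlgebra S' E' :=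
  monLift (MonoidAlgebra.singleOneRingHom.comp f) ((MonoidAlgebra.of S' E').comp g)

@[simp] theorem monMap_single {S E S' E' : Type u} [CommRing S] [CommMonoid E] [CommRing S'] [CommMonoid E']
    (f : S →+* S') (g : E →* E') (e : E) (s : S) :
    monMap f g (MonoidAlgebra.single e s) = MonoidAlgebra.single (g e) (f s) := by
  simp [monMap, MonoidAlgebra.singleOneRingHom, MonoidAlgebra.single_mul_single]

/-- This makes the kernel of (P ×_A P')[E] → A[E] computable one coefficient at a time. -/
theorem coeff_monMap_id {S E S' : Type u} [CommRing S] [CommMonoid E] [CommRing S'] (f : S →+* S')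
    (w : MonoidAlgebra S E) (e : E) : (monMap f (MonoidHom.id E) w).coeff e = f (w.coeff e) := by
  classical
  induction w using MonoidAlgebra.induction_linear with
  | zero => simp
  | add x y hx hy => simp [hx, hy]
  | single a b =>
    simp only [monMap_single, MonoidHom.id_apply, MonoidAlgebra.coeff_single, Finsupp.single_apply]
    split_ifs <;> simp

variable (S E : RingSheaf J)

/-- The presheaf of monoid algebras on the multiplicative monoid of a sheaf of rings. -/
noncomputable def monAlg : Tᵒᵖ ⥤ CommRingCat.{u} where
  obj U := CommRingCat.of (MonoidAlgebra (S.Sec U.unop) (E.Sec U.unop))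
  map h := CommRingCat.ofHom (monMap (S.res h.unop) (E.res h.unop).toMonoidHom)
  map_id U := by
    refine CommRingCat.hom_ext (MonoidAlgebra.ringHom_ext (fun s => ?_) fun e => ?_)
    · exact (monMap_single _ _ _ _).trans (congrArg₂ _ (map_one _) (S.res_id _ s))
    · exact (monMap_single _ _ _ _).trans (congrArg₂ _ (E.res_id _ e) (map_one _))
  map_comp {U V W} h k := by
    refine CommRingCat.hom_ext (MonoidAlgebra.ringHom_ext (fun s => ?_) fun e => ?_)
    · refine (monMap_single _ _ _ _).trans ?_
      refine Eq.trans ?_ (congrArg (monMap (S.res k.unop) (E.res k.unop).toMonoidHom)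
        (monMap_single (S.res h.unop) (E.res h.unop).toMonoidHom 1 s).symm)
      refine Eq.trans ?_ (monMap_single _ _ _ _).symm
      refine congrArg₂ _ ?_ (S.res_comp _ _ s)
      change E.res _ 1 = E.res _ (E.res _ 1)
      simp
    · refine (monMap_single _ _ _ _).trans ?_
      refine Eq.trans ?_ (congrArg (monMap (S.res k.unop) (E.res k.unop).toMonoidHom)
        (monMap_single (S.res h.unop) (E.res h.unop).toMonoidHom e 1).symm)
      refine Eq.trans ?_ (monMap_single _ _ _ _).symm
      refine congrArg₂ _ (E.res_comp _ _ e) ?_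
      simp

variable {S E} in
/-- The monomials. -/
noncomputable def mono {U : T} (e : E.Sec U) (s : S.Sec U) : (monAlg S E).obj (op U) := MonoidAlgebra.single e s

theorem monAlg_map_mono {U V : T} (h : V ⟶ U) (e : E.Sec U) (s : S.Sec U) :
    ((monAlg S E).map h.op).hom (mono e s) = mono (E.res h e) (S.res h s) :=
  monMap_single _ _ _ _

variable {S E}

/-- Ring maps that agree on the monomials agree. -/
theorem monAlg_hom_ext {U : T} {X : Type u} [CommRing X] {f g : (monAlg S E).obj (op U) →+* X}
    (h : ∀ (e : E.Sec U) (s : S.Sec U), f (mono e s) = g (mono e s)) : f = g :=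
  MonoidAlgebra.ringHom_ext (fun s => h 1 s) (fun e => h e 1)

theorem monAlg_induction {U : T} {P : (monAlg S E).obj (op U) → Prop} (w : (monAlg S E).obj (op U)) (zero : P 0)
    (add : ∀ x y, P x → P y → P (x + y)) (single : ∀ (e : E.Sec U) (s : S.Sec U), P (mono e s)) : P w :=
  MonoidAlgebra.induction_linear (motive := P) w zero add single

@[simp] theorem mono_zero {U : T} (e : E.Sec U) : mono e (0 : S.Sec U) = 0 := MonoidAlgebra.single_zero e

theorem mono_mul_mono {U : T} (e e' : E.Sec U) (s t : S.Sec U) : mono e s * mono e' t = mono (e * e') (s * t) :=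
  MonoidAlgebra.single_mul_single e e' s t

end MonAlg

/-! ### Free algebras on R ×_B R' ×_B C and their evaluations. -/

section Algebras
variable {A : RingSheaf J} {B : Under A} {M : ModSheaf B.right}

namespace AlgButterfly
variable (ξ η : AlgTwoExt B M) (C : Over B)

/-- The ring `R ×_B R' ×_B C`. -/
abbrev baseRing : RingSheaf J := fiberProd (ξ.ext.pullback (toBase C)).g (η.ext.pullback (toBase C)).g

/-- The projection to `R`. -/
abbrev baseR : baseRing ξ η C ⟶ ξ.ext.R := fiberProd.fst _ _ ≫ fiberProd.fst _ _

/-- The projection to `R'`. -/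
abbrev baseR' : baseRing ξ η C ⟶ η.ext.R := fiberProd.snd _ _ ≫ fiberProd.fst _ _

/-- The projection to `C`. -/
abbrev baseC : baseRing ξ η C ⟶ C.left.right := fiberProd.fst _ _ ≫ fiberProd.snd _ _

theorem g_baseR (U : T) (e : (baseRing ξ η C).Sec U) :
    ap ξ.ext.g U (ap (baseR ξ η C) U e) = ap (toBase C) U (ap (baseC ξ η C) U e) := e.1.1.2

theorem g_baseR' (U : T) (e : (baseRing ξ η C).Sec U) :
    ap η.ext.g U (ap (baseR' ξ η C) U e) = ap (toBase C) U (ap (baseC ξ η C) U e) :=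
  e.1.2.2.trans (congrArg (ap (toBase C) U) e.2.symm)

variable {C} in
/-- The map from `P ×_A P'` to `R`. -/
abbrev pairR : SplitPair ξ η ⟶ ξ.ext.R := fiberProd.fst _ _ ≫ ξ.split.ρ ≫ fiberProd.fst _ _

/-- The map from `P ×_A P'` to `R'`. -/
abbrev pairR' : SplitPair ξ η ⟶ η.ext.R := fiberProd.snd _ _ ≫ η.split.ρ ≫ fiberProd.fst _ _

/-- The map from `P ×_A P'` to `A`. -/
abbrev pairA : SplitPair ξ η ⟶ A := fiberProd.fst ξ.split.π η.split.π ≫ ξ.split.π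

theorem g_pairR (U : T) (z : (SplitPair ξ η).Sec U) :
    ap ξ.ext.g U (ap (pairR ξ η) U z) = ap (str B) U (ap (pairA ξ η) U z) := by
  refine (ap ξ.split.ρ U z.1.1).2.trans (congrArg (ap (str B) U) ?_)
  exact bar_split ξ z.1.1

theorem g_pairR' (U : T) (z : (SplitPair ξ η).Sec U) :
    ap η.ext.g U (ap (pairR' ξ η) U z) = ap (str B) U (ap (pairA ξ η) U z) := by
  refine (ap η.split.ρ U z.1.2).2.trans (congrArg (ap (str B) U) ?_)
  exact (bar_split η z.1.2).trans z.2.symm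

/-- The sections of `N × N'`. -/
abbrev NN (U : T) : Type u := ξ.ext.N.Sec U × η.ext.N.Sec U

/-- Restriction of sections of `N × N'`. -/
def NN.res {U V : T} (h : V ⟶ U) : NN ξ η U →+ NN ξ η V := (ξ.ext.N.res h).prodMap (η.ext.N.res h)

/-- The inclusion of `N × N'` in `P ×_A P'`. -/
def incl (U : T) : NN ξ η U →+ (SplitPair ξ η).Sec U where
  toFun x := fiberProd.mk (ξ.split.ι U x.1) (η.split.ι U x.2) ((ξ.split.π_ι U _).trans (η.split.π_ι U _).symm)
  map_zero' := fiberProd.ext (map_zero (ξ.split.ι U)) (map_zero (η.split.ι U))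
  map_add' x y := fiberProd.ext (map_add (ξ.split.ι U) _ _) (map_add (η.split.ι U) _ _)

theorem incl_injective (U : T) : Function.Injective (incl ξ η U) := fun _ _ h =>
  Prod.ext (ξ.split.ι_injective U (congrArg (ap (fiberProd.fst _ _) U) h))
    (η.split.ι_injective U (congrArg (ap (fiberProd.snd _ _) U) h))

theorem incl_res {U V : T} (h : V ⟶ U) (x : NN ξ η U) :
    incl ξ η V (NN.res ξ η h x) = (SplitPair ξ η).res h (incl ξ η U x) :=
  fiberProd.ext (ξ.split.ι_res h _) (η.split.ι_res h _)

theorem mul_incl (U : T) (z : (SplitPair ξ η).Sec U) (x : NN ξ η U) :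
    z * incl ξ η U x = incl ξ η U (ap (pairR ξ η) U z • x.1, ap (pairR' ξ η) U z • x.2) :=
  fiberProd.ext (ξ.split.ι_smul U z.1.1 x.1).symm (η.split.ι_smul U z.1.2 x.2).symm

theorem pairR_incl (U : T) (x : NN ξ η U) : ap (pairR ξ η) U (incl ξ η U x) = ξ.ext.f U x.1 :=
  congrArg (ap (fiberProd.fst _ _) U) (ξ.split.ρ_ι U x.1)

theorem pairR'_incl (U : T) (x : NN ξ η U) : ap (pairR' ξ η) U (incl ξ η U x) = η.ext.f U x.2 :=
  congrArg (ap (fiberProd.fst _ _) U) (η.split.ρ_ι U x.2)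

theorem pairA_incl (U : T) (x : NN ξ η U) : ap (pairA ξ η) U (incl ξ η U x) = 0 := ξ.split.π_ι U x.1

theorem exists_incl (U : T) (z : (SplitPair ξ η).Sec U) (h : ap (pairA ξ η) U z = 0) : ∃ x, incl ξ η U x = z := by
  obtain ⟨n, n', H, rfl⟩ := exists_ι_of_π_eq_zero z h
  exact ⟨(n, n'), rfl⟩

/-- The presheaf of free algebras over `P ×_A P'`. -/
noncomputable abbrev freePair : Tᵒᵖ ⥤ CommRingCat.{u} := monAlg (SplitPair ξ η) (baseRing ξ η C)

/-- The presheaf of free algebras over `A`. -/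
noncomputable abbrev freeA : Tᵒᵖ ⥤ CommRingCat.{u} := monAlg A (baseRing ξ η C)

/-- Evaluation in `R`. -/
noncomputable def evR (U : T) : (freePair ξ η C).obj (op U) →+* ξ.ext.R.Sec U :=
  monLift (ap (pairR ξ η) U) (ap (baseR ξ η C) U).toMonoidHom

/-- Evaluation in `R'`. -/
noncomputable def evR' (U : T) : (freePair ξ η C).obj (op U) →+* η.ext.R.Sec U :=
  monLift (ap (pairR' ξ η) U) (ap (baseR' ξ η C) U).toMonoidHom

/-- Evaluation in `C`. -/
noncomputable def evC (U : T) : (freeA ξ η C).obj (op U) →+* C.left.right.Sec U :=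
  monLift (ap (str C.left) U) (ap (baseC ξ η C) U).toMonoidHom

/-- The projection of the free algebra over `P ×_A P'` to the free algebra over `A`. -/
noncomputable def evA (U : T) : (freePair ξ η C).obj (op U) →+* (freeA ξ η C).obj (op U) :=
  monMap (ap (pairA ξ η) U) (MonoidHom.id _)

variable {U : T}

@[simp] theorem evR_single (e : (baseRing ξ η C).Sec U) (z : (SplitPair ξ η).Sec U) :
    evR ξ η C U (mono e z) = ap (pairR ξ η) U z * ap (baseR ξ η C) U e := monLift_single _ _ _ _

@[simp] theorem evR'_single (e : (baseRing ξ η C).Sec U) (z : (SplitPair ξ η).Sec U) :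
    evR' ξ η C U (mono e z) = ap (pairR' ξ η) U z * ap (baseR' ξ η C) U e := monLift_single _ _ _ _

@[simp] theorem evC_single (e : (baseRing ξ η C).Sec U) (a : A.Sec U) :
    evC ξ η C U (mono e a) = ap (str C.left) U a * ap (baseC ξ η C) U e := monLift_single _ _ _ _

@[simp] theorem evA_single (e : (baseRing ξ η C).Sec U) (z : (SplitPair ξ η).Sec U) :
    evA ξ η C U (mono e z) = mono e (ap (pairA ξ η) U z) := monMap_single _ _ _ _

theorem evR_res {V : T} (h : V ⟶ U) (w) : evR ξ η C V (((freePair ξ η C).map h.op).hom w) = ξ.ext.R.res h (evR ξ η C U w) := by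
  refine RingHom.congr_fun (monAlg_hom_ext (f := (evR ξ η C V).comp ((freePair ξ η C).map h.op).hom)
    (g := (ξ.ext.R.res h).comp (evR ξ η C U)) fun e z => ?_) w
  rw [RingHom.comp_apply, RingHom.comp_apply, monAlg_map_mono, evR_single, evR_single, map_mul, ap_res, ap_res]

theorem evR'_res {V : T} (h : V ⟶ U) (w) : evR' ξ η C V (((freePair ξ η C).map h.op).hom w) = η.ext.R.res h (evR' ξ η C U w) := by
  refine RingHom.congr_fun (monAlg_hom_ext (f := (evR' ξ η C V).comp ((freePair ξ η C).map h.op).hom)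
    (g := (η.ext.R.res h).comp (evR' ξ η C U)) fun e z => ?_) w
  rw [RingHom.comp_apply, RingHom.comp_apply, monAlg_map_mono, evR'_single, evR'_single, map_mul, ap_res, ap_res]

theorem evC_res {V : T} (h : V ⟶ U) (w) : evC ξ η C V (((freeA ξ η C).map h.op).hom w) = C.left.right.res h (evC ξ η C U w) := by
  refine RingHom.congr_fun (monAlg_hom_ext (f := (evC ξ η C V).comp ((freeA ξ η C).map h.op).hom)
    (g := (C.left.right.res h).comp (evC ξ η C U)) fun e z => ?_) w
  rw [RingHom.comp_apply, RingHom.comp_apply, monAlg_map_mono, evC_single, evC_single, map_mul, ap_res, ap_res]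

theorem evA_res {V : T} (h : V ⟶ U) (w) :
    evA ξ η C V (((freePair ξ η C).map h.op).hom w) = ((freeA ξ η C).map h.op).hom (evA ξ η C U w) := by
  refine RingHom.congr_fun (monAlg_hom_ext (f := (evA ξ η C V).comp ((freePair ξ η C).map h.op).hom)
    (g := ((freeA ξ η C).map h.op).hom.comp (evA ξ η C U)) fun e z => ?_) w
  rw [RingHom.comp_apply, RingHom.comp_apply, monAlg_map_mono, evA_single, evA_single, monAlg_map_mono, ap_res]

/-- On a monomial z[e], both factors have matching images in B: z through P → R ×_B A, and e because
it is a compatible triple. Together with `g_evR'` this shows that the evaluations in R and R' agree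
in B. -/
theorem g_evR (w) : ap ξ.ext.g U (evR ξ η C U w) = ap (toBase C) U (evC ξ η C U (evA ξ η C U w)) := by
  refine RingHom.congr_fun (monAlg_hom_ext (f := (ap ξ.ext.g U).comp (evR ξ η C U))
    (g := (ap (toBase C) U).comp ((evC ξ η C U).comp (evA ξ η C U))) fun e z => ?_) w
  simp only [RingHom.comp_apply]
  rw [evR_single, evA_single, evC_single, map_mul, map_mul, g_baseR, g_pairR]
  congr 1
  rw [← str_toBase C]
  rfl

theorem g_evR' (w) : ap η.ext.g U (evR' ξ η C U w) = ap (toBase C) U (evC ξ η C U (evA ξ η C U w)) := by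
  refine RingHom.congr_fun (monAlg_hom_ext (f := (ap η.ext.g U).comp (evR' ξ η C U))
    (g := (ap (toBase C) U).comp ((evC ξ η C U).comp (evA ξ η C U))) fun e z => ?_) w
  simp only [RingHom.comp_apply]
  rw [evR'_single, evA_single, evC_single, map_mul, map_mul, g_baseR', g_pairR']
  congr 1
  rw [← str_toBase C]
  rfl

/-- Formal combinations of elements of the monoid with coefficients in `N × N'`. -/
abbrev FreeNN (U : T) : Type u := (baseRing ξ η C).Sec U →₀ NN ξ η U

/-- The inclusion of the formal combinations with coefficients in `N × N'`. -/
noncomputable def freeIncl (U : T) : FreeNN ξ η C U →+ (freePair ξ η C).obj (op U) :=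
  (MonoidAlgebra.coeffAddEquiv (R := (SplitPair ξ η).Sec U) (M := (baseRing ξ η C).Sec U)).symm.toAddMonoidHom.comp
    (Finsupp.mapRange.addMonoidHom (incl ξ η U))

@[simp] theorem freeIncl_single (e : (baseRing ξ η C).Sec U) (x : NN ξ η U) :
    freeIncl ξ η C U (Finsupp.single e x) = mono e (incl ξ η U x) := by
  change MonoidAlgebra.ofCoeff (Finsupp.mapRange _ (map_zero (incl ξ η U)) (Finsupp.single e x)) = _
  rw [Finsupp.mapRange_single]
  rfl

theorem freeIncl_injective (U : T) : Function.Injective (freeIncl ξ η C U) :=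
  (MonoidAlgebra.coeffAddEquiv (R := (SplitPair ξ η).Sec U) (M := (baseRing ξ η C).Sec U)).symm.injective.comp
    (Finsupp.mapRange_injective _ (map_zero _) (incl_injective ξ η U))

/-- Evaluation of formal combinations in `N × N'`. -/
noncomputable def freeEv (U : T) : FreeNN ξ η C U →+ NN ξ η U :=
  Finsupp.liftAddHom fun e => (DistribSMul.toAddMonoidHom (ξ.ext.N.Sec U) (ap (baseR ξ η C) U e)).prodMap
    (DistribSMul.toAddMonoidHom (η.ext.N.Sec U) (ap (baseR' ξ η C) U e))

@[simp] theorem freeEv_single (e : (baseRing ξ η C).Sec U) (x : NN ξ η U) :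
    freeEv ξ η C U (Finsupp.single e x) = (ap (baseR ξ η C) U e • x.1, ap (baseR' ξ η C) U e • x.2) :=
  Finsupp.liftAddHom_apply_single _ _ _

theorem evR_freeIncl (φ : FreeNN ξ η C U) : evR ξ η C U (freeIncl ξ η C U φ) = ξ.ext.f U (freeEv ξ η C U φ).1 := by
  induction φ using Finsupp.induction_linear with
  | zero => simp only [map_zero]; exact (map_zero (ξ.ext.f U)).symm
  | add x y hx hy => simp only [map_add, hx, hy]; exact (map_add (ξ.ext.f U) _ _).symm
  | single e x => rw [freeIncl_single, evR_single, freeEv_single, pairR_incl, map_smul, smul_eq_mul, mul_comm]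

theorem evR'_freeIncl (φ : FreeNN ξ η C U) : evR' ξ η C U (freeIncl ξ η C U φ) = η.ext.f U (freeEv ξ η C U φ).2 := by
  induction φ using Finsupp.induction_linear with
  | zero => simp only [map_zero]; exact (map_zero (η.ext.f U)).symm
  | add x y hx hy => simp only [map_add, hx, hy]; exact (map_add (η.ext.f U) _ _).symm
  | single e x => rw [freeIncl_single, evR'_single, freeEv_single, pairR'_incl, map_smul, smul_eq_mul, mul_comm]

theorem evA_freeIncl (φ : FreeNN ξ η C U) : evA ξ η C U (freeIncl ξ η C U φ) = 0 := by
  induction φ using Finsupp.induction_linear with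
  | zero => simp only [map_zero]
  | add x y hx hy => simp only [map_add, hx, hy, add_zero]
  | single e x => rw [freeIncl_single, evA_single, pairA_incl, mono_zero]

/-- The projection to A[E] fixes the monomials, so every coefficient of w lies in the kernel N × N'
of P ×_A P' → A. -/
theorem exists_freeIncl (w : (freePair ξ η C).obj (op U)) (h : evA ξ η C U w = 0) : ∃ φ, freeIncl ξ η C U φ = w := by
  change w ∈ (freeIncl ξ η C U).range
  have h1 : ∀ e : (baseRing ξ η C).Sec U, (mono e (MonoidAlgebra.coeff w e) : (freePair ξ η C).obj (op U)) ∈ (freeIncl ξ η C U).range := by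
    intro e
    have h2 : ap (pairA ξ η) U (MonoidAlgebra.coeff w e) = 0 := by
      exact (coeff_monMap_id (ap (pairA ξ η) U) w e).symm.trans (congrArg (fun t => MonoidAlgebra.coeff t e) h)
    obtain ⟨x, hx⟩ := exists_incl ξ η U _ h2
    exact ⟨Finsupp.single e x, by rw [freeIncl_single, hx]⟩
  rw [← show _ = w from MonoidAlgebra.sum_coeff_single w]
  exact AddSubgroup.sum_mem _ fun e _ => h1 e

/-- The combinations with coefficients in N × N' form an ideal, and evaluation on it is linear over
(P ×_A P')[E] acting through R and R'. Producing the combination together with its value avoids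
putting a module structure on `FreeNN`. -/
theorem exists_mul_freeIncl (w : (freePair ξ η C).obj (op U)) (φ : FreeNN ξ η C U) :
    ∃ ψ, freeIncl ξ η C U ψ = w * freeIncl ξ η C U φ ∧
      freeEv ξ η C U ψ = (evR ξ η C U w • (freeEv ξ η C U φ).1, evR' ξ η C U w • (freeEv ξ η C U φ).2) := by
  induction w using monAlg_induction with
  | zero => exact ⟨0, by rw [map_zero, zero_mul], by simp only [map_zero, zero_smul]; rfl⟩
  | add x y hx hy =>
    obtain ⟨a, ha, ha'⟩ := hx
    obtain ⟨b, hb, hb'⟩ := hy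
    exact ⟨a + b, by rw [map_add, ha, hb, add_mul], by simp only [map_add, ha', hb', add_smul]; rfl⟩
  | single e z =>
    induction φ using Finsupp.induction_linear with
    | zero => exact ⟨0, by rw [map_zero, mul_zero], by simp only [map_zero, Prod.fst_zero, Prod.snd_zero, smul_zero]; rfl⟩
    | add x y hx hy =>
      obtain ⟨a, ha, ha'⟩ := hx
      obtain ⟨b, hb, hb'⟩ := hy
      exact ⟨a + b, by rw [map_add, map_add, ha, hb, mul_add], by
        simp only [map_add, ha', hb', Prod.fst_add, Prod.snd_add, smul_add]; rfl⟩
    | single e' x =>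
      -- This is z[e] · x[e'] = (zx)[ee'], where the product zx in P ×_A P' is computed by letting z
      -- act on N through R and on N' through R'.
      refine ⟨Finsupp.single (e * e') (ap (pairR ξ η) U z • x.1, ap (pairR' ξ η) U z • x.2), ?_, ?_⟩
      · rw [freeIncl_single, freeIncl_single, ← mul_incl]
        exact (mono_mul_mono e e' z (incl ξ η U x)).symm
      · rw [freeEv_single, freeEv_single, evR_single, evR'_single, smul_smul, smul_smul, smul_smul, smul_smul,
          map_mul, map_mul]
        refine Prod.ext ?_ ?_
        · exact congrArg (· • x.1) (by ring)
        · exact congrArg (· • x.2) (by ring)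

end AlgButterfly
end Algebras
end Butterflies

namespace Butterflies
variable {T : Type u} [SmallCategory T] {J : GrothendieckTopology T}

/-- The constants in a monoid algebra. -/
noncomputable def monConst (S E : RingSheaf J) (U : T) : S.Sec U →+* (monAlg S E).obj (op U) :=
  MonoidAlgebra.singleOneRingHom

theorem monConst_apply {S E : RingSheaf J} {U : T} (s : S.Sec U) : monConst S E U s = mono 1 s := rfl

theorem quot_hom_ext {F : Tᵒᵖ ⥤ CommRingCat.{u}} {I : ∀ U : T, Ideal (F.obj (op U))}
    {hI : ∀ {U V : T} (h : V ⟶ U) x, x ∈ I U → (F.map h.op).hom x ∈ I V} {X : RingSheaf J}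
    {φ ψ : quotSheaf F I hI ⟶ X} (H : ∀ U x, ap φ U (toQuot F I hI U x) = ap ψ U (toQuot F I hI U x)) : φ = ψ := by
  refine ringHom_ext fun U s => X.eq_of_locally ((toQuot_locally_surj F I hI U s).mono ?_)
  rintro V h ⟨x, hx⟩
  rw [← ap_res, ← ap_res, ← hx, H]

/-! ### Local nonemptiness: the generic butterfly. -/

section Algebras
variable {A : RingSheaf J} {B : Under A} {M : ModSheaf B.right}

namespace AlgButterfly
variable (ξ η : AlgTwoExt B M) (C : Over B) {U : T}

theorem exists_freeIncl_res {V : T} (h : V ⟶ U) (φ : FreeNN ξ η C U) :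
    ∃ ψ, freeIncl ξ η C V ψ = ((freePair ξ η C).map h.op).hom (freeIncl ξ η C U φ) ∧
      freeEv ξ η C V ψ = NN.res ξ η h (freeEv ξ η C U φ) := by
  induction φ using Finsupp.induction_linear with
  | zero => exact ⟨0, by rw [map_zero, map_zero, map_zero], by rw [map_zero, map_zero, map_zero]⟩
  | add x y hx hy =>
    obtain ⟨a, ha, ha'⟩ := hx
    obtain ⟨b, hb, hb'⟩ := hy
    exact ⟨a + b, by rw [map_add, map_add, map_add, ha, hb], by rw [map_add, map_add, map_add, ha', hb']⟩
  | single e x =>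
    refine ⟨Finsupp.single ((baseRing ξ η C).res h e) (NN.res ξ η h x), ?_, ?_⟩
    · rw [freeIncl_single, freeIncl_single, monAlg_map_mono, incl_res]
    · rw [freeEv_single, freeEv_single, ap_res, ap_res]
      exact Prod.ext (ξ.ext.N.res_smul h _ _).symm (η.ext.N.res_smul h _ _).symm

/-- The ideal of the relations of the middle term of the generic butterfly. -/
def relIdeal (U : T) : Ideal ((freePair ξ η C).obj (op U)) where
  carrier := {w | ∃ φ m, freeIncl ξ η C U φ = w ∧ freeEv ξ η C U φ = (ξ.ext.e U m, η.ext.e U m)}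
  zero_mem' := ⟨0, 0, map_zero _, (map_zero _).trans (Prod.ext (map_zero (ξ.ext.e U)).symm (map_zero (η.ext.e U)).symm)⟩
  add_mem' := by
    rintro _ _ ⟨φ, m, rfl, h⟩ ⟨φ', m', rfl, h'⟩
    exact ⟨φ + φ', m + m', map_add _ _ _, (map_add _ _ _).trans ((congrArg₂ _ h h').trans
      (Prod.ext (map_add (ξ.ext.e U) m m').symm (map_add (η.ext.e U) m m').symm))⟩
  smul_mem' := by
    rintro w _ ⟨φ, m, rfl, h⟩
    obtain ⟨ψ, h1, h2⟩ := exists_mul_freeIncl ξ η C w φ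
    -- The evaluations of w in R and R' have the same image in B, so they move e m and e' m by the
    -- same scalar and the value stays in the diagonal copy of M.
    refine ⟨ψ, ap ξ.ext.g U (evR ξ η C U w) • m, h1, ?_⟩
    rw [h2, h, ξ.ext.e_smul, g_evR, ← g_evR', η.ext.e_smul]

theorem relIdeal_res {U V : T} (h : V ⟶ U) (w) (hw : w ∈ relIdeal ξ η C U) :
    ((freePair ξ η C).map h.op).hom w ∈ relIdeal ξ η C V := by
  obtain ⟨φ, m, rfl, h'⟩ := hw
  obtain ⟨ψ, h1, h2⟩ := exists_freeIncl_res ξ η C h φ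
  exact ⟨ψ, M.res h m, h1, h2.trans ((congrArg _ h').trans (Prod.ext (ξ.ext.e_res h m).symm (η.ext.e_res h m).symm))⟩

/-- The middle term of the generic butterfly. -/
noncomputable def genQ : RingSheaf J := quotSheaf (freePair ξ η C) (relIdeal ξ η C) (relIdeal_res ξ η C)

/-- The projection to the middle term of the generic butterfly. -/
noncomputable def toGen (U : T) : (freePair ξ η C).obj (op U) →+* (genQ ξ η C).Sec U :=
  toQuot (freePair ξ η C) (relIdeal ξ η C) (relIdeal_res ξ η C) U

theorem toGen_res {U V : T} (h : V ⟶ U) (w) :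
    toGen ξ η C V (((freePair ξ η C).map h.op).hom w) = (genQ ξ η C).res h (toGen ξ η C U w) :=
  toQuot_res _ _ _ h w

theorem toGen_locally_surj (U : T) (q : (genQ ξ η C).Sec U) :
    Locally J U fun V h => ∃ w, toGen ξ η C V w = (genQ ξ η C).res h q := toQuot_locally_surj _ _ _ U q

theorem toGen_eq_zero {w : (freePair ξ η C).obj (op U)} (hw : w ∈ relIdeal ξ η C U) : toGen ξ η C U w = 0 :=
  (toQuot_eq_zero_iff _ _ (relIdeal_res ξ η C) U w).2 (Locally.of_forall fun _ h => relIdeal_res ξ η C h w hw)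

/-- The algebra over which the generic butterfly is defined. -/
noncomputable def genD : RingSheaf J := ringSheafify (freeA ξ η C)

/-- The projection to the algebra over which the generic butterfly is defined. -/
noncomputable def toGenD (U : T) : (freeA ξ η C).obj (op U) →+* (genD ξ η C).Sec U := toSheafSec (freeA ξ η C) U

theorem toGenD_res {U V : T} (h : V ⟶ U) (w) :
    toGenD ξ η C V (((freeA ξ η C).map h.op).hom w) = (genD ξ η C).res h (toGenD ξ η C U w) :=
  toSheafSec_res _ h w

/-- The structure of an `A`-algebra on `genD`. -/
noncomputable def genStr : A ⟶ genD ξ η C :=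
  mkHom (fun U => (toGenD ξ η C U).comp (monConst _ _ U)) (fun h a => by
    rw [RingHom.comp_apply, RingHom.comp_apply, ← toGenD_res, monConst_apply, monConst_apply, monAlg_map_mono,
      map_one])

/-- The projection of `genD` to `C`. -/
noncomputable def genProj : genD ξ η C ⟶ C.left.right :=
  sheafifyDesc (freeA ξ η C)
    { app := fun U => CommRingCat.ofHom (evC ξ η C U.unop)
      naturality := fun U V h => CommRingCat.hom_ext (RingHom.ext fun w => evC_res ξ η C h.unop w) }

theorem genProj_toGenD (w : (freeA ξ η C).obj (op U)) : ap (genProj ξ η C) U (toGenD ξ η C U w) = evC ξ η C U w :=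
  ap_sheafifyDesc _ _ U w

theorem genStr_genProj : genStr ξ η C ≫ genProj ξ η C = str C.left := ringHom_ext fun U a => by
  refine (genProj_toGenD ξ η C _).trans ?_
  rw [monConst_apply, evC_single, map_one, mul_one]

/-- Local lifts r and r' of the image of c in B give a monomial [(r, c), (r', c)] over c. Monomials
only have to be multiplicative, so no compatibility between the chosen lifts is needed. -/
theorem genProj_locSurj : LocSurj (genProj ξ η C) := by
  intro U c
  refine ((ξ.ext.g_surjective U (ap (toBase C) U c)).and (η.ext.g_surjective U (ap (toBase C) U c))).mono ?_
  rintro V h ⟨⟨r, hr⟩, ⟨r', hr'⟩⟩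
  rw [← ap_res] at hr hr'
  refine ⟨toGenD ξ η C V (mono (fiberProd.mk (fiberProd.mk r (C.left.right.res h c) hr)
    (fiberProd.mk r' (C.left.right.res h c) hr') rfl) 1), ?_⟩
  rw [genProj_toGenD, evC_single, map_one, one_mul]
  rfl

/-- The algebra `A[R ×_B R' ×_B C]` over `B`. -/
noncomputable abbrev genAlg : Over B := overMk (genStr ξ η C) (genProj ξ η C) (genStr_genProj ξ η C)

/-- The map from the middle term of the generic butterfly to `R`. -/
noncomputable def genToR : genQ ξ η C ⟶ ξ.ext.R :=
  quotDesc (relIdeal_res ξ η C) (evR ξ η C) (evR_res ξ η C) (by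
    rintro U _ ⟨φ, m, rfl, h⟩
    rw [evR_freeIncl, h]
    exact ξ.ext.f_e U m)

/-- The map from the middle term of the generic butterfly to `R'`. -/
noncomputable def genToR' : genQ ξ η C ⟶ η.ext.R :=
  quotDesc (relIdeal_res ξ η C) (evR' ξ η C) (evR'_res ξ η C) (by
    rintro U _ ⟨φ, m, rfl, h⟩
    rw [evR'_freeIncl, h]
    exact η.ext.f_e U m)

theorem toGenD_evA_res {U V : T} (h : V ⟶ U) (w : (freePair ξ η C).obj (op U)) :
    (toGenD ξ η C V).comp (evA ξ η C V) (((freePair ξ η C).map h.op).hom w) =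
      (genD ξ η C).res h ((toGenD ξ η C U).comp (evA ξ η C U) w) := by
  rw [RingHom.comp_apply, RingHom.comp_apply, evA_res, toGenD_res]

/-- The map from the middle term of the generic butterfly to `genD`. -/
noncomputable def genBar : genQ ξ η C ⟶ genD ξ η C :=
  quotDesc (relIdeal_res ξ η C) (fun U => (toGenD ξ η C U).comp (evA ξ η C U)) (toGenD_evA_res ξ η C) (by
    rintro U _ ⟨φ, m, rfl, h⟩
    rw [RingHom.comp_apply, evA_freeIncl, map_zero])

theorem genToR_toGen (w : (freePair ξ η C).obj (op U)) : ap (genToR ξ η C) U (toGen ξ η C U w) = evR ξ η C U w :=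
  ap_quotDesc _ _ _ _ U w

theorem genToR'_toGen (w : (freePair ξ η C).obj (op U)) : ap (genToR' ξ η C) U (toGen ξ η C U w) = evR' ξ η C U w :=
  ap_quotDesc _ _ _ _ U w

theorem genBar_toGen (w : (freePair ξ η C).obj (op U)) :
    ap (genBar ξ η C) U (toGen ξ η C U w) = toGenD ξ η C U (evA ξ η C U w) :=
  ap_quotDesc _ _ (toGenD_evA_res ξ η C) _ U w

theorem genToR_g : genToR ξ η C ≫ ξ.ext.g = genBar ξ η C ≫ genProj ξ η C ≫ toBase C := quot_hom_ext fun U w => by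
  change ap ξ.ext.g U (ap (genToR ξ η C) U (toGen ξ η C U w)) =
    ap (toBase C) U (ap (genProj ξ η C) U (ap (genBar ξ η C) U (toGen ξ η C U w)))
  rw [genToR_toGen, genBar_toGen, genProj_toGenD, g_evR]

theorem genToR'_g : genToR' ξ η C ≫ η.ext.g = genBar ξ η C ≫ genProj ξ η C ≫ toBase C := quot_hom_ext fun U w => by
  change ap η.ext.g U (ap (genToR' ξ η C) U (toGen ξ η C U w)) =
    ap (toBase C) U (ap (genProj ξ η C) U (ap (genBar ξ η C) U (toGen ξ η C U w)))
  rw [genToR'_toGen, genBar_toGen, genProj_toGenD, g_evR']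

/-- The map `N × N' → Q`, `(n, n') ↦ ι n - κ n'`. -/
noncomputable def genIncl (U : T) : NN ξ η U →+ (genQ ξ η C).Sec U :=
  ((toGen ξ η C U).comp (monConst _ _ U)).toAddMonoidHom.comp (incl ξ η U)

theorem genIncl_apply (x : NN ξ η U) : genIncl ξ η C U x = toGen ξ η C U (freeIncl ξ η C U (Finsupp.single 1 x)) :=
  congrArg (toGen ξ η C U) (freeIncl_single ξ η C 1 x).symm

theorem freeEv_single_one (x : NN ξ η U) : freeEv ξ η C U (Finsupp.single 1 x) = x := by
  rw [freeEv_single, map_one, map_one, one_smul, one_smul]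

theorem genIncl_res {V : T} (h : V ⟶ U) (x : NN ξ η U) :
    genIncl ξ η C V (NN.res ξ η h x) = (genQ ξ η C).res h (genIncl ξ η C U x) := by
  rw [genIncl_apply, genIncl_apply, freeIncl_single, freeIncl_single, ← toGen_res, monAlg_map_mono, map_one, incl_res]

theorem genToR_genIncl (x : NN ξ η U) : ap (genToR ξ η C) U (genIncl ξ η C U x) = ξ.ext.f U x.1 := by
  rw [genIncl_apply, genToR_toGen, evR_freeIncl, freeEv_single_one]

theorem genToR'_genIncl (x : NN ξ η U) : ap (genToR' ξ η C) U (genIncl ξ η C U x) = η.ext.f U x.2 := by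
  rw [genIncl_apply, genToR'_toGen, evR'_freeIncl, freeEv_single_one]

theorem genBar_genIncl (x : NN ξ η U) : ap (genBar ξ η C) U (genIncl ξ η C U x) = 0 := by
  rw [genIncl_apply, genBar_toGen, evA_freeIncl, map_zero]

/-- A combination and the constant given by its value differ by an element of value 0, which is a
relation with m = 0. Hence the kernel over A[E] is locally the image of N × N' alone. -/
theorem toGen_freeIncl (φ : FreeNN ξ η C U) : toGen ξ η C U (freeIncl ξ η C U φ) = genIncl ξ η C U (freeEv ξ η C U φ) := by
  rw [genIncl_apply, ← sub_eq_zero, ← map_sub, ← map_sub]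
  refine toGen_eq_zero ξ η C ⟨_, 0, rfl, ?_⟩
  rw [map_sub, freeEv_single_one, sub_self, map_zero, map_zero]
  rfl

theorem genIncl_e (m : M.Sec U) : genIncl ξ η C U (ξ.ext.e U m, η.ext.e U m) = 0 := by
  rw [genIncl_apply]
  exact toGen_eq_zero ξ η C ⟨_, m, rfl, freeEv_single_one ξ η C _⟩

/-- Nothing outside M is lost: a constant that is locally a relation is, by injectivity of
`freeIncl`, its own combination, so its value x is of the form (e m, e' m). -/
theorem genIncl_eq_zero (x : NN ξ η U) (H : genIncl ξ η C U x = 0) :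
    Locally J U fun V h => ∃ m, NN.res ξ η h x = (ξ.ext.e V m, η.ext.e V m) := by
  rw [genIncl_apply] at H
  refine ((toQuot_eq_zero_iff _ _ (relIdeal_res ξ η C) U _).1 H).mono ?_
  rintro V h ⟨φ, m, h1, h2⟩
  rw [freeIncl_single, monAlg_map_mono, ← incl_res, ← freeIncl_single, map_one] at h1
  rw [freeIncl_injective ξ η C V h1, freeEv_single_one] at h2
  exact ⟨m, h2⟩

theorem mul_genIncl (q : (genQ ξ η C).Sec U) (x : NN ξ η U) :
    q * genIncl ξ η C U x = genIncl ξ η C U (ap (genToR ξ η C) U q • x.1, ap (genToR' ξ η C) U q • x.2) := by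
  refine (genQ ξ η C).eq_of_locally ((toGen_locally_surj ξ η C U q).mono ?_)
  rintro V h ⟨w, hw⟩
  have e : NN.res ξ η h (ap (genToR ξ η C) U q • x.1, ap (genToR' ξ η C) U q • x.2) =
      (evR ξ η C V w • (NN.res ξ η h x).1, evR' ξ η C V w • (NN.res ξ η h x).2) := by
    rw [← genToR_toGen, ← genToR'_toGen, hw, ap_res, ap_res]
    exact Prod.ext (ξ.ext.N.res_smul h _ _) (η.ext.N.res_smul h _ _)
  rw [map_mul, ← genIncl_res, ← genIncl_res, ← hw, e, genIncl_apply, ← map_mul]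
  obtain ⟨ψ, h1, h2⟩ := exists_mul_freeIncl ξ η C w (Finsupp.single 1 (NN.res ξ η h x))
  rw [← h1, toGen_freeIncl, h2, freeEv_single_one]

theorem evA_locally_surj (v : (freeA ξ η C).obj (op U)) :
    Locally J U fun V h => ∃ w, evA ξ η C V w = ((freeA ξ η C).map h.op).hom v := by
  induction v using monAlg_induction with
  | zero => exact Locally.of_forall fun V h => ⟨0, by rw [map_zero, map_zero]⟩
  | add x y hx hy =>
    refine (hx.and hy).mono ?_
    rintro V h ⟨⟨a, ha⟩, ⟨b, hb⟩⟩
    exact ⟨a + b, by rw [map_add, map_add, ha, hb]⟩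
  | single e a =>
    refine (splitPair_locSurj ξ η U a).mono ?_
    rintro V h ⟨z, hz⟩
    refine ⟨mono ((baseRing ξ η C).res h e) z, ?_⟩
    rw [evA_single, monAlg_map_mono, hz]

/-- The generic butterfly. -/
noncomputable def genBf : Butterfly (ξ.ext.pullback (toBase (genAlg ξ η C))) (η.ext.pullback (toBase (genAlg ξ η C))) where
  Q := genQ ξ η C
  ι U := (genIncl ξ η C U).comp (AddMonoidHom.inl _ _)
  -- With this sign the relation (e m, e' m) = 0 reads ι e m = κ e' m, and the triangle through R'
  -- anticommutes.
  κ U := -(genIncl ξ η C U).comp (AddMonoidHom.inr _ _)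
  ρ := fiberProd.lift (genToR ξ η C) (genBar ξ η C) (genToR_g ξ η C)
  π := fiberProd.lift (genToR' ξ η C) (genBar ξ η C) (genToR'_g ξ η C)
  ι_res h n := by
    refine Eq.trans ?_ (genIncl_res ξ η C h (n, 0))
    exact congrArg (genIncl ξ η C _) (Prod.ext rfl (map_zero (η.ext.N.res h)).symm)
  κ_res h n := by
    refine Eq.trans ?_ ((congrArg Neg.neg (genIncl_res ξ η C h (0, n))).trans (map_neg _ _).symm)
    exact congrArg (fun t => - genIncl ξ η C _ t) (Prod.ext (map_zero (ξ.ext.N.res h)).symm rfl)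
  ι_smul U q n := by
    refine Eq.trans ?_ (mul_genIncl ξ η C q (n, 0)).symm
    exact congrArg (genIncl ξ η C _) (Prod.ext rfl (smul_zero (A := η.ext.N.Sec U) _).symm)
  κ_smul U q n := by
    refine Eq.trans ?_ ((congrArg Neg.neg (mul_genIncl ξ η C q (0, n)).symm).trans (mul_neg _ _).symm)
    exact congrArg (fun t => - genIncl ξ η C _ t) (Prod.ext (smul_zero (A := ξ.ext.N.Sec U) _).symm rfl)
  ρ_ι U n := fiberProd.ext (genToR_genIncl ξ η C (n, 0)) (genBar_genIncl ξ η C (n, 0))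
  π_κ U n := by
    refine (map_neg _ _).trans (congrArg Neg.neg ?_)
    exact fiberProd.ext (genToR'_genIncl ξ η C (0, n)) (genBar_genIncl ξ η C (0, n))
  π_ι U n := fiberProd.ext ((genToR'_genIncl ξ η C (n, 0)).trans (map_zero (η.ext.f U))) (genBar_genIncl ξ η C (n, 0))
  ι_e U m := by
    refine eq_neg_of_add_eq_zero_left (Eq.trans ?_ (genIncl_e ξ η C m))
    refine (map_add (genIncl ξ η C U) _ _).symm.trans (congrArg _ ?_)
    exact Prod.ext (add_zero _) (zero_add _)
  ρ_g := rfl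
  κ_injective U := by
    rw [injective_iff_map_eq_zero]
    intro n hn
    -- If (0, n) = (e m, e' m), then m = 0 because e is injective, so n = 0.
    refine η.ext.N.eq_of_locally ((genIncl_eq_zero ξ η C (0, n) (neg_eq_zero.1 hn)).mono ?_)
    rintro V h ⟨m, hm⟩
    have h1 : ξ.ext.e V m = 0 := (congrArg Prod.fst hm).symm.trans (map_zero (ξ.ext.N.res h))
    have h2 : η.ext.N.res h n = η.ext.e V m := congrArg Prod.snd hm
    have h3 : m = 0 := ξ.ext.e_injective V (h1.trans (map_zero (ξ.ext.e V)).symm)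
    rw [h2, h3, map_zero, map_zero]
  exact_Q := by
    have inj : ∀ U, Function.Injective (-(genIncl ξ η C U).comp (AddMonoidHom.inr _ _)) := by
      intro U
      rw [injective_iff_map_eq_zero]
      intro n hn
      refine η.ext.N.eq_of_locally ((genIncl_eq_zero ξ η C (0, n) (neg_eq_zero.1 hn)).mono ?_)
      rintro V h ⟨m, hm⟩
      have h1 : ξ.ext.e V m = 0 := (congrArg Prod.fst hm).symm.trans (map_zero (ξ.ext.N.res h))
      have h2 : η.ext.N.res h n = η.ext.e V m := congrArg Prod.snd hm
      have h3 : m = 0 := ξ.ext.e_injective V (h1.trans (map_zero (ξ.ext.e V)).symm)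
      rw [h2, h3, map_zero, map_zero]
    intro U q
    constructor
    · intro hq
      have hR : ap (genToR ξ η C) U q = 0 := congrArg (ap (fiberProd.fst _ _) U) hq
      have hD : ap (genBar ξ η C) U q = 0 := congrArg (ap (fiberProd.snd _ _) U) hq
      refine exists_global_preimage_mod η.ext.N (fun U => -(genIncl ξ η C U).comp (AddMonoidHom.inr _ _))
        (fun h n => by
          refine Eq.trans ?_ ((congrArg Neg.neg (genIncl_res ξ η C h (0, n))).trans (map_neg _ _).symm)
          exact congrArg (fun t => - genIncl ξ η C _ t) (Prod.ext (map_zero (ξ.ext.N.res h)).symm rfl)) inj q ?_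
      -- Represent q by some w. Its image in the sheaf A[E] is zero, hence zero in the presheaf
      -- after a further localization. So w has coefficients in N × N', and q is the class of a
      -- single element of N × N'.
      refine (toGen_locally_surj ξ η C U q).bind' ?_
      rintro V h ⟨w, hw⟩
      have h1 : toGenD ξ η C V (evA ξ η C V w) = toGenD ξ η C V 0 := by
        rw [← genBar_toGen, hw, ap_res, hD, map_zero, map_zero]
      refine (locally_eq_of_toSheafSec_eq _ _ _ _ h1).mono ?_
      intro W k hk
      rw [← evA_res, map_zero] at hk
      obtain ⟨φ, hφ⟩ := exists_freeIncl ξ η C _ hk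
      have h2 : genIncl ξ η C W (freeEv ξ η C W φ) = (genQ ξ η C).res (k ≫ h) q := by
        rw [← toGen_freeIncl, hφ, toGen_res, hw, RingSheaf.res_comp]
      have h3 : ξ.ext.f W (freeEv ξ η C W φ).1 = 0 := by
        rw [← genToR_genIncl, h2, ap_res, hR, map_zero]
      obtain ⟨m, hm⟩ := (ξ.ext.exact_N W _).1 h3
      -- Here q is the class of some (e m, x'). Subtracting the relation (e m, e' m) leaves (0, x' -
      -- e' m), which is κ(e' m - x').
      refine ⟨η.ext.e W m - (freeEv ξ η C W φ).2, ?_⟩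
      rw [← h2, ← sub_eq_zero]
      change - genIncl ξ η C W (0, η.ext.e W m - (freeEv ξ η C W φ).2) - _ = 0
      rw [← neg_eq_zero, neg_sub, sub_neg_eq_add, ← map_add, ← genIncl_e ξ η C m]
      exact congrArg _ (Prod.ext ((add_zero _).trans hm.symm) (add_sub_cancel _ _))
    · rintro ⟨n, rfl⟩
      refine (map_neg _ _).trans (neg_eq_zero.2 ?_)
      exact fiberProd.ext ((genToR_genIncl ξ η C (0, n)).trans (map_zero (ξ.ext.f U))) (genBar_genIncl ξ η C (0, n))
  ρ_surjective U x := by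
    obtain ⟨⟨r, d⟩, hx⟩ := x
    have hx' : ap ξ.ext.g U r = ap (toBase C) U (ap (genProj ξ η C) U d) := hx
    refine (toSheafSec_locally_surj _ U d).bind' ?_
    rintro V h ⟨v, hv⟩
    refine (evA_locally_surj ξ η C v).bind' ?_
    rintro W k ⟨w, hw⟩
    have hd : toGenD ξ η C W (evA ξ η C W w) = (genD ξ η C).res (k ≫ h) d := by
      rw [hw, toGenD_res, RingSheaf.res_comp]
      exact congrArg _ hv
    -- The element w already has the right image in A[E]. Its error in R dies in B, so locally it is
    -- f(n), and adding ι n corrects it without changing the image in A[E].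
    refine ((ξ.ext.exact_R W (ξ.ext.R.res (k ≫ h) r - evR ξ η C W w)).1 ?_).mono ?_
    · rw [map_sub, ap_res, hx', g_evR, ← genProj_toGenD, hd, ← ap_res, ← ap_res, sub_self]
    · rintro W' k' ⟨n, hn⟩
      refine ⟨toGen ξ η C W' (((freePair ξ η C).map k'.op).hom w) + genIncl ξ η C W' (n, 0), fiberProd.ext ?_ ?_⟩
      · change ap (genToR ξ η C) W' _ = ξ.ext.R.res ((k' ≫ k) ≫ h) r
        rw [Category.assoc, map_add, genToR_toGen, genToR_genIncl, evR_res, hn, map_sub, add_sub_cancel, ξ.ext.R.res_comp (k ≫ h) k' r]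
      · change ap (genBar ξ η C) W' _ = (genD ξ η C).res ((k' ≫ k) ≫ h) d
        rw [Category.assoc, map_add, genBar_genIncl, add_zero, genBar_toGen, evA_res, toGenD_res, hd, (genD ξ η C).res_comp (k ≫ h) k' d]

/-- The splitting of the generic butterfly over `A`. -/
noncomputable def genSec : SplitPair ξ η ⟶ (genBf ξ η C).Q :=
  mkHom (S := genQ ξ η C) (fun U => (toGen ξ η C U).comp (monConst _ _ U)) (fun h z => by
    refine Eq.trans ?_ (toGen_res ξ η C h _)
    rw [RingHom.comp_apply, monConst_apply, monConst_apply, monAlg_map_mono, map_one])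

theorem isSec_genSec : IsSec (genBf ξ η C) (genSec ξ η C) where
  toR U z := (genToR_toGen ξ η C (mono 1 z)).trans (by rw [evR_single, map_one, mul_one])
  toR' U z := (genToR'_toGen ξ η C (mono 1 z)).trans (by rw [evR'_single, map_one, mul_one])
  bar U z := (genBar_toGen ξ η C (mono 1 z)).trans (by rw [evA_single]; rfl)
  ι U n := congrArg (fun t => toGen ξ η C U (mono 1 t)) (fiberProd.ext rfl (map_zero (η.split.ι U)).symm)
  κ U n := by
    refine Eq.trans ?_ (map_neg (genIncl ξ η C U) (0, n))
    refine congrArg (fun t => toGen ξ η C U (mono 1 t)) (fiberProd.ext ?_ ?_)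
    · refine Eq.trans ?_ (congrArg (ξ.split.ι U) (neg_zero (G := ξ.ext.N.Sec U)).symm)
      exact (map_zero (ξ.split.ι U)).symm
    · exact (map_neg (η.split.ι U) n).symm

/-- Every member of the sieve generated by A[E] → C factors through A[E], so the generic butterfly
pulls back to it. -/
theorem locally_nonempty : ∃ S ∈ algTopology B C, ∀ ⦃D : Over B⦄ (f : D ⟶ C), S f → Nonempty (AlgButterfly ξ η D) := by
  refine ⟨_, generate_mem_algTopology (overProj (genStr ξ η C) (genProj ξ η C) (genStr_genProj ξ η C))
    (genProj_locSurj ξ η C), ?_⟩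
  rintro D _ ⟨E, a, b, hb, rfl⟩
  obtain ⟨⟩ := hb
  exact ⟨restrictObj a (ofSec (isSec_genSec ξ η C))⟩

end AlgButterfly
end Algebras
end Butterflies

namespace Butterflies
variable {T : Type u} [SmallCategory T] {J : GrothendieckTopology T}

/-! ### The topology on algebras over B and the sheaf of derivations. -/

section Algebras
variable {A : RingSheaf J} {B : Under A} {M : ModSheaf B.right}

/-- Morphisms of algebras over `B`. -/
def overHom {D C : Over B} (φ : D.left.right ⟶ C.left.right) (h1 : str D.left ≫ φ = str C.left)
    (h2 : φ ≫ toBase C = toBase D) : D ⟶ C :=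
  Over.homMk (Under.homMk φ h1 : D.left ⟶ C.left) (Under.UnderMorphism.ext h2)

theorem over_hom_ext {D C : Over B} {f g : D ⟶ C} (h : ringMap f = ringMap g) : f = g :=
  Over.OverMorphism.ext (Under.UnderMorphism.ext h)

section FiberProduct
variable {C D E : Over B} (f : D ⟶ C) (g : E ⟶ C)

theorem overProd_w : fiberProd.lift (str D.left) (str E.left) ((str_ringMap f).trans (str_ringMap g).symm) ≫
    fiberProd.snd (ringMap f) (ringMap g) = str E.left := rfl

/-- The fibre product of algebras over `B`. -/
def overProd : Over B :=
  overMk (C := E) (fiberProd.lift (str D.left) (str E.left) ((str_ringMap f).trans (str_ringMap g).symm))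
    (fiberProd.snd (ringMap f) (ringMap g)) (overProd_w f g)

/-- The first projection. -/
def overFst : overProd f g ⟶ D := overHom (fiberProd.fst (ringMap f) (ringMap g)) rfl
  ((congrArg (fiberProd.fst (ringMap f) (ringMap g) ≫ ·) (ringMap_toBase f).symm).trans
    ((congrArg (· ≫ toBase C) (fiberProd.condition (φ := ringMap f) (ψ := ringMap g))).trans
      (congrArg (fiberProd.snd (ringMap f) (ringMap g) ≫ ·) (ringMap_toBase g))))

/-- The second projection. -/
def overSnd : overProd f g ⟶ E := overHom (fiberProd.snd (ringMap f) (ringMap g)) rfl rfl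

theorem overProd_condition : overFst f g ≫ f = overSnd f g ≫ g := over_hom_ext fiberProd.condition

variable {f g} in
/-- Sections of the fibre product. -/
def overPair {U : T} (a : D.left.right.Sec U) (b : E.left.right.Sec U) (h : ap (ringMap f) U a = ap (ringMap g) U b) :
    (overProd f g).left.right.Sec U := fiberProd.mk a b h

end FiberProduct

/-- Finite sets of sections lift locally to a member of the sieve, which may depend on the restriction. -/
def LocLift {C : Over B} (S : Sieve C) : Prop :=
  ∀ (U : T) (Λ : Finset (C.left.right.Sec U)), Locally J U fun V h => ∃ (D : Over B) (f : D ⟶ C), S f ∧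
    ∀ c ∈ Λ, ∃ d : D.left.right.Sec V, ap (ringMap f) V d = C.left.right.res h c

theorem IsCovering.locLift {C : Over B} {S : Sieve C} (H : IsCovering S) : LocLift S := fun U Λ => by
  obtain ⟨D, f, hf, h⟩ := H U Λ
  exact h.mono fun V k hk => ⟨D, f, hf, hk⟩

/-- The topology of the sieves to which finite sets of sections lift locally. -/
def liftTopology (B : Under A) : GrothendieckTopology (Over B) where
  sieves C := {S | LocLift S}
  top_mem' C U Λ := Locally.of_forall fun V h => ⟨C, 𝟙 C, trivial, fun c _ => ⟨C.left.right.res h c, rfl⟩⟩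
  pullback_stable' := by
    classical
    intro C C' S k hS U Λ
    refine (hS U (Λ.image (ap (ringMap k) U))).mono ?_
    rintro V h ⟨D, f, hf, H⟩
    -- A lift of the image of c to D is, together with c, a lift of c to the fibre product D ×_C C'.
    refine ⟨overProd f k, overSnd f k, ?_, fun c hc => ?_⟩
    · change S (overSnd f k ≫ k)
      rw [← overProd_condition]
      exact S.downward_closed hf _
    · obtain ⟨d, hd⟩ := H _ (Finset.mem_image_of_mem _ hc)
      exact ⟨overPair d (C'.left.right.res h c) (hd.trans (ap_res _ h c).symm), rfl⟩
  transitive' := by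
    classical
    intro C S hS R hR U Λ
    refine (hS U Λ).bind' ?_
    rintro V h ⟨D, f, hf, H⟩
    -- The chosen lifts of Λ form a finite set again, so the second sieve applies to it. Different
    -- members V of the first covering lead to different algebras, so the lifting algebra has to be
    -- allowed to vary locally.
    choose! d hd using H
    refine (hR hf V (Λ.image d)).mono ?_
    rintro W k ⟨E, g, hg, H'⟩
    refine ⟨E, g ≫ f, hg, fun c hc => ?_⟩
    obtain ⟨e, he⟩ := H' _ (Finset.mem_image_of_mem d hc)
    refine ⟨e, (congrArg (ap (ringMap f) W) he).trans ?_⟩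
    rw [ap_res, hd c hc, RingSheaf.res_comp]

/-- The generated topology is contained in every topology having the generating sieves, and
`liftTopology` is one of these. Its covering sieves have an explicit description, so the sheaf and
stack conditions are proved for it and then restricted. -/
theorem algTopology_le_liftTopology (B : Under A) : algTopology B ≤ liftTopology B :=
  sInf_le fun _ _ H => H.locLift

/-- The members of a sieve. -/
abbrev SieveArrow {C : Over B} (S : Sieve C) : Type (u + 1) := {f : Σ D : Over B, D ⟶ C // S f.2}

theorem LocLift.pairLift {C : Over B} {S : Sieve C} (H : LocLift S) :
    PairLift (fun f : SieveArrow S => ringMap f.1.2) := by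
  classical
  intro U x y
  refine (H U {x, y}).mono ?_
  rintro V h ⟨D, f, hf, H'⟩
  obtain ⟨a, ha⟩ := H' x (by simp)
  obtain ⟨b, hb⟩ := H' y (by simp)
  exact ⟨⟨⟨D, f⟩, hf⟩, a, b, ha, hb⟩

section DerSheaf
variable {C : Over B} {S : Sieve C}

theorem Der.eq_of_locLift (hS : LocLift S) {d d' : Der M C}
    (H : ∀ ⦃D : Over B⦄ (f : D ⟶ C), S f → Der.comp M f d = Der.comp M f d') : d = d' := by
  refine Subtype.ext (funext fun U => AddMonoidHom.ext fun x => M.restrict (toBase C) |>.eq_of_locally ?_)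
  refine (hS.pairLift U x x).mono ?_
  rintro V h ⟨⟨⟨D, f⟩, hf⟩, a, -, ha, -⟩
  have := congrArg (fun t => t.1 V a) (H f hf)
  change d.1 V (ap (ringMap f) V a) = d'.1 V (ap (ringMap f) V a) at this
  rw [ha, d.2.1, d'.2.1] at this
  exact this

variable (hS : LocLift S) (d : ∀ ⦃D : Over B⦄ (f : D ⟶ C), S f → Der M D)
  (H : ∀ ⦃D : Over B⦄ (f : D ⟶ C) (hf : S f) ⦃E : Over B⦄ (g : E ⟶ C) (hg : S g) ⦃X : Over B⦄ (a : X ⟶ D) (b : X ⟶ E),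
    a ≫ f = b ≫ g → Der.comp M a (d f hf) = Der.comp M b (d g hg))

include H in
-- Sections of D and E with the same image in C form a section of D ×_C E, where the two derivations
-- agree by hypothesis.
theorem der_compat {D E : Over B} (f : D ⟶ C) (hf : S f) (g : E ⟶ C) (hg : S g) {U : T} (a : D.left.right.Sec U)
    (b : E.left.right.Sec U) (h : ap (ringMap f) U a = ap (ringMap g) U b) : (d f hf).1 U a = (d g hg).1 U b :=
  congrArg (fun t => t.1 U (overPair a b h)) (H f hf g hg (overFst f g) (overSnd f g) (overProd_condition f g))

include hS H in
theorem glueDer_exists (U : T) (x : C.left.right.Sec U) : ∃ y : M.Sec U, ∀ (V : T) (h : V ⟶ U) (D : Over B) (f : D ⟶ C)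
    (hf : S f) (a : D.left.right.Sec V), ap (ringMap f) V a = C.left.right.res h x → M.res h y = (d f hf).1 V a := by
  obtain ⟨y, hy⟩ := M.exists_of_locally_unique (fun V h y => ∃ (D : Over B) (f : D ⟶ C) (hf : S f)
      (a : D.left.right.Sec V), ap (ringMap f) V a = C.left.right.res h x ∧ (d f hf).1 V a = y) (by
      rintro V h W k y ⟨D, f, hf, a, h1, rfl⟩
      exact ⟨D, f, hf, D.left.right.res k a, by rw [ap_res, h1, RingSheaf.res_comp], (d f hf).2.1 k a⟩) (by
      rintro V h y y' ⟨D, f, hf, a, h1, rfl⟩ ⟨E, g, hg, b, h2, rfl⟩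
      exact der_compat d H f hf g hg a b (h1.trans h2.symm)) ((hS.pairLift U x x).mono fun V h => by
        rintro ⟨⟨⟨D, f⟩, hf⟩, a, -, ha, -⟩
        exact ⟨_, D, f, hf, a, ha, rfl⟩)
  refine ⟨y, fun V h D f hf a ha => M.eq_of_locally ((hy.pull h).mono ?_)⟩
  rintro W k ⟨E, g, hg, b, h1, h2⟩
  rw [← M.res_comp, ← h2, ← (d f hf).2.1]
  refine der_compat d H g hg f hf _ _ ?_
  rw [ap_res, ha, h1, RingSheaf.res_comp]

include hS H in
theorem exists_glueDer : ∃ δ : Der M C, ∀ ⦃D : Over B⦄ (f : D ⟶ C) (hf : S f), Der.comp M f δ = d f hf := by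
  choose y hy using fun U x => glueDer_exists hS d H U x
  refine ⟨⟨fun U =>
    { toFun := y U
      map_zero' := ?_
      map_add' := ?_ }, ?_, ?_, ?_⟩, fun D f hf => Subtype.ext (funext fun U => AddMonoidHom.ext fun a => ?_)⟩
  · refine M.eq_of_locally ((hS.pairLift U 0 0).mono ?_)
    rintro V h ⟨⟨⟨D, f⟩, hf⟩, -⟩
    rw [hy U 0 V h D f hf 0 (by rw [map_zero, map_zero]), map_zero, map_zero]
  · intro x x'
    refine M.eq_of_locally ((hS.pairLift U x x').mono ?_)
    rintro V h ⟨⟨⟨D, f⟩, hf⟩, a, b, ha, hb⟩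
    rw [hy U _ V h D f hf (a + b) (by rw [map_add, map_add, ha, hb]), map_add, map_add,
      hy U x V h D f hf a ha, hy U x' V h D f hf b hb]
  · intro U V h x
    change y V (C.left.right.res h x) = M.res h (y U x)
    refine M.eq_of_locally ((hS.pairLift V (C.left.right.res h x) 0).mono ?_)
    rintro W k ⟨⟨⟨D, f⟩, hf⟩, a, -, ha, -⟩
    refine (hy V _ W k D f hf a ha).trans ?_
    rw [← M.res_comp]
    exact (hy U x W (k ≫ h) D f hf a (by rw [RingSheaf.res_comp]; exact ha)).symm
  · intro U x x'
    change y U (x * x') = ap (toBase C) U x • y U x' + ap (toBase C) U x' • y U x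
    refine M.eq_of_locally ((hS.pairLift U x x').mono ?_)
    rintro V h ⟨⟨⟨D, f⟩, hf⟩, a, b, ha, hb⟩
    dsimp only at ha hb
    rw [hy U _ V h D f hf (a * b) (by rw [map_mul, map_mul, ha, hb]), map_add, M.res_smul, M.res_smul,
      hy U x V h D f hf a ha, hy U x' V h D f hf b hb, (d f hf).2.2.1, ← ap_res, ← ap_res, ← ha, ← hb,
      ← ringMap_toBase f]
    rfl
  · intro U a
    change y U (ap (str C.left) U a) = 0
    refine M.eq_of_locally ((hS.pairLift U 0 0).mono ?_)
    rintro V h ⟨⟨⟨D, f⟩, hf⟩, -⟩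
    rw [hy U _ V h D f hf (ap (str D.left) V (A.res h a)) (by rw [← ap_res, ← str_ringMap f]; rfl), (d f hf).2.2.2,
      map_zero]
  · refine Eq.trans ?_ (hy U (ap (ringMap f) U a) U (𝟙 U) D f hf a (RingSheaf.res_id _ _ _).symm)
    exact (M.res_id _ _).symm

end DerSheaf

/-- The sheaf condition is tested on maps from a group E. The derivations are glued for each element
of E separately, and uniqueness of the glued derivation makes the result additive in E. -/
theorem derPresheaf_isSheaf (B : Under A) (M : ModSheaf B.right) : Presheaf.IsSheaf (liftTopology B) (derPresheaf B M) := by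
  intro E C S hS x hx
  have hS' : LocLift S := hS
  have H (e : E) : ∃ δ : Der M C, ∀ ⦃D : Over B⦄ (f : D ⟶ C) (hf : S f), Der.comp M f δ = (x f hf).hom e :=
    exists_glueDer hS' (fun D f hf => (x f hf).hom e) (fun D f hf D' g hg X a b h =>
      congrArg (fun t => t.hom e) (hx a b hf hg h))
  choose δ hδ using H
  refine ⟨AddCommGrpCat.ofHom
    { toFun := δ
      map_zero' := Der.eq_of_locLift hS' fun D f hf =>
        (hδ _ f hf).trans ((map_zero (x f hf).hom).trans (map_zero (Der.comp M f)).symm)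
      map_add' := fun e e' => Der.eq_of_locLift hS' fun D f hf =>
        (hδ _ f hf).trans ((map_add (x f hf).hom e e').trans ((congrArg₂ _ (hδ _ f hf).symm (hδ _ f hf).symm).trans
          (map_add (Der.comp M f) _ _).symm)) },
    fun D f hf => AddCommGrpCat.hom_ext (AddMonoidHom.ext fun e => hδ e f hf), fun t ht => ?_⟩
  refine AddCommGrpCat.hom_ext (AddMonoidHom.ext fun e => Der.eq_of_locLift hS' fun D f hf => ?_)
  exact (congrArg (fun s => s.hom e) (ht f hf)).trans (hδ e f hf).symm

theorem derPresheaf_isSheaf_algTopology (B : Under A) (M : ModSheaf B.right) :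
    Presheaf.IsSheaf (algTopology B) (derPresheaf B M) := fun E =>
  Presieve.isSheaf_of_le _ (algTopology_le_liftTopology B) (derPresheaf_isSheaf B M E)

end Algebras
end Butterflies

namespace Butterflies
variable {T : Type u} [SmallCategory T] {J : GrothendieckTopology T}

/-! ### Descent data read on sections of sheaves of rings. -/

section Realization
universe v' w' t
variable {A : RingSheaf J} (B : Under A)

/-- The objects of a fibered category over `A-alg/B` as sheaves of rings over algebras over `B`, such that
pullbacks correspond to fibre products. -/
structure Realization (F : Pseudofunctor (LocallyDiscrete (Over B)ᵒᵖ) Cat.{v', w'}) where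
  El {C : Over B} (x : F.obj (.mk (op C))) : RingSheaf J
  el {C : Over B} {x y : F.obj (.mk (op C))} (φ : x ⟶ y) : El x ⟶ El y
  el_id {C : Over B} (x : F.obj (.mk (op C))) : el (𝟙 x) = 𝟙 (El x)
  el_comp {C : Over B} {x y z : F.obj (.mk (op C))} (φ : x ⟶ y) (ψ : y ⟶ z) : el (φ ≫ ψ) = el φ ≫ el ψ
  bar {C : Over B} (x : F.obj (.mk (op C))) : El x ⟶ C.left.right
  el_bar {C : Over B} {x y : F.obj (.mk (op C))} (φ : x ⟶ y) : el φ ≫ bar y = bar x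
  pr {C D : Over B} (f : D ⟶ C) (x : F.obj (.mk (op C))) : El ((F.map f.op.toLoc).toFunctor.obj x) ⟶ El x
  pr_bar {C D : Over B} (f : D ⟶ C) (x : F.obj (.mk (op C))) : pr f x ≫ bar x = bar _ ≫ ringMap f
  map_pr {C D : Over B} (f : D ⟶ C) {x y : F.obj (.mk (op C))} (φ : x ⟶ y) :
    el ((F.map f.op.toLoc).toFunctor.map φ) ≫ pr f y = pr f x ≫ el φ
  mapComp_pr {C D E : Over B} (f : D ⟶ C) (g : E ⟶ D) (x : F.obj (.mk (op C))) :
    el ((F.mapComp f.op.toLoc g.op.toLoc).inv.toNatTrans.app x) ≫ pr (g ≫ f) x =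
      pr g ((F.map f.op.toLoc).toFunctor.obj x) ≫ pr f x
  ext {C D : Over B} (f : D ⟶ C) (x : F.obj (.mk (op C))) {U : T}
    {a b : (El ((F.map f.op.toLoc).toFunctor.obj x)).Sec U} (h : ap (pr f x) U a = ap (pr f x) U b)
    (h' : ap (bar _) U a = ap (bar _) U b) : a = b
  exists_pr {C D : Over B} (f : D ⟶ C) (x : F.obj (.mk (op C))) {U : T} (a : (El x).Sec U) (d : D.left.right.Sec U)
    (h : ap (bar x) U a = ap (ringMap f) U d) : ∃ b, ap (pr f x) U b = a ∧ ap (bar _) U b = d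

namespace Realization
variable {B} {F : Pseudofunctor (LocallyDiscrete (Over B)ᵒᵖ) Cat.{v', w'}} (r : Realization B F)
  {C D E : Over B}

theorem mapComp'_inv_pr (f : D ⟶ C) (g : E ⟶ D) (q : E ⟶ C) (h : f.op.toLoc ≫ g.op.toLoc = q.op.toLoc) (x : F.obj (.mk (op C))) :
    r.el ((F.mapComp' f.op.toLoc g.op.toLoc q.op.toLoc h).inv.toNatTrans.app x) ≫ r.pr q x =
      r.pr g ((F.map f.op.toLoc).toFunctor.obj x) ≫ r.pr f x := by
  obtain rfl : g ≫ f = q := Quiver.Hom.op_inj (congrArg Discrete.as h)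
  rw [← r.mapComp_pr, ← Pseudofunctor.mapComp'_eq_mapComp]
  rfl

theorem mapComp'_hom_pr (f : D ⟶ C) (g : E ⟶ D) (q : E ⟶ C) (h : f.op.toLoc ≫ g.op.toLoc = q.op.toLoc) (x : F.obj (.mk (op C))) :
    r.el ((F.mapComp' f.op.toLoc g.op.toLoc q.op.toLoc h).hom.toNatTrans.app x) ≫
      r.pr g ((F.map f.op.toLoc).toFunctor.obj x) ≫ r.pr f x = r.pr q x := by
  rw [← r.mapComp'_inv_pr f g q h x, ← Category.assoc, ← r.el_comp, Cat.Hom.hom_inv_id_toNatTrans_app, r.el_id, Category.id_comp]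

theorem el_comp_apply {x y z : F.obj (.mk (op C))} (φ : x ⟶ y) (ψ : y ⟶ z) {U : T} (a : (r.El x).Sec U) :
    ap (r.el (φ ≫ ψ)) U a = ap (r.el ψ) U (ap (r.el φ) U a) := congrArg (fun t => ap t U a) (r.el_comp φ ψ)

theorem bar_el_apply {x y : F.obj (.mk (op C))} (φ : x ⟶ y) {U : T} (a : (r.El x).Sec U) :
    ap (r.bar y) U (ap (r.el φ) U a) = ap (r.bar x) U a := congrArg (fun t => ap t U a) (r.el_bar φ)

theorem pr_map_apply (f : D ⟶ C) {x y : F.obj (.mk (op C))} (φ : x ⟶ y) {U : T}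
    (a : (r.El ((F.map f.op.toLoc).toFunctor.obj x)).Sec U) :
    ap (r.pr f y) U (ap (r.el ((F.map f.op.toLoc).toFunctor.map φ)) U a) = ap (r.el φ) U (ap (r.pr f x) U a) :=
  congrArg (fun t => ap t U a) (r.map_pr f φ)

theorem bar_pr_apply (f : D ⟶ C) (x : F.obj (.mk (op C))) {U : T} (a : (r.El ((F.map f.op.toLoc).toFunctor.obj x)).Sec U) :
    ap (r.bar x) U (ap (r.pr f x) U a) = ap (ringMap f) U (ap (r.bar _) U a) :=
  congrArg (fun t => ap t U a) (r.pr_bar f x)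

section Family
variable {I : Type t} {X : I → Over B} {f : ∀ i, X i ⟶ C}

theorem ofObj_hom_pr (x : F.obj (.mk (op C))) (q : E ⟶ C) (i j : I) (f₁ : E ⟶ X i) (f₂ : E ⟶ X j) (h₁ : f₁ ≫ f i = q)
    (h₂ : f₂ ≫ f j = q) {U : T} (a : (r.El ((F.map f₁.op.toLoc).toFunctor.obj ((F.map (f i).op.toLoc).toFunctor.obj x))).Sec U) :
    ap (r.pr (f j) x) U (ap (r.pr f₂ _) U (ap (r.el (((F.toDescentData f).obj x).hom q f₁ f₂ h₁ h₂)) U a)) =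
      ap (r.pr (f i) x) U (ap (r.pr f₁ _) U a) :=
  (congrArg (fun t => ap (r.pr (f j) x) U (ap (r.pr f₂ _) U t)) (r.el_comp_apply _ _ a)).trans
    ((congrArg (fun t => ap t U _) (r.mapComp'_hom_pr (f j) f₂ q _ x)).trans
      (congrArg (fun t => ap t U a) (r.mapComp'_inv_pr (f i) f₁ q _ x)))

/-- Since a and b have the same image in C, the section a comes from a section c over X i ×_C X j,
and the descent isomorphism of x carries c to a section over b. The claim is the commutation of Φ
with the descent isomorphisms, evaluated at c. -/
theorem descent_compat {x y : F.obj (.mk (op C))} (Φ : (F.toDescentData f).obj x ⟶ (F.toDescentData f).obj y) {U : T} (i j : I)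
    (a : (r.El ((F.map (f i).op.toLoc).toFunctor.obj x)).Sec U) (b : (r.El ((F.map (f j).op.toLoc).toFunctor.obj x)).Sec U)
    (h : ap (r.pr (f i) x) U a = ap (r.pr (f j) x) U b) :
    ap (r.pr (f i) y) U (ap (r.el (Φ.hom i)) U a) = ap (r.pr (f j) y) U (ap (r.el (Φ.hom j)) U b) := by
  have hd : ap (ringMap (f i)) U (ap (r.bar _) U a) = ap (ringMap (f j)) U (ap (r.bar _) U b) := by
    rw [← r.bar_pr_apply, ← r.bar_pr_apply, h]
  have hcomm := Φ.comm (overFst (f i) (f j) ≫ f i) (overFst (f i) (f j)) (overSnd (f i) (f j)) rfl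
    (overProd_condition (f i) (f j)).symm
  obtain ⟨c, hc, hc'⟩ := r.exists_pr (overFst (f i) (f j)) _ a (overPair _ _ hd) rfl
  have e1 : ap (r.pr (f j) y) U (ap (r.pr (overSnd (f i) (f j)) _) U (ap (r.el (_ ≫ _)) U c)) =
      ap (r.pr (f i) y) U (ap (r.el (Φ.hom i)) U a) :=
    (congrArg (fun t => ap (r.pr (f j) y) U (ap (r.pr (overSnd (f i) (f j)) _) U t))
      (r.el_comp_apply ((F.map (overFst (f i) (f j)).op.toLoc).toFunctor.map (Φ.hom i))
        (((F.toDescentData f).obj y).hom (overFst (f i) (f j) ≫ f i) (overFst (f i) (f j)) (overSnd (f i) (f j)) rfl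
          (overProd_condition (f i) (f j)).symm) c)).trans ((r.ofObj_hom_pr y _ i j _ _ _ _ _).trans
      (congrArg (ap (r.pr (f i) y) U) ((r.pr_map_apply _ (Φ.hom i) c).trans (congrArg _ hc))))
  have e2 : ap (r.pr (overSnd (f i) (f j)) _) U (ap (r.el (((F.toDescentData f).obj x).hom (overFst (f i) (f j) ≫ f i)
      (overFst (f i) (f j)) (overSnd (f i) (f j)) rfl (overProd_condition (f i) (f j)).symm)) U c) = b := by
    refine r.ext (f j) x ?_ ?_
    · exact (r.ofObj_hom_pr x _ i j _ _ _ _ c).trans ((congrArg _ hc).trans h)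
    · exact (r.bar_pr_apply _ _ _).trans (congrArg _ ((r.bar_el_apply _ c).trans hc'))
  have e3 : ap (r.pr (f j) y) U (ap (r.pr (overSnd (f i) (f j)) _) U (ap (r.el (_ ≫ _)) U c)) =
      ap (r.pr (f j) y) U (ap (r.el (Φ.hom j)) U b) :=
    (congrArg (fun t => ap (r.pr (f j) y) U (ap (r.pr (overSnd (f i) (f j)) _) U t))
      (r.el_comp_apply (((F.toDescentData f).obj x).hom (overFst (f i) (f j) ≫ f i) (overFst (f i) (f j)) (overSnd (f i) (f j)) rfl
          (overProd_condition (f i) (f j)).symm) ((F.map (overSnd (f i) (f j)).op.toLoc).toFunctor.map (Φ.hom j)) c)).trans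
      (congrArg (ap (r.pr (f j) y) U) ((r.pr_map_apply _ (Φ.hom j) _).trans (congrArg _ e2)))
  exact e1.symm.trans ((congrArg (fun t => ap (r.pr (f j) y) U (ap (r.pr (overSnd (f i) (f j)) _) U (ap (r.el t) U c))) hcomm).trans e3)

end Family
end Realization
end Realization

section Algebras
variable {A : RingSheaf J} {B : Under A} {M : ModSheaf B.right} (ξ η : AlgTwoExt B M)

/-- The realization of a butterfly by its middle term. -/
def isomRealization : Realization B (Isom ξ η) where
  El {C} x := (show AlgButterfly ξ η C from x).bf.Q
  el {C x y} φ := (show AlgButterfly.Hom (ξ := ξ) (η := η) (C := C) x y from φ).f.φ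
  el_id _ := rfl
  el_comp _ _ := rfl
  bar {C} x := (show AlgButterfly ξ η C from x).bf.bar
  el_bar {C x y} φ := ringHom_ext fun U q => (show AlgButterfly.Hom (ξ := ξ) (η := η) (C := C) x y from φ).f.ap_bar U q
  pr {C D} f x := fiberProd.fst (show AlgButterfly ξ η C from x).bf.bar (ringMap f)
  pr_bar _ _ := fiberProd.condition
  map_pr _ _ _ _ := rfl
  mapComp_pr _ _ _ := rfl
  ext _ _ _ _ _ h h' := fiberProd.ext h h'
  exists_pr f x U a d h := ⟨fiberProd.mk a d h, rfl, rfl⟩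

end Algebras
end Butterflies

namespace Butterflies
variable {T : Type u} [SmallCategory T] {J : GrothendieckTopology T}

/-! ### Gluing of morphisms of butterflies. -/

section Algebras
variable {A : RingSheaf J} {B : Under A} {M : ModSheaf B.right} {ξ η : AlgTwoExt B M}

namespace AlgButterfly
variable {C D E : Over B}

/-- Sections of the pullback of a butterfly. -/
def restrictMk (f : D ⟶ C) (X : AlgButterfly ξ η C) {U : T} (q : X.bf.Q.Sec U) (d : D.left.right.Sec U)
    (h : ap X.bf.bar U q = ap (ringMap f) U d) : (restrictObj f X).bf.Q.Sec U := fiberProd.mk q d h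

theorem restrict_ext {f : D ⟶ C} {X : AlgButterfly ξ η C} {U : T} {x y : (restrictObj f X).bf.Q.Sec U}
    (h1 : x.1.1 = y.1.1) (h2 : x.1.2 = y.1.2) : x = y := fiberProd.ext h1 h2

theorem bar_fst {f : D ⟶ C} {X : AlgButterfly ξ η C} {U : T} (x : (restrictObj f X).bf.Q.Sec U) :
    ap X.bf.bar U x.1.1 = ap (ringMap f) U x.1.2 := x.2

theorem hom_snd {f : D ⟶ C} {X Y : AlgButterfly ξ η C} {U : T} (φ : restrictObj f X ⟶ restrictObj f Y)
    (x : (restrictObj f X).bf.Q.Sec U) : (ap φ.f.φ U x).1.2 = x.1.2 :=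
  φ.f.ap_bar U x

section Family
variable {I : Type*} {X : I → Over B} (f : ∀ i, X i ⟶ C)

/-- Pairs of sections lift locally to a member of the family. -/
def FamLift : Prop := PairLift (fun i => ringMap (f i))

variable {f} (hf : FamLift f) {x y : AlgButterfly ξ η C}

include hf in
theorem FamLift.pairLift : PairLift (fun i => fiberProd.fst x.bf.bar (ringMap (f i))) := by
  intro U a b
  refine (hf U (ap x.bf.bar U a) (ap x.bf.bar U b)).mono ?_
  rintro V h ⟨i, d, e, hd, he⟩
  rw [← ap_res] at hd he
  exact ⟨i, restrictMk (f i) x _ d hd.symm, restrictMk (f i) x _ e he.symm, rfl, rfl⟩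

include hf in
theorem map_injective {φ ψ : x ⟶ y}
    (h : ∀ i, ((restrict (f i)).map φ : restrictObj (f i) x ⟶ _) = (restrict (f i)).map ψ) : φ = ψ := by
  refine hom_ext (hom_ext_of_pairLift (hf.pairLift (x := x)) fun i => ringHom_ext fun U a => ?_)
  exact congrArg (fun t => (ap (Hom.f (X := restrictObj (f i) x) (Y := restrictObj (f i) y) t).φ U a).1.1) (h i)

variable (Φ : ∀ i, restrictObj (f i) x ⟶ restrictObj (f i) y)
  (H : ∀ (U : T) (i j : I) (a : (restrictObj (f i) x).bf.Q.Sec U) (b : (restrictObj (f j) x).bf.Q.Sec U),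
    a.1.1 = b.1.1 → (ap (Φ i).f.φ U a).1.1 = (ap (Φ j).f.φ U b).1.1)

include hf H in
-- The pullbacks of Q to the members of the family cover Q in the sense of `PairLift`, so the ring
-- maps glue. Compatibility with the structure maps is an equation of sections, to be checked
-- locally over one member.
theorem exists_glue : ∃ φ : x ⟶ y, ∀ i, ((restrict (f i)).map φ : restrictObj (f i) x ⟶ _) = Φ i := by
  have hx := hf.pairLift (x := x)
  obtain ⟨g, hg⟩ : ∃ g : x.bf.Q ⟶ y.bf.Q, ∀ (U : T) (i : I) (a : (restrictObj (f i) x).bf.Q.Sec U),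
      ap g U a.1.1 = (ap (Φ i).f.φ U a).1.1 :=
    ⟨glueHom hx (fun i => (Φ i).f.φ ≫ fiberProd.fst y.bf.bar (ringMap (f i))) H, fun U i a =>
      ap_glueHom hx (fun i => (Φ i).f.φ ≫ fiberProd.fst y.bf.bar (ringMap (f i))) H U i a⟩
  refine ⟨homMk (Butterfly.homMk g ?_ ?_ ?_ ?_ ?_) ?_, ?_⟩
  · intro U n
    refine RingSheaf.eq_of_locally _ ((hf U 0 0).mono ?_)
    rintro V h ⟨i, -⟩
    rw [← ap_res, ← x.bf.ι_res, ← y.bf.ι_res]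
    exact (hg V i ((restrictObj (f i) x).bf.ι V (ξ.ext.N.res h n))).trans
      (congrArg (fun t => t.1.1) ((Φ i).f.φ_ι V (ξ.ext.N.res h n)))
  · intro U n
    refine RingSheaf.eq_of_locally _ ((hf U 0 0).mono ?_)
    rintro V h ⟨i, -⟩
    rw [← ap_res, ← x.bf.κ_res, ← y.bf.κ_res]
    exact (hg V i ((restrictObj (f i) x).bf.κ V (η.ext.N.res h n))).trans
      (congrArg (fun t => t.1.1) ((Φ i).f.φ_κ V (η.ext.N.res h n)))
  · intro U q
    refine RingSheaf.eq_of_locally _ ((hx U q q).mono ?_)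
    rintro V h ⟨i, a, -, ha, -⟩
    change a.1.1 = _ at ha
    rw [← ap_res, ← ap_res, ← ap_res, ← ha]
    exact (congrArg (ap y.bf.toR V) (hg V i a)).trans ((Φ i).f.ap_toR V a)
  · intro U q
    refine RingSheaf.eq_of_locally _ ((hx U q q).mono ?_)
    rintro V h ⟨i, a, -, ha, -⟩
    change a.1.1 = _ at ha
    rw [← ap_res, ← ap_res, ← ap_res, ← ha]
    exact (congrArg (ap y.bf.toR' V) (hg V i a)).trans ((Φ i).f.ap_toR' V a)
  · intro U q
    refine RingSheaf.eq_of_locally _ ((hx U q q).mono ?_)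
    rintro V h ⟨i, a, -, ha, -⟩
    change a.1.1 = _ at ha
    rw [← ap_res, ← ap_res, ← ap_res, ← ha]
    refine (congrArg (ap y.bf.bar V) (hg V i a)).trans ((bar_fst _).trans (Eq.trans ?_ (bar_fst (f := f i) a).symm))
    exact congrArg (ap (ringMap (f i)) V) (hom_snd (Φ i) a)
  · intro U z
    refine RingSheaf.eq_of_locally _ ((hf U 0 0).mono ?_)
    rintro V h ⟨i, -⟩
    change y.bf.Q.res h (ap g U _) = _
    rw [← ap_res, ← ap_res, ← ap_res]
    refine (congrArg (ap g V) (fst_sec_restrictObj (f i) x V _).symm).trans ((hg V i _).trans ?_)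
    refine Eq.trans ?_ (fst_sec_restrictObj (f i) y V _)
    exact congrArg (fun t => t.1.1) (Hom.ap_sec (Φ i) V ((SplitPair ξ η).res h z))
  · intro i
    refine hom_ext (ringHom_ext fun U a => restrict_ext ?_ ?_)
    · exact hg U i a
    · exact (hom_snd (Φ i) a).symm

include hf in
theorem toDescentData_fullyFaithful : Nonempty ((Isom ξ η).toDescentData f).FullyFaithful := by
  rw [Functor.FullyFaithful.nonempty_iff_map_bijective]
  intro x y
  refine ⟨fun φ ψ h => map_injective hf fun i => congrArg (fun t => Pseudofunctor.DescentData.Hom.hom t i) h, fun Φ => ?_⟩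
  obtain ⟨φ, hφ⟩ := exists_glue hf (x := x) (y := y) (fun i => Φ.hom i) (fun U i j a b hab =>
    (isomRealization ξ η).descent_compat Φ i j a b hab)
  exact ⟨φ, Pseudofunctor.DescentData.hom_ext hφ⟩

end Family

end AlgButterfly

theorem isom_isPrestack (ξ η : AlgTwoExt B M) : (Isom ξ η).IsPrestack (liftTopology B) := by
  refine Pseudofunctor.IsPrestack.of_isPrestackFor fun C S hS => ⟨AlgButterfly.toDescentData_fullyFaithful ?_⟩
  have hS' : LocLift S := hS
  intro U x y
  refine (hS'.pairLift U x y).mono ?_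
  rintro V h ⟨⟨⟨D, f⟩, hf⟩, a, b, ha, hb⟩
  exact ⟨⟨Over.mk f, hf⟩, a, b, ha, hb⟩

end Algebras
end Butterflies

namespace Butterflies
variable {T : Type u} [SmallCategory T] {J : GrothendieckTopology T}

/-! ### The relation between sections defined by a descent datum. -/

section Descent
universe v' w' t
variable {A : RingSheaf J} {B : Under A}

/-- The map to a fibre product of algebras over `B`. -/
def overLift {C D E Y : Over B} {f : D ⟶ C} {g : E ⟶ C} (a : Y ⟶ D) (b : Y ⟶ E) (h : a ≫ f = b ≫ g) :
    Y ⟶ overProd f g :=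
  overHom (fiberProd.lift (ringMap a) (ringMap b) (congrArg (fun t => ringMap t) h))
    (fiberProd.hom_ext (str_ringMap a) (str_ringMap b)) (ringMap_toBase b)

theorem overLift_fst {C D E Y : Over B} {f : D ⟶ C} {g : E ⟶ C} (a : Y ⟶ D) (b : Y ⟶ E) (h : a ≫ f = b ≫ g) :
    overLift a b h ≫ overFst f g = a := over_hom_ext rfl

theorem overLift_snd {C D E Y : Over B} {f : D ⟶ C} {g : E ⟶ C} (a : Y ⟶ D) (b : Y ⟶ E) (h : a ≫ f = b ≫ g) :
    overLift a b h ≫ overSnd f g = b := over_hom_ext rfl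

variable {F : Pseudofunctor (LocallyDiscrete (Over B)ᵒᵖ) Cat.{v', w'}}

namespace Realization
variable (r : Realization B F) {C : Over B} {I : Type t} {X : I → Over B} {f : ∀ i, X i ⟶ C} (D : F.DescentData f)

/-- The descent isomorphism over the fibre product of two members of the family. -/
abbrev descentHom (i j : I) :=
  D.hom (overFst (f i) (f j) ≫ f i) (overFst (f i) (f j)) (overSnd (f i) (f j)) rfl (overProd_condition (f i) (f j)).symm

/-- Sections over members of the family that are identified by the descent datum. -/
def Rel {i j : I} {U : T} (a : (r.El (D.obj i)).Sec U) (b : (r.El (D.obj j)).Sec U) : Prop :=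
  ∃ c : (r.El ((F.map (overFst (f i) (f j)).op.toLoc).toFunctor.obj (D.obj i))).Sec U,
    ap (r.pr _ _) U c = a ∧ ap (r.pr (overSnd (f i) (f j)) (D.obj j)) U (ap (r.el (descentHom D i j)) U c) = b

/-- Pulling a morphism back along Y' → Y does not change its effect on sections after projection to
x and y. The comparison isomorphisms of the pseudofunctor are absorbed here. -/
theorem pr_pullHom {Y Y' : Over B} {i j : I} {f₁ : Y ⟶ X i} {f₂ : Y ⟶ X j} {x : F.obj (.mk (op (X i)))}
    {y : F.obj (.mk (op (X j)))} (φ : (F.map f₁.op.toLoc).toFunctor.obj x ⟶ (F.map f₂.op.toLoc).toFunctor.obj y)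
    (g : Y' ⟶ Y) (gf₁ : Y' ⟶ X i) (gf₂ : Y' ⟶ X j) (h₁ : g ≫ f₁ = gf₁) (h₂ : g ≫ f₂ = gf₂) {U : T}
    (c : (r.El ((F.map gf₁.op.toLoc).toFunctor.obj x)).Sec U) :
    ∃ c', ap (r.pr f₁ x) U c' = ap (r.pr gf₁ x) U c ∧
      ap (r.pr f₂ y) U (ap (r.el φ) U c') =
        ap (r.pr gf₂ y) U (ap (r.el (Pseudofunctor.LocallyDiscreteOpToCat.pullHom φ g gf₁ gf₂ h₁ h₂)) U c) := by
  have e₁ : f₁.op.toLoc ≫ g.op.toLoc = gf₁.op.toLoc := by rw [← h₁]; rfl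
  have e₂ : f₂.op.toLoc ≫ g.op.toLoc = gf₂.op.toLoc := by rw [← h₂]; rfl
  refine ⟨ap (r.pr g _) U (ap (r.el ((F.mapComp' f₁.op.toLoc g.op.toLoc gf₁.op.toLoc e₁).hom.toNatTrans.app x)) U c), ?_, ?_⟩
  · exact congrArg (fun t => ap t U c) (r.mapComp'_hom_pr f₁ g gf₁ e₁ x)
  · refine (congrArg (ap (r.pr f₂ y) U) (r.pr_map_apply g φ _).symm).trans ?_
    refine (congrArg (fun t => ap t U _) (r.mapComp'_inv_pr f₂ g gf₂ e₂ y)).symm.trans ?_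
    refine congrArg (ap (r.pr gf₂ y) U) ?_
    exact ((r.el_comp_apply _ _ _).trans (r.el_comp_apply _ _ _)).symm

/-- Any Y over both members maps to X i ×_C X j, and the descent isomorphism over Y is the pullback
of the one there. -/
theorem rel_mk {Y : Over B} {i j : I} (q : Y ⟶ C) (f₁ : Y ⟶ X i) (f₂ : Y ⟶ X j) (h₁ : f₁ ≫ f i = q)
    (h₂ : f₂ ≫ f j = q) {U : T} (c : (r.El ((F.map f₁.op.toLoc).toFunctor.obj (D.obj i))).Sec U) :
    r.Rel D (ap (r.pr f₁ (D.obj i)) U c) (ap (r.pr f₂ (D.obj j)) U (ap (r.el (D.hom q f₁ f₂ h₁ h₂)) U c)) := by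
  have h := h₁.trans h₂.symm
  obtain ⟨c', hc, hc'⟩ := r.pr_pullHom (descentHom D i j) (overLift f₁ f₂ h) f₁ f₂ (overLift_fst _ _ h) (overLift_snd _ _ h) c
  refine ⟨c', hc, hc'.trans ?_⟩
  have hq : overLift f₁ f₂ h ≫ overFst (f i) (f j) ≫ f i = q := by rw [← Category.assoc, overLift_fst, h₁]
  exact congrArg (fun t => ap (r.pr f₂ (D.obj j)) U (ap (r.el t) U c))
    (D.pullHom_hom (overLift f₁ f₂ h) _ q hq _ _ rfl (overProd_condition (f i) (f j)).symm f₁ f₂ (overLift_fst _ _ h)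
      (overLift_snd _ _ h))

variable {r D} {i j k : I} {U : T} {a a' : (r.El (D.obj i)).Sec U} {b b' : (r.El (D.obj j)).Sec U}

theorem bar_descent {Y : Over B} (q : Y ⟶ C) (f₁ : Y ⟶ X i) (f₂ : Y ⟶ X j) (h₁ : f₁ ≫ f i = q)
    (h₂ : f₂ ≫ f j = q) {U : T} (c : (r.El ((F.map f₁.op.toLoc).toFunctor.obj (D.obj i))).Sec U) :
    ap (r.bar _) U (ap (r.pr f₂ (D.obj j)) U (ap (r.el (D.hom q f₁ f₂ h₁ h₂)) U c)) = ap (ringMap f₂) U (ap (r.bar _) U c) :=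
  (r.bar_pr_apply _ _ _).trans (congrArg _ (r.bar_el_apply _ c))

theorem Rel.bar (h : r.Rel D a b) :
    ap (ringMap (f i)) U (ap (r.bar _) U a) = ap (ringMap (f j)) U (ap (r.bar _) U b) := by
  obtain ⟨c, rfl, rfl⟩ := h
  refine (congrArg _ (r.bar_pr_apply _ _ c)).trans (Eq.trans ?_ (congrArg _ (bar_descent _ _ _ _ _ c)).symm)
  exact congrArg (fun t => ap (ringMap t) U (ap (r.bar _) U c)) (overProd_condition (f i) (f j))

theorem exists_rel (a : (r.El (D.obj i)).Sec U) (d : (X j).left.right.Sec U)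
    (h : ap (ringMap (f i)) U (ap (r.bar _) U a) = ap (ringMap (f j)) U d) :
    ∃ b : (r.El (D.obj j)).Sec U, r.Rel D a b ∧ ap (r.bar _) U b = d := by
  obtain ⟨c, hc, hc'⟩ := r.exists_pr (overFst (f i) (f j)) _ a (overPair _ _ h) rfl
  exact ⟨_, ⟨c, hc, rfl⟩, (bar_descent _ _ _ _ _ c).trans (congrArg _ hc')⟩

/-- A section of the pullback to X i ×_C X j amounts to a together with an image in X j. Given a,
the related b is therefore determined by its image in X j; by `exists_rel` every image compatible
with that of a in C occurs. -/
theorem Rel.unique (h : r.Rel D a b) (h' : r.Rel D a b') (hb : ap (r.bar _) U b = ap (r.bar _) U b') : b = b' := by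
  obtain ⟨c, rfl, rfl⟩ := h
  obtain ⟨c', hc, rfl⟩ := h'
  have : c' = c := by
    refine r.ext _ _ hc (fiberProd.ext ?_ ?_)
    · exact ((r.bar_pr_apply _ _ c').symm.trans (congrArg _ hc)).trans (r.bar_pr_apply _ _ c)
    · exact ((bar_descent _ _ _ _ _ c').symm.trans hb.symm).trans (bar_descent _ _ _ _ _ c)
  rw [this]

theorem Rel.refl (a : (r.El (D.obj i)).Sec U) : r.Rel D a a := by
  obtain ⟨c, hc, -⟩ := r.exists_pr (𝟙 (X i)) (D.obj i) a (ap (r.bar _) U a) rfl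
  have h := r.rel_mk D (f i) (𝟙 (X i)) (𝟙 (X i)) (Category.id_comp _) (Category.id_comp _) c
  have e : ap (r.el (D.hom (f i) (𝟙 (X i)) (𝟙 (X i)) (Category.id_comp _) (Category.id_comp _))) U c = c :=
    (congrArg (fun t => ap (r.el t) U c) (D.hom_self (f i) (𝟙 (X i)) (Category.id_comp _))).trans
      (congrArg (fun t => ap t U c) (r.el_id _))
  rw [e, hc] at h
  exact h

/-- The images of a, b and e define a section of X i ×_C X j ×_C X k, hence a lift c of a over this
product. The descent isomorphisms carry c to sections over members j and k that equal b and e by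
uniqueness, and the cocycle condition relates a to e directly. -/
theorem Rel.trans {e : (r.El (D.obj k)).Sec U} (h : r.Rel D a b) (h' : r.Rel D b e) : r.Rel D a e := by
  have hab := h.bar
  have hae := hab.trans h'.bar
  have w := overProd_condition (f i) (f j)
  have w' := overProd_condition (overFst (f i) (f j) ≫ f i) (f k)
  have q₁ : (overFst (overFst (f i) (f j) ≫ f i) (f k) ≫ overFst (f i) (f j)) ≫ f i = overSnd _ _ ≫ f k := by
    rw [Category.assoc, w']
  have q₂ : (overFst (overFst (f i) (f j) ≫ f i) (f k) ≫ overSnd (f i) (f j)) ≫ f j = overSnd _ _ ≫ f k := by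
    rw [Category.assoc, ← w, w']
  obtain ⟨c, hc, hc'⟩ := r.exists_pr (overFst (overFst (f i) (f j) ≫ f i) (f k) ≫ overFst (f i) (f j)) (D.obj i) a
    (overPair (f := overFst (f i) (f j) ≫ f i) (g := f k) (overPair (f := f i) (g := f j) _ _ hab) (ap (r.bar _) U e) hae) rfl
  have h₁ := r.rel_mk D _ _ _ q₁ q₂ c
  have b₁ := bar_descent (r := r) (D := D) _ _ _ q₁ q₂ c
  have h₂ := r.rel_mk D _ _ _ q₂ rfl (ap (r.el (D.hom _ _ _ q₁ q₂)) U c)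
  have b₂ := bar_descent (r := r) (D := D) _ _ _ q₂ rfl (ap (r.el (D.hom _ _ _ q₁ q₂)) U c)
  have h₃ := r.rel_mk D _ _ _ q₁ rfl c
  have e₃ := (r.el_comp_apply (D.hom _ _ _ q₁ q₂) (D.hom _ _ _ q₂ rfl) c).symm.trans
    (congrArg (fun t => ap (r.el t) U c) (D.hom_comp _ _ _ _ q₁ q₂ rfl))
  rw [hc] at h₁ h₃
  have eb := Rel.unique h₁ h (b₁.trans (congrArg _ hc'))
  rw [eb] at h₂
  have ee := Rel.unique h₂ h' (b₂.trans ((congrArg _ (r.bar_el_apply _ c)).trans (congrArg _ hc')))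
  rw [e₃] at ee
  rw [ee] at h₃
  exact h₃

/-- Some a' with the same image as a satisfies b ~ a'. Then a ~ a' by transitivity and a ~ a by
reflexivity, so a' = a by uniqueness. -/
theorem Rel.symm (h : r.Rel D a b) : r.Rel D b a := by
  obtain ⟨a', h', ha⟩ := exists_rel b _ h.bar.symm
  rwa [(Rel.refl a).unique (h.trans h') ha.symm]

theorem Rel.add (h : r.Rel D a b) (h' : r.Rel D a' b') : r.Rel D (a + a') (b + b') := by
  obtain ⟨c, rfl, rfl⟩ := h
  obtain ⟨c', rfl, rfl⟩ := h'
  exact ⟨c + c', map_add _ _ _, by rw [map_add, map_add]⟩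

theorem Rel.mul (h : r.Rel D a b) (h' : r.Rel D a' b') : r.Rel D (a * a') (b * b') := by
  obtain ⟨c, rfl, rfl⟩ := h
  obtain ⟨c', rfl, rfl⟩ := h'
  exact ⟨c * c', map_mul _ _ _, by rw [map_mul, map_mul]⟩

theorem Rel.neg (h : r.Rel D a b) : r.Rel D (-a) (-b) := by
  obtain ⟨c, rfl, rfl⟩ := h
  exact ⟨-c, map_neg _ _, by rw [map_neg, map_neg]⟩

theorem Rel.zero : r.Rel D (0 : (r.El (D.obj i)).Sec U) (0 : (r.El (D.obj j)).Sec U) :=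
  ⟨0, map_zero _, by rw [map_zero, map_zero]⟩

theorem Rel.one : r.Rel D (1 : (r.El (D.obj i)).Sec U) (1 : (r.El (D.obj j)).Sec U) :=
  ⟨1, map_one _, by rw [map_one, map_one]⟩

theorem Rel.res (h : r.Rel D a b) {V : T} (k : V ⟶ U) : r.Rel D (RingSheaf.res _ k a) (RingSheaf.res _ k b) := by
  obtain ⟨c, rfl, rfl⟩ := h
  exact ⟨RingSheaf.res _ k c, by rw [ap_res], by rw [ap_res, ap_res]⟩

/-- The only candidate for b is the section related to a with the same image in X j. It agrees with
b locally by uniqueness, hence globally. -/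
theorem Rel.of_locally (h : Locally J U fun _ k => r.Rel D (RingSheaf.res _ k a) (RingSheaf.res _ k b)) : r.Rel D a b := by
  have hb : ap (ringMap (f i)) U (ap (r.bar _) U a) = ap (ringMap (f j)) U (ap (r.bar _) U b) := by
    refine RingSheaf.eq_of_locally _ (h.mono fun V k hk => ?_)
    rw [← ap_res, ← ap_res, ← ap_res, ← ap_res]
    exact hk.bar
  obtain ⟨b', hb', e⟩ := exists_rel a _ hb
  have : b' = b := RingSheaf.eq_of_locally _ (h.mono fun V k hk => (hb'.res k).unique hk (by rw [ap_res, ap_res, e]))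
  rwa [← this]

/-- Sections of an iterated pullback of x are determined by their projections to x and to the
algebras. The latter are preserved by all morphisms, and the former agree by `hφ`, since every
instance of the descent isomorphism is an instance of the relation. -/
theorem pr_comm {x : F.obj (.mk (op C))} (hel : ∀ {E : Over B} {x y : F.obj (.mk (op E))} {φ ψ : x ⟶ y}, r.el φ = r.el ψ → φ = ψ)
    (φ : ∀ i, D.obj i ⟶ (F.map (f i).op.toLoc).toFunctor.obj x)
    (hφ : ∀ {i j : I} {U : T} (a : (r.El (D.obj i)).Sec U) (b : (r.El (D.obj j)).Sec U), r.Rel D a b →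
      ap (r.pr (f i) x) U (ap (r.el (φ i)) U a) = ap (r.pr (f j) x) U (ap (r.el (φ j)) U b))
    {Y : Over B} (q : Y ⟶ C) (i j : I) (f₁ : Y ⟶ X i) (f₂ : Y ⟶ X j) (h₁ : f₁ ≫ f i = q) (h₂ : f₂ ≫ f j = q) :
    (F.map f₁.op.toLoc).toFunctor.map (φ i) ≫ ((F.toDescentData f).obj x).hom q f₁ f₂ h₁ h₂ =
      D.hom q f₁ f₂ h₁ h₂ ≫ (F.map f₂.op.toLoc).toFunctor.map (φ j) := by
  refine hel (ringHom_ext fun U c => r.ext f₂ _ (r.ext (f j) x ?_ ?_) ?_)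
  · refine (congrArg (fun t => ap (r.pr (f j) x) U (ap (r.pr f₂ _) U t)) (r.el_comp_apply _ _ c)).trans ?_
    refine (r.ofObj_hom_pr x q i j f₁ f₂ h₁ h₂ _).trans ?_
    refine (congrArg (ap (r.pr (f i) x) U) (r.pr_map_apply f₁ (φ i) c)).trans ?_
    refine (hφ _ _ (r.rel_mk D q f₁ f₂ h₁ h₂ c)).trans ?_
    refine (congrArg (ap (r.pr (f j) x) U) (r.pr_map_apply f₂ (φ j) _)).symm.trans ?_
    exact (congrArg (fun t => ap (r.pr (f j) x) U (ap (r.pr f₂ _) U t)) (r.el_comp_apply _ _ c)).symm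
  · refine (r.bar_pr_apply f₂ _ _).trans (Eq.trans ?_ (r.bar_pr_apply f₂ _ _).symm)
    exact congrArg _ ((r.bar_el_apply _ c).trans (r.bar_el_apply _ c).symm)
  · exact (r.bar_el_apply _ c).trans (r.bar_el_apply _ c).symm

/-- An isomorphism of a descent datum with that of an object, from isomorphisms on the members of the family. -/
noncomputable def descentIso {x : F.obj (.mk (op C))} (hel : ∀ {E : Over B} {x y : F.obj (.mk (op E))} {φ ψ : x ⟶ y}, r.el φ = r.el ψ → φ = ψ)
    (φ : ∀ i, D.obj i ⟶ (F.map (f i).op.toLoc).toFunctor.obj x) (hi : ∀ i, IsIso (φ i))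
    (hφ : ∀ {i j : I} {U : T} (a : (r.El (D.obj i)).Sec U) (b : (r.El (D.obj j)).Sec U), r.Rel D a b →
      ap (r.pr (f i) x) U (ap (r.el (φ i)) U a) = ap (r.pr (f j) x) U (ap (r.el (φ j)) U b)) :
    D ≅ (F.toDescentData f).obj x :=
  Pseudofunctor.DescentData.isoMk (fun i => @asIso _ _ _ _ (φ i) (hi i)) fun Y q i j f₁ f₂ h₁ h₂ =>
    pr_comm hel φ hφ q i j f₁ f₂ h₁ h₂

end Realization
end Descent
end Butterflies

/-! ### Gluing of sheaves of rings along a relation between sections. -/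

namespace Butterflies
variable {T : Type u} [SmallCategory T] {J : GrothendieckTopology T}

/-- A family of sheaves of rings with compatible identifications between their sections, such that finitely many
sections can be moved locally to a single member of the family. -/
structure RingGluing (J : GrothendieckTopology T) (I : Type u) where
  ring : I → RingSheaf J
  Rel : ∀ {i j : I} {U : T}, (ring i).Sec U → (ring j).Sec U → Prop
  refl : ∀ {i : I} {U : T} (a : (ring i).Sec U), Rel a a
  symm : ∀ {i j : I} {U : T} {a : (ring i).Sec U} {b : (ring j).Sec U}, Rel a b → Rel b a
  trans : ∀ {i j k : I} {U : T} {a : (ring i).Sec U} {b : (ring j).Sec U} {c : (ring k).Sec U}, Rel a b → Rel b c → Rel a c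
  res : ∀ {i j : I} {U : T} {a : (ring i).Sec U} {b : (ring j).Sec U}, Rel a b → ∀ {V : T} (h : V ⟶ U),
    Rel ((ring i).res h a) ((ring j).res h b)
  of_locally : ∀ {i j : I} {U : T} {a : (ring i).Sec U} {b : (ring j).Sec U},
    (Locally J U fun _ h => Rel ((ring i).res h a) ((ring j).res h b)) → Rel a b
  zero : ∀ (i j : I) (U : T), Rel (0 : (ring i).Sec U) (0 : (ring j).Sec U)
  one : ∀ (i j : I) (U : T), Rel (1 : (ring i).Sec U) (1 : (ring j).Sec U)
  neg : ∀ {i j : I} {U : T} {a : (ring i).Sec U} {b : (ring j).Sec U}, Rel a b → Rel (-a) (-b)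
  add : ∀ {i j : I} {U : T} {a a' : (ring i).Sec U} {b b' : (ring j).Sec U}, Rel a b → Rel a' b' → Rel (a + a') (b + b')
  mul : ∀ {i j : I} {U : T} {a a' : (ring i).Sec U} {b b' : (ring j).Sec U}, Rel a b → Rel a' b' → Rel (a * a') (b * b')
  nonempty : ∀ U : T, Locally J U fun _ _ => Nonempty I
  lift : ∀ {i j k : I} {U : T} (a : (ring i).Sec U) (b : (ring j).Sec U) (c : (ring k).Sec U), Locally J U fun V h =>
    ∃ (l : I) (a' b' c' : (ring l).Sec V), Rel ((ring i).res h a) a' ∧ Rel ((ring j).res h b) b' ∧ Rel ((ring k).res h c) c'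

namespace RingGluing
variable {I : Type u} (G : RingGluing J I)

/-- Sections over members of the family up to identification. -/
def setoid (U : T) : Setoid (Σ i, (G.ring i).Sec U) where
  r a b := G.Rel a.2 b.2
  iseqv := ⟨fun a => G.refl a.2, G.symm, G.trans⟩

/-- The presheaf of sections over members of the family up to identification. -/
def presheaf : Tᵒᵖ ⥤ Type u where
  obj U := Quotient (G.setoid U.unop)
  map h := TypeCat.ofHom (Quotient.map (fun a => ⟨a.1, (G.ring a.1).res h.unop a.2⟩) fun _ _ hab => G.res hab h.unop)
  map_id U := by
    ext x
    induction x using Quotient.ind with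
    | _ a => exact congrArg (fun t => (⟦⟨a.1, t⟩⟧ : Quotient (G.setoid U.unop))) ((G.ring a.1).res_id _ a.2)
  map_comp {U V W} h k := by
    ext x
    induction x using Quotient.ind with
    | _ a => exact congrArg (fun t => (⟦⟨a.1, t⟩⟧ : Quotient (G.setoid W.unop))) ((G.ring a.1).res_comp _ _ a.2)

/-- The glued sheaf of sets. -/
noncomputable def sheaf : Sheaf J (Type u) := (presheafToSheaf J (Type u)).obj G.presheaf

/-- Sections of the glued sheaf. -/
abbrev Sec (U : T) : Type u := G.sheaf.obj.obj (op U)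

/-- Restriction of sections. -/
noncomputable def rs {U V : T} (h : V ⟶ U) (x : G.Sec U) : G.Sec V := G.sheaf.obj.map h.op x

theorem rs_id {U : T} (x : G.Sec U) : G.rs (𝟙 U) x = x := congrArg (fun t => t x) (G.sheaf.obj.map_id (op U))

theorem rs_comp {U V W : T} (h : V ⟶ U) (k : W ⟶ V) (x : G.Sec U) : G.rs (k ≫ h) x = G.rs k (G.rs h x) :=
  congrArg (fun t => t x) (G.sheaf.obj.map_comp h.op k.op)

theorem sheaf_isSheaf : Presieve.IsSheaf J G.sheaf.obj := (isSheaf_iff_isSheaf_of_type _ _).1 G.sheaf.property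

theorem eq_of_locally {U : T} {x y : G.Sec U} (H : Locally J U fun _ h => G.rs h x = G.rs h y) : x = y := by
  obtain ⟨S, hS, H⟩ := H
  exact (G.sheaf_isSheaf S hS).isSeparatedFor.ext fun V h hh => H h hh

variable {G} in
/-- The section of the glued sheaf given by a section over a member of the family. -/
noncomputable def of {i : I} {U : T} (a : (G.ring i).Sec U) : G.Sec U :=
  (toSheafify J G.presheaf).app (op U) (Quotient.mk (G.setoid U) ⟨i, a⟩)

theorem rs_of {i : I} {U V : T} (h : V ⟶ U) (a : (G.ring i).Sec U) : G.rs h (of a) = of ((G.ring i).res h a) :=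
  (congrArg (fun t => t (Quotient.mk (G.setoid U) ⟨i, a⟩)) ((toSheafify J G.presheaf).naturality h.op)).symm

/-- Sheafification identifies sections that become related locally. Since the relation is itself
local, nothing beyond it is identified. -/
theorem of_eq_of {i j : I} {U : T} {a : (G.ring i).Sec U} {b : (G.ring j).Sec U} : G.of a = G.of b ↔ G.Rel a b := by
  constructor
  · intro H
    have : Presheaf.IsLocallyInjective J (toSheafify J G.presheaf) := inferInstance
    exact G.of_locally ⟨_, this.equalizerSieve_mem (X := op U) _ _ H, fun V h hh => Quotient.exact hh⟩
  · intro H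
    exact congrArg _ (Quotient.sound (s := G.setoid U) (a := ⟨i, a⟩) (b := ⟨j, b⟩) H)

theorem exists_of {U : T} (x : G.Sec U) : Locally J U fun V h => ∃ (i : I) (a : (G.ring i).Sec V), G.rs h x = of a := by
  have : Presheaf.IsLocallySurjective J (toSheafify J G.presheaf) := inferInstance
  refine ⟨_, this.imageSieve_mem (U := U) x, fun V h hh => ?_⟩
  obtain ⟨t, ht⟩ := hh
  induction t using Quotient.ind with
  | _ a => exact ⟨a.1, a.2, ht.symm⟩

theorem exists_of₃ {U : T} (x y z : G.Sec U) : Locally J U fun V h => ∃ (i : I) (a b c : (G.ring i).Sec V),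
    G.rs h x = of a ∧ G.rs h y = of b ∧ G.rs h z = of c := by
  refine ((G.exists_of x).and ((G.exists_of y).and (G.exists_of z))).bind' ?_
  rintro V h ⟨⟨i, a, ha⟩, ⟨j, b, hb⟩, ⟨k, c, hc⟩⟩
  refine (G.lift a b c).mono ?_
  rintro W l ⟨m, a', b', c', ha', hb', hc'⟩
  refine ⟨m, a', b', c', ?_, ?_, ?_⟩
  · rw [rs_comp, ha, rs_of, of_eq_of]; exact ha'
  · rw [rs_comp, hb, rs_of, of_eq_of]; exact hb'
  · rw [rs_comp, hc, rs_of, of_eq_of]; exact hc'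

/-- This is the one gluing argument behind all the ring operations: each is prescribed by its value
whenever the arguments come from a single member of the family. -/
theorem exists_section {U : T} (Φ : ∀ ⦃V : T⦄, (V ⟶ U) → ∀ i : I, (G.ring i).Sec V → Prop)
    (stab : ∀ ⦃V⦄ (h : V ⟶ U) ⦃W⦄ (k : W ⟶ V) i a, Φ h i a → Φ (k ≫ h) i ((G.ring i).res k a))
    (uniq : ∀ ⦃V⦄ (h : V ⟶ U) i j a b, Φ h i a → Φ h j b → G.Rel a b)
    (ex : Locally J U fun _ h => ∃ i a, Φ h i a) :
    ∃ x : G.Sec U, ∀ ⦃V : T⦄ (h : V ⟶ U) (i : I) (a : (G.ring i).Sec V), Φ h i a → G.rs h x = of a := by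
  obtain ⟨x, hx⟩ := exists_of_locally_unique G.sheaf_isSheaf
    (fun V h x => ∃ (i : I) (a : (G.ring i).Sec V), Φ h i a ∧ x = of a) (by
      rintro V h W k x ⟨i, a, ha, rfl⟩
      exact ⟨i, _, stab h k i a ha, G.rs_of k a⟩) (by
      rintro V h x y ⟨i, a, ha, rfl⟩ ⟨j, b, hb, rfl⟩
      exact G.of_eq_of.2 (uniq h i j a b ha hb)) (ex.mono fun V h ⟨i, a, ha⟩ => ⟨_, i, a, ha, rfl⟩)
  refine ⟨x, fun V h i a ha => G.eq_of_locally ((hx.pull h).mono ?_)⟩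
  rintro W k ⟨j, b, hb, e⟩
  rw [← rs_comp, rs_of]
  exact Eq.trans e (G.of_eq_of.2 (uniq _ j i b _ hb (stab h k i a ha)))

theorem exists_const (c : ∀ i U, (G.ring i).Sec U) (hc : ∀ i ⦃U V : T⦄ (h : V ⟶ U), (G.ring i).res h (c i U) = c i V)
    (rel : ∀ i j U, G.Rel (c i U) (c j U)) (U : T) : ∃ x : G.Sec U, ∀ ⦃V : T⦄ (h : V ⟶ U) (i : I), G.rs h x = of (c i V) := by
  obtain ⟨x, hx⟩ := G.exists_section (U := U) (fun V h i a => a = c i V) (by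
    rintro V h W k i a rfl
    exact hc i k) (by
    rintro V h i j a b rfl rfl
    exact rel i j V) ((G.nonempty U).mono fun V h ⟨i⟩ => ⟨i, _, rfl⟩)
  exact ⟨x, fun V h i => hx h i _ rfl⟩

theorem exists_op (o : ∀ i U, (G.ring i).Sec U → (G.ring i).Sec U → (G.ring i).Sec U)
    (ho : ∀ i ⦃U V : T⦄ (h : V ⟶ U) a b, (G.ring i).res h (o i U a b) = o i V ((G.ring i).res h a) ((G.ring i).res h b))
    (rel : ∀ ⦃i j U⦄ ⦃a a' : (G.ring i).Sec U⦄ ⦃b b' : (G.ring j).Sec U⦄, G.Rel a b → G.Rel a' b' → G.Rel (o i U a a') (o j U b b'))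
    {U : T} (x y : G.Sec U) : ∃ z : G.Sec U, ∀ ⦃V : T⦄ (h : V ⟶ U) (i : I) (a b : (G.ring i).Sec V),
      G.rs h x = of a → G.rs h y = of b → G.rs h z = of (o i V a b) := by
  obtain ⟨z, hz⟩ := G.exists_section (U := U) (fun V h i c => ∃ a b, G.rs h x = of a ∧ G.rs h y = of b ∧ c = o i V a b) (by
    rintro V h W k i _ ⟨a, b, ha, hb, rfl⟩
    refine ⟨_, _, ?_, ?_, ho i k a b⟩
    · rw [rs_comp, ha, rs_of]
    · rw [rs_comp, hb, rs_of]) (by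
    rintro V h i j _ _ ⟨a, b, ha, hb, rfl⟩ ⟨a', b', ha', hb', rfl⟩
    exact rel (G.of_eq_of.1 (ha.symm.trans ha')) (G.of_eq_of.1 (hb.symm.trans hb'))) ((G.exists_of₃ x y y).mono (by
    rintro V h ⟨i, a, b, -, ha, hb, -⟩
    exact ⟨i, _, a, b, ha, hb, rfl⟩))
  exact ⟨z, fun V h i a b ha hb => hz h i _ ⟨a, b, ha, hb, rfl⟩⟩

theorem exists_zero (U : T) : ∃ x : G.Sec U, ∀ ⦃V : T⦄ (h : V ⟶ U) (i : I), G.rs h x = of (0 : (G.ring i).Sec V) :=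
  G.exists_const (fun _ _ => 0) (fun _ _ _ _ => map_zero _) G.zero U

theorem exists_one (U : T) : ∃ x : G.Sec U, ∀ ⦃V : T⦄ (h : V ⟶ U) (i : I), G.rs h x = of (1 : (G.ring i).Sec V) :=
  G.exists_const (fun _ _ => 1) (fun _ _ _ _ => map_one _) G.one U

theorem exists_add {U : T} (x y : G.Sec U) : ∃ z : G.Sec U, ∀ ⦃V : T⦄ (h : V ⟶ U) (i : I) (a b : (G.ring i).Sec V),
      G.rs h x = of a → G.rs h y = of b → G.rs h z = of (a + b) :=
  G.exists_op (fun _ _ a b => a + b) (fun _ _ _ _ _ _ => map_add _ _ _) (fun _ _ _ _ _ _ _ => G.add) x y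

theorem exists_mul {U : T} (x y : G.Sec U) : ∃ z : G.Sec U, ∀ ⦃V : T⦄ (h : V ⟶ U) (i : I) (a b : (G.ring i).Sec V),
      G.rs h x = of a → G.rs h y = of b → G.rs h z = of (a * b) :=
  G.exists_op (fun _ _ a b => a * b) (fun _ _ _ _ _ _ => map_mul _ _ _) (fun _ _ _ _ _ _ _ => G.mul) x y

theorem exists_neg {U : T} (x : G.Sec U) : ∃ z : G.Sec U, ∀ ⦃V : T⦄ (h : V ⟶ U) (i : I) (a b : (G.ring i).Sec V),
      G.rs h x = of a → G.rs h x = of b → G.rs h z = of (-a) :=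
  G.exists_op (fun _ _ a _ => -a) (fun _ _ _ _ _ _ => map_neg _ _) (fun _ _ _ _ _ _ _ h _ => G.neg h) x x

noncomputable instance (U : T) : Zero (G.Sec U) := ⟨(G.exists_zero U).choose⟩
noncomputable instance (U : T) : One (G.Sec U) := ⟨(G.exists_one U).choose⟩
noncomputable instance (U : T) : Add (G.Sec U) := ⟨fun x y => (G.exists_add x y).choose⟩
noncomputable instance (U : T) : Mul (G.Sec U) := ⟨fun x y => (G.exists_mul x y).choose⟩
noncomputable instance (U : T) : Neg (G.Sec U) := ⟨fun x => (G.exists_neg x).choose⟩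

variable {U V : T} {i : I}

theorem rs_zero (h : V ⟶ U) (i : I) : G.rs h 0 = of (0 : (G.ring i).Sec V) := (G.exists_zero U).choose_spec h i

theorem rs_one (h : V ⟶ U) (i : I) : G.rs h 1 = of (1 : (G.ring i).Sec V) := (G.exists_one U).choose_spec h i

theorem rs_add (h : V ⟶ U) {x y : G.Sec U} {a b : (G.ring i).Sec V} (hx : G.rs h x = of a) (hy : G.rs h y = of b) :
    G.rs h (x + y) = of (a + b) := (G.exists_add x y).choose_spec h i a b hx hy

theorem rs_mul (h : V ⟶ U) {x y : G.Sec U} {a b : (G.ring i).Sec V} (hx : G.rs h x = of a) (hy : G.rs h y = of b) :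
    G.rs h (x * y) = of (a * b) := (G.exists_mul x y).choose_spec h i a b hx hy

theorem rs_neg (h : V ⟶ U) {x : G.Sec U} {a : (G.ring i).Sec V} (hx : G.rs h x = of a) :
    G.rs h (-x) = of (-a) := (G.exists_neg x).choose_spec h i a a hx hx

/-- Each axiom involves at most three elements, and these come locally from one member of the
family, where the axiom holds. This is why the gluing data ask that three sections can be moved
together. -/
noncomputable instance (U : T) : CommRing (G.Sec U) := CommRing.ofMinimalAxioms
  (fun x y z => G.eq_of_locally ((G.exists_of₃ x y z).mono fun V h ⟨i, a, b, c, ha, hb, hc⟩ => by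
    rw [G.rs_add h (G.rs_add h ha hb) hc, G.rs_add h ha (G.rs_add h hb hc), add_assoc]))
  (fun x => G.eq_of_locally ((G.exists_of x).mono fun V h ⟨i, a, ha⟩ => by
    rw [G.rs_add h (G.rs_zero h i) ha, zero_add, ha]))
  (fun x => G.eq_of_locally ((G.exists_of x).mono fun V h ⟨i, a, ha⟩ => by
    rw [G.rs_add h (G.rs_neg h ha) ha, neg_add_cancel, G.rs_zero h i]))
  (fun x y z => G.eq_of_locally ((G.exists_of₃ x y z).mono fun V h ⟨i, a, b, c, ha, hb, hc⟩ => by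
    rw [G.rs_mul h (G.rs_mul h ha hb) hc, G.rs_mul h ha (G.rs_mul h hb hc), mul_assoc]))
  (fun x y => G.eq_of_locally ((G.exists_of₃ x y y).mono fun V h ⟨i, a, b, _, ha, hb, _⟩ => by
    rw [G.rs_mul h ha hb, G.rs_mul h hb ha, mul_comm]))
  (fun x => G.eq_of_locally ((G.exists_of x).mono fun V h ⟨i, a, ha⟩ => by
    rw [G.rs_mul h (G.rs_one h i) ha, one_mul, ha]))
  (fun x y z => G.eq_of_locally ((G.exists_of₃ x y z).mono fun V h ⟨i, a, b, c, ha, hb, hc⟩ => by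
    rw [G.rs_mul h ha (G.rs_add h hb hc), G.rs_add h (G.rs_mul h ha hb) (G.rs_mul h ha hc), mul_add]))

/-- Restriction is a ring map. -/
noncomputable def rsHom (h : V ⟶ U) : G.Sec U →+* G.Sec V where
  toFun := G.rs h
  map_zero' := G.eq_of_locally ((G.nonempty V).mono fun W k ⟨i⟩ => by
    rw [← rs_comp, G.rs_zero _ i, G.rs_zero _ i])
  map_one' := G.eq_of_locally ((G.nonempty V).mono fun W k ⟨i⟩ => by
    rw [← rs_comp, G.rs_one _ i, G.rs_one _ i])
  map_add' x y := G.eq_of_locally (((G.exists_of₃ x y y).pull h).mono fun W k ⟨i, a, b, _, ha, hb, _⟩ => by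
    rw [← rs_comp, G.rs_add _ ha hb, G.rs_add k (by rw [← rs_comp, ha]) (by rw [← rs_comp, hb])])
  map_mul' x y := G.eq_of_locally (((G.exists_of₃ x y y).pull h).mono fun W k ⟨i, a, b, _, ha, hb, _⟩ => by
    rw [← rs_comp, G.rs_mul _ ha hb, G.rs_mul k (by rw [← rs_comp, ha]) (by rw [← rs_comp, hb])])

/-- The glued presheaf of rings. -/
noncomputable def gluedPresheaf : Tᵒᵖ ⥤ CommRingCat.{u} where
  obj U := CommRingCat.of (G.Sec U.unop)
  map h := CommRingCat.ofHom (G.rsHom h.unop)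
  map_id U := CommRingCat.hom_ext (RingHom.ext fun x => G.rs_id x)
  map_comp h k := CommRingCat.hom_ext (RingHom.ext fun x => G.rs_comp _ _ x)

/-- The glued sheaf of rings. -/
noncomputable def glued : RingSheaf J where
  obj := G.gluedPresheaf
  property := by
    rw [Presheaf.isSheaf_iff_isSheaf_forget J _ (forget CommRingCat)]
    exact G.sheaf.property

/-- The map from a member of the family to the glued sheaf. -/
noncomputable def incl (i : I) : G.ring i ⟶ G.glued := mkHom (R := G.ring i) (S := G.glued) (fun U =>
  { toFun := fun a => of a
    map_zero' := by
      have := G.rs_zero (𝟙 U) i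
      rw [rs_id] at this
      exact this.symm
    map_one' := by
      have := G.rs_one (𝟙 U) i
      rw [rs_id] at this
      exact this.symm
    map_add' := fun a b => by
      have := G.rs_add (𝟙 U) (x := of a) (y := of b) (G.rs_id _) (G.rs_id _)
      rw [rs_id] at this
      exact this.symm
    map_mul' := fun a b => by
      have := G.rs_mul (𝟙 U) (x := of a) (y := of b) (G.rs_id _) (G.rs_id _)
      rw [rs_id] at this
      exact this.symm }) (fun h a => (G.rs_of h a).symm)

theorem incl_eq_incl {i j : I} {U : T} {a : (G.ring i).Sec U} {b : (G.ring j).Sec U} :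
    ap (G.incl i) U a = ap (G.incl j) U b ↔ G.Rel a b := G.of_eq_of

theorem pairLift : PairLift G.incl := fun U x y => (G.exists_of₃ x y y).mono
  fun _ _ ⟨i, a, b, _, ha, hb, _⟩ => ⟨i, a, b, ha.symm, hb.symm⟩

end RingGluing
end Butterflies

namespace Butterflies
variable {T : Type u} [SmallCategory T] {J : GrothendieckTopology T}

/-! ### Butterflies glued from the members of a family. -/

section Algebras
variable {A : RingSheaf J} {B : Under A} {M : ModSheaf B.right} {ξ η : AlgTwoExt B M}

namespace AlgButterfly
universe t
variable {C : Over B} {I : Type t} {X : I → Over B}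

/-- A sheaf of rings glued from the middle terms of butterflies over a family of algebras over `C`. -/
structure Amalgam (f : ∀ i, X i ⟶ C) (x : ∀ i, AlgButterfly ξ η (X i)) where
  Q : RingSheaf J
  incl : ∀ i, (x i).bf.Q ⟶ Q
  pairLift : PairLift incl
  bar : ∀ (U : T) (i j : I) (a : (x i).bf.Q.Sec U) (b : (x j).bf.Q.Sec U), ap (incl i) U a = ap (incl j) U b →
    ap ((x i).bf.bar ≫ ringMap (f i)) U a = ap ((x j).bf.bar ≫ ringMap (f j)) U b
  exists_incl : ∀ (U : T) (i j : I) (a : (x i).bf.Q.Sec U) (d : (X j).left.right.Sec U),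
    ap (ringMap (f i)) U (ap (x i).bf.bar U a) = ap (ringMap (f j)) U d →
      ∃ b : (x j).bf.Q.Sec U, ap (incl i) U a = ap (incl j) U b ∧ ap (x j).bf.bar U b = d
  unique : ∀ (U : T) (i : I) (a b : (x i).bf.Q.Sec U), ap (incl i) U a = ap (incl i) U b →
    ap (x i).bf.bar U a = ap (x i).bf.bar U b → a = b
  toR : ∀ (U : T) (i j : I) (a : (x i).bf.Q.Sec U) (b : (x j).bf.Q.Sec U), ap (incl i) U a = ap (incl j) U b →
    ap (x i).bf.toR U a = ap (x j).bf.toR U b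
  toR' : ∀ (U : T) (i j : I) (a : (x i).bf.Q.Sec U) (b : (x j).bf.Q.Sec U), ap (incl i) U a = ap (incl j) U b →
    ap (x i).bf.toR' U a = ap (x j).bf.toR' U b
  ι : ∀ (U : T) (i j : I) (n : ξ.ext.N.Sec U), ap (incl i) U ((x i).bf.ι U n) = ap (incl j) U ((x j).bf.ι U n)
  κ : ∀ (U : T) (i j : I) (n : η.ext.N.Sec U), ap (incl i) U ((x i).bf.κ U n) = ap (incl j) U ((x j).bf.κ U n)
  sec : ∀ (U : T) (i j : I) (z : (SplitPair ξ η).Sec U), ap (incl i) U (ap (x i).sec U z) = ap (incl j) U (ap (x j).sec U z)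

namespace Amalgam
variable {f : ∀ i, X i ⟶ C} {x : ∀ i, AlgButterfly ξ η (X i)} (Z : Amalgam f x)

/-- The map to `R`. -/
noncomputable def qR : Z.Q ⟶ ξ.ext.R := glueHom Z.pairLift (fun i => (x i).bf.toR) Z.toR

/-- The map to `R'`. -/
noncomputable def qR' : Z.Q ⟶ η.ext.R := glueHom Z.pairLift (fun i => (x i).bf.toR') Z.toR'

/-- The map to `C`. -/
noncomputable def qBar : Z.Q ⟶ C.left.right := glueHom Z.pairLift (fun i => (x i).bf.bar ≫ ringMap (f i)) Z.bar

variable {U : T} (i : I) (a : (x i).bf.Q.Sec U)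

@[simp] theorem qR_incl : ap Z.qR U (ap (Z.incl i) U a) = ap (x i).bf.toR U a := ap_glueHom Z.pairLift _ Z.toR U i a

@[simp] theorem qR'_incl : ap Z.qR' U (ap (Z.incl i) U a) = ap (x i).bf.toR' U a := ap_glueHom Z.pairLift _ Z.toR' U i a

@[simp] theorem qBar_incl : ap Z.qBar U (ap (Z.incl i) U a) = ap (ringMap (f i)) U (ap (x i).bf.bar U a) :=
  ap_glueHom Z.pairLift _ Z.bar U i a

theorem exists_incl_eq (q : Z.Q.Sec U) : Locally J U fun V h => ∃ (i : I) (a : (x i).bf.Q.Sec V), ap (Z.incl i) V a = Z.Q.res h q :=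
  (Z.pairLift U q q).mono fun _ _ ⟨i, a, _, ha, _⟩ => ⟨i, a, ha⟩

theorem toBase_comp (i : I) (c : (X i).left.right.Sec U) : ap (toBase C) U (ap (ringMap (f i)) U c) = ap (toBase (X i)) U c :=
  congrArg (fun t => ap t U c) (ringMap_toBase (f i))

theorem qR_g : Z.qR ≫ ξ.ext.g = Z.qBar ≫ toBase C := hom_ext_of_pairLift Z.pairLift fun i => ringHom_ext fun U a => by
  rw [ap_comp, ap_comp, ap_comp, ap_comp, qR_incl, qBar_incl, toBase_comp, (x i).bf.g_toR]

theorem qR'_g : Z.qR' ≫ η.ext.g = Z.qBar ≫ toBase C := hom_ext_of_pairLift Z.pairLift fun i => ringHom_ext fun U a => by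
  rw [ap_comp, ap_comp, ap_comp, ap_comp, qR'_incl, qBar_incl, toBase_comp, (x i).bf.g_toR']

theorem κ_injective (U : T) : Function.Injective fun n => ap (Z.incl i) U ((x i).bf.κ U n) := by
  intro n n' h
  exact (x i).bf.κ_injective U (Z.unique U i _ _ h (((x i).bf.bar_κ U n).trans ((x i).bf.bar_κ U n').symm))

/-- The glued butterfly. -/
noncomputable def bf (hf : FamLift f) (k : I) : Butterfly (ξ.ext.pullback (toBase C)) (η.ext.pullback (toBase C)) where
  Q := Z.Q
  -- The maps from N and N' are defined through one fixed member k. By `Z.ι` and `Z.κ` every other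
  -- member gives the same maps, so an axiom can be checked on whichever member carries the given
  -- section of the glued ring.
  ι U := (ap (Z.incl k) U).toAddMonoidHom.comp ((x k).bf.ι U)
  κ U := (ap (Z.incl k) U).toAddMonoidHom.comp ((x k).bf.κ U)
  ρ := fiberProd.lift Z.qR Z.qBar Z.qR_g
  π := fiberProd.lift Z.qR' Z.qBar Z.qR'_g
  ι_res h n := (congrArg (ap (Z.incl k) _) ((x k).bf.ι_res h n)).trans (ap_res _ _ _)
  κ_res h n := (congrArg (ap (Z.incl k) _) ((x k).bf.κ_res h n)).trans (ap_res _ _ _)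
  ι_smul U q n := by
    change ap (Z.incl k) U ((x k).bf.ι U (ap Z.qR U q • (show ξ.ext.N.Sec U from n))) = q * ap (Z.incl k) U ((x k).bf.ι U n)
    refine RingSheaf.eq_of_locally _ ((Z.exists_incl_eq q).mono ?_)
    rintro V h ⟨i, a, ha⟩
    rw [map_mul, ← ap_res, ← ap_res, ← (x k).bf.ι_res, ← (x k).bf.ι_res]
    refine (congrArg (fun t => ap (Z.incl k) V ((x k).bf.ι V t)) (ξ.ext.N.res_smul h _ _)).trans ?_
    rw [← ap_res, ← ha, qR_incl]
    refine (Z.ι V k i _).trans (Eq.trans ?_ (congrArg (ap (Z.incl i) V a * ·) (Z.ι V i k _)))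
    exact (congrArg (ap (Z.incl i) V) ((x i).bf.ι_smul' V a _)).trans (map_mul _ _ _)
  κ_smul U q n := by
    change ap (Z.incl k) U ((x k).bf.κ U (ap Z.qR' U q • (show η.ext.N.Sec U from n))) = q * ap (Z.incl k) U ((x k).bf.κ U n)
    refine RingSheaf.eq_of_locally _ ((Z.exists_incl_eq q).mono ?_)
    rintro V h ⟨i, a, ha⟩
    rw [map_mul, ← ap_res, ← ap_res, ← (x k).bf.κ_res, ← (x k).bf.κ_res]
    refine (congrArg (fun t => ap (Z.incl k) V ((x k).bf.κ V t)) (η.ext.N.res_smul h _ _)).trans ?_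
    rw [← ap_res, ← ha, qR'_incl]
    refine (Z.κ V k i _).trans (Eq.trans ?_ (congrArg (ap (Z.incl i) V a * ·) (Z.κ V i k _)))
    exact (congrArg (ap (Z.incl i) V) ((x i).bf.κ_smul' V a _)).trans (map_mul _ _ _)
  ρ_ι U n := fiberProd.ext ((Z.qR_incl k _).trans ((x k).bf.toR_ι U n))
    ((Z.qBar_incl k _).trans ((congrArg _ ((x k).bf.bar_ι U n)).trans (map_zero _)))
  π_κ U n := fiberProd.ext ((Z.qR'_incl k _).trans ((x k).bf.toR'_κ U n))
    ((Z.qBar_incl k _).trans ((congrArg _ ((x k).bf.bar_κ U n)).trans ((map_zero _).trans neg_zero.symm)))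
  π_ι U n := fiberProd.ext ((Z.qR'_incl k _).trans ((x k).bf.toR'_ι U n))
    ((Z.qBar_incl k _).trans ((congrArg _ ((x k).bf.bar_ι U n)).trans (map_zero _)))
  ι_e U m := congrArg (ap (Z.incl k) U) ((x k).bf.ι_e U m)
  ρ_g := rfl
  κ_injective := Z.κ_injective k
  exact_Q U q := by
    constructor
    · intro hq
      have hR : ap Z.qR U q = 0 := congrArg (ap (fiberProd.fst _ _) U) hq
      have hC : ap Z.qBar U q = 0 := congrArg (ap (fiberProd.snd _ _) U) hq
      refine exists_global_preimage_mod η.ext.N (fun U => (ap (Z.incl k) U).toAddMonoidHom.comp ((x k).bf.κ U))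
        (fun h n => (congrArg (ap (Z.incl k) _) ((x k).bf.κ_res h n)).trans (ap_res _ _ _)) (Z.κ_injective k) q ?_
      refine (Z.exists_incl_eq q).mono ?_
      rintro V h ⟨i, a, ha⟩
      -- The image of a in C is 0, so a can be moved to the member k with image 0 in X k. There the
      -- exactness of the butterfly over X k applies.
      obtain ⟨b, hb, hb'⟩ := Z.exists_incl V i k a 0 (by rw [← qBar_incl, ha, ap_res, hC, map_zero, map_zero])
      have hbR : ap (x k).bf.toR V b = 0 := by rw [← qR_incl, ← hb, ha, ap_res, hR, map_zero]
      obtain ⟨n, hn⟩ := ((x k).bf.exact_Q V b).1 (fiberProd.ext hbR hb')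
      exact ⟨n, (congrArg (ap (Z.incl k) V) hn).trans (hb.symm.trans ha)⟩
    · rintro ⟨n, rfl⟩
      exact fiberProd.ext ((Z.qR_incl k _).trans ((x k).bf.toR_κ U n))
        ((Z.qBar_incl k _).trans ((congrArg _ ((x k).bf.bar_κ U n)).trans (map_zero _)))
  ρ_surjective U r := by
    obtain ⟨⟨r, c⟩, hr⟩ := r
    have hr' : ap ξ.ext.g U r = ap (toBase C) U c := hr
    refine (hf U c c).bind' ?_
    -- A local lift d of c to a member of the family reduces the surjectivity of ρ to that of the
    -- butterfly over this member.
    rintro V h ⟨i, d, -, hd, -⟩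
    have hr'' : ap ξ.ext.g V (ξ.ext.R.res h r) = ap (toBase (X i)) V d := by
      rw [ap_res, hr', ← ap_res, ← hd, toBase_comp]
    refine ((x i).bf.ρ_surjective V (fiberProd.mk _ d hr'')).mono ?_
    rintro W l ⟨b, hb⟩
    refine ⟨ap (Z.incl i) W b, fiberProd.ext ?_ ?_⟩
    · refine (Z.qR_incl i b).trans ((congrArg (ap (fiberProd.fst _ _) W) hb).trans ?_)
      exact (RingSheaf.res_comp _ _ _ _).symm
    · refine (Z.qBar_incl i b).trans ((congrArg (fun t => ap (ringMap (f i)) W (ap (fiberProd.snd _ _) W t)) hb).trans ?_)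
      refine (ap_res (ringMap (f i)) l d).trans ((congrArg _ hd).trans ?_)
      exact (RingSheaf.res_comp _ _ _ _).symm

theorem isSec (hf : FamLift f) (k : I) : IsSec (Z.bf hf k) ((x k).sec ≫ Z.incl k) where
  toR U z := (Z.qR_incl k _).trans ((isSec_sec (x k)).toR U z)
  toR' U z := (Z.qR'_incl k _).trans ((isSec_sec (x k)).toR' U z)
  bar U z := (Z.qBar_incl k _).trans ((congrArg _ ((isSec_sec (x k)).bar U z)).trans
    (congrArg (fun t => ap t U (ap (fiberProd.fst _ _ ≫ ξ.split.π) U z)) (str_ringMap (f k))))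
  ι U n := congrArg (ap (Z.incl k) U) ((isSec_sec (x k)).ι U n)
  κ U n := congrArg (ap (Z.incl k) U) ((isSec_sec (x k)).κ U n)

/-- The glued butterfly of algebras. -/
noncomputable def obj (hf : FamLift f) (k : I) : AlgButterfly ξ η C := ofSec (Z.isSec hf k)

/-- The comparison of a member of the family with the pullback of the glued butterfly. -/
noncomputable def comparison (hf : FamLift f) (k : I) (i : I) : x i ⟶ restrictObj (f i) (Z.obj hf k) :=
  homMk (Butterfly.homMk (fiberProd.lift (Z.incl i) (x i).bf.bar (ringHom_ext fun U a => Z.qBar_incl i a))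
    (fun U n => fiberProd.ext (Z.ι U i k n) ((x i).bf.bar_ι U n))
    (fun U n => fiberProd.ext (Z.κ U i k n) ((x i).bf.bar_κ U n))
    (fun U a => Z.qR_incl i a)
    (fun U a => Z.qR'_incl i a)
    (fun U a => rfl))
    (fun U z => by
      refine fiberProd.ext ?_ ?_
      · refine Eq.trans ?_ (fst_sec_restrictObj (f i) (Z.obj hf k) U z).symm
        exact (Z.sec U i k z).trans (congrArg (fun t => ap t U z) (sec_ofSec (Z.isSec hf k)).symm)
      · exact ((isSec_sec (x i)).bar U z).trans (snd_sec_restrictObj (f i) (Z.obj hf k) U z).symm)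

theorem fst_comparison (hf : FamLift f) (k i : I) {U : T} (a : (x i).bf.Q.Sec U) :
    ap (fiberProd.fst (Z.obj hf k).bf.bar (ringMap (f i))) U (ap (Hom.f (Z.comparison hf k i)).φ U a) = ap (Z.incl i) U a := rfl

end Amalgam
end AlgButterfly
end Algebras
end Butterflies

namespace Butterflies
variable {T : Type u} [SmallCategory T] {J : GrothendieckTopology T}

/-! ### Effectivity of descent. -/

section Algebras
universe v' w' t
variable {A : RingSheaf J} {B : Under A}

section
variable {C : Over B} {I : Type t} {X : I → Over B}

/-- Triples of sections lift locally to a member of the family. -/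
def TripleLift (f : ∀ i, X i ⟶ C) : Prop := ∀ (U : T) (a b c : C.left.right.Sec U), Locally J U fun V h =>
  ∃ (i : I) (a' b' c' : (X i).left.right.Sec V), ap (ringMap (f i)) V a' = C.left.right.res h a ∧
    ap (ringMap (f i)) V b' = C.left.right.res h b ∧ ap (ringMap (f i)) V c' = C.left.right.res h c

theorem TripleLift.famLift {f : ∀ i, X i ⟶ C} (hf : TripleLift f) : AlgButterfly.FamLift f := fun U a b =>
  (hf U a b b).mono fun _ _ ⟨i, a', b', _, ha, hb, _⟩ => ⟨i, a', b', ha, hb⟩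

end

section
variable {F : Pseudofunctor (LocallyDiscrete (Over B)ᵒᵖ) Cat.{v', w'}} (r : Realization B F) {C : Over B}
  {I : Type u} {X : I → Over B} {f : ∀ i, X i ⟶ C} (D : F.DescentData f)

/-- The gluing of sheaves of rings defined by a descent datum. -/
def Realization.gluing (hf : TripleLift f) : RingGluing J I where
  ring i := r.El (D.obj i)
  Rel a b := r.Rel D a b
  refl := Realization.Rel.refl
  symm := Realization.Rel.symm
  trans := Realization.Rel.trans
  res h _ k := h.res k
  of_locally := Realization.Rel.of_locally
  zero _ _ _ := Realization.Rel.zero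
  one _ _ _ := Realization.Rel.one
  neg := Realization.Rel.neg
  add := Realization.Rel.add
  mul := Realization.Rel.mul
  nonempty U := (hf U 0 0 0).mono fun _ _ ⟨i, _⟩ => ⟨i⟩
  lift {i j k U} a b c := by
    refine (hf U (ap (ringMap (f i)) U (ap (r.bar _) U a)) (ap (ringMap (f j)) U (ap (r.bar _) U b))
      (ap (ringMap (f k)) U (ap (r.bar _) U c))).mono ?_
    rintro V h ⟨l, a', b', c', ha, hb, hc⟩
    -- The three sections are moved by lifting their images in C to a common member. A section with
    -- prescribed image there and related to the given one exists by `exists_rel`.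
    rw [← ap_res, ← ap_res] at ha hb hc
    obtain ⟨a'', ha'', -⟩ := Realization.exists_rel _ _ ha.symm
    obtain ⟨b'', hb'', -⟩ := Realization.exists_rel _ _ hb.symm
    obtain ⟨c'', hc'', -⟩ := Realization.exists_rel _ _ hc.symm
    exact ⟨l, a'', b'', c'', ha'', hb'', hc''⟩

end

variable {M : ModSheaf B.right} {ξ η : AlgTwoExt B M}

namespace AlgButterfly

section
variable {C D E : Over B} {p : E ⟶ C} {q : E ⟶ D} {X : AlgButterfly ξ η C} {Y : AlgButterfly ξ η D}
  (φ : restrictObj p X ⟶ restrictObj q Y) (U : T)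

theorem toR_fst_hom (c : (restrictObj p X).bf.Q.Sec U) : ap X.bf.toR U c.1.1 = ap Y.bf.toR U (ap (Hom.f φ).φ U c).1.1 :=
  ((Hom.f φ).ap_toR U c).symm

theorem toR'_fst_hom (c : (restrictObj p X).bf.Q.Sec U) : ap X.bf.toR' U c.1.1 = ap Y.bf.toR' U (ap (Hom.f φ).φ U c).1.1 :=
  ((Hom.f φ).ap_toR' U c).symm

theorem fst_hom_ι (n : ξ.ext.N.Sec U) : (ap (Hom.f φ).φ U ((restrictObj p X).bf.ι U n)).1.1 = Y.bf.ι U n :=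
  congrArg (fun t => t.1.1) ((Hom.f φ).φ_ι U n)

theorem fst_hom_κ (n : η.ext.N.Sec U) : (ap (Hom.f φ).φ U ((restrictObj p X).bf.κ U n)).1.1 = Y.bf.κ U n :=
  congrArg (fun t => t.1.1) ((Hom.f φ).φ_κ U n)

theorem fst_hom_sec (z : (SplitPair ξ η).Sec U) : (ap (Hom.f φ).φ U (ap (restrictObj p X).sec U z)).1.1 = ap Y.sec U z :=
  (congrArg (fun t => t.1.1) (Hom.ap_sec φ U z)).trans (fst_sec_restrictObj q Y U z)

end

variable {C : Over B} {I : Type u} {X : I → Over B} {f : ∀ i, X i ⟶ C} (D : (Isom ξ η).DescentData f)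

/-- The members of a descent datum. -/
abbrev descentObj (i : I) : AlgButterfly ξ η (X i) := D.obj i

/-- The descent isomorphisms of a descent datum. -/
abbrev descentMap (i j : I) : restrictObj (overFst (f i) (f j)) (descentObj D i) ⟶ restrictObj (overSnd (f i) (f j)) (descentObj D j) :=
  Realization.descentHom D i j

theorem rel_iff {i j : I} {U : T} {a : (descentObj D i).bf.Q.Sec U} {b : (descentObj D j).bf.Q.Sec U} :
    (isomRealization ξ η).Rel D a b ↔ ∃ c : (restrictObj (overFst (f i) (f j)) (descentObj D i)).bf.Q.Sec U,
      c.1.1 = a ∧ (ap (Hom.f (descentMap D i j)).φ U c).1.1 = b := Iff.rfl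

/-- The amalgam defined by a descent datum. -/
noncomputable def amalgam (hf : TripleLift f) : Amalgam f (descentObj D) where
  Q := ((isomRealization ξ η).gluing D hf).glued
  incl i := ((isomRealization ξ η).gluing D hf).incl i
  pairLift := ((isomRealization ξ η).gluing D hf).pairLift
  bar U i j a b h := Realization.Rel.bar (((isomRealization ξ η).gluing D hf).incl_eq_incl.1 h)
  exists_incl U i j a d h := by
    obtain ⟨b, hb, hb'⟩ := Realization.exists_rel (r := isomRealization ξ η) (D := D) a d h
    exact ⟨b, ((isomRealization ξ η).gluing D hf).incl_eq_incl.2 hb, hb'⟩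
  unique U i a b h h' := Realization.Rel.unique (r := isomRealization ξ η) (D := D) (Realization.Rel.refl (r := isomRealization ξ η) (D := D) a)
    (((isomRealization ξ η).gluing D hf).incl_eq_incl.1 h) h'
  toR U i j a b h := by
    obtain ⟨c, rfl, rfl⟩ := (rel_iff D).1 (((isomRealization ξ η).gluing D hf).incl_eq_incl.1 h)
    exact toR_fst_hom _ U c
  toR' U i j a b h := by
    obtain ⟨c, rfl, rfl⟩ := (rel_iff D).1 (((isomRealization ξ η).gluing D hf).incl_eq_incl.1 h)
    exact toR'_fst_hom _ U c
  ι U i j n := ((isomRealization ξ η).gluing D hf).incl_eq_incl.2 ((rel_iff D).2 ⟨_, rfl, fst_hom_ι (descentMap D i j) U n⟩)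
  κ U i j n := ((isomRealization ξ η).gluing D hf).incl_eq_incl.2 ((rel_iff D).2 ⟨_, rfl, fst_hom_κ (descentMap D i j) U n⟩)
  sec U i j z := ((isomRealization ξ η).gluing D hf).incl_eq_incl.2 ((rel_iff D).2
    ⟨_, fst_sec_restrictObj _ _ U z, fst_hom_sec (descentMap D i j) U z⟩)

/-- The chosen index only serves to define the maps from N and N' and the A-structure of the glued
butterfly. The comparison morphisms are automatically invertible, and they respect the descent data
because related sections become equal in the glued ring. -/
theorem exists_descent (hf : TripleLift f) [Nonempty I] : ∃ x : (Isom ξ η).obj (.mk (op C)),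
    Nonempty (D ≅ ((Isom ξ η).toDescentData f).obj x) := by
  obtain ⟨k⟩ := ‹Nonempty I›
  refine ⟨(amalgam D hf).obj hf.famLift k, ⟨Realization.descentIso (r := isomRealization ξ η) (fun h => hom_ext h)
    (fun i => (amalgam D hf).comparison hf.famLift k i) (fun i => isIso _) ?_⟩⟩
  intro i j U a b h
  refine ((amalgam D hf).fst_comparison hf.famLift k i a).trans (Eq.trans ?_ ((amalgam D hf).fst_comparison hf.famLift k j b).symm)
  exact ((isomRealization ξ η).gluing D hf).incl_eq_incl.2 h

/-- An empty family to which sections lift locally forces every object of the site to be covered by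
sieves without members, so any two sections of any sheaf of rings agree. Then C maps to the algebra
of the generic butterfly, which can be pulled back to C. -/
theorem exists_obj_of_isEmpty (hf : TripleLift f) [IsEmpty I] : Nonempty (AlgButterfly ξ η C) := by
  have hs (R : RingSheaf J) (U : T) (a b : R.Sec U) : a = b :=
    R.eq_of_locally ((hf U 0 0 0).mono fun _ _ ⟨i, _⟩ => isEmptyElim i)
  let φ : C.left.right ⟶ (genAlg ξ η C).left.right := mkHom (fun U =>
    { toFun := fun _ => 0
      map_one' := hs _ U _ _
      map_zero' := rfl
      map_add' := fun _ _ => hs _ U _ _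
      map_mul' := fun _ _ => hs _ U _ _ }) (fun _ _ => hs _ _ _ _)
  exact ⟨restrictObj (overHom φ (ringHom_ext fun U _ => hs _ U _ _) (ringHom_ext fun U _ => hs _ U _ _))
    (ofSec (isSec_genSec ξ η C))⟩

theorem toDescentData_essSurj (hf : TripleLift f) : ((Isom ξ η).toDescentData f).EssSurj where
  mem_essImage D := by
    rcases isEmpty_or_nonempty I with h | h
    · obtain ⟨x⟩ := exists_obj_of_isEmpty (ξ := ξ) (η := η) hf
      exact ⟨x, ⟨Pseudofunctor.DescentData.isoMk (fun i => isEmptyElim i) fun Y q i => isEmptyElim i⟩⟩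
    · obtain ⟨x, ⟨e⟩⟩ := exists_descent D hf
      exact ⟨x, ⟨e.symm⟩⟩

theorem toDescentData_isEquivalence (hf : TripleLift f) : ((Isom ξ η).toDescentData f).IsEquivalence := by
  obtain ⟨h⟩ := toDescentData_fullyFaithful (ξ := ξ) (η := η) hf.famLift
  exact { faithful := h.faithful, full := h.full, essSurj := toDescentData_essSurj hf }

end AlgButterfly

/-- The members of a sieve form a large class, but gluing sections by a quotient in `Type u` needs a
small index. One chosen lift for each finite set of sections over U and each member V → U of its
covering is enough, and these data are small because the site is. -/
theorem LocLift.exists_family {C : Over B} {S : Sieve C} (hS : LocLift S) : ∃ (I : Type u) (X : I → Over B) (f : ∀ i, X i ⟶ C),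
    TripleLift f ∧ (∀ i, S (f i)) ∧ LocLift (Sieve.generate (Presieve.ofArrows X f)) := by
  classical
  choose R hR D f hf H using hS
  let I : Type u := Σ (U : T) (Λ : Finset (C.left.right.Sec U)) (V : T), {h : V ⟶ U // R U Λ h}
  let g : ∀ i : I, D i.1 i.2.1 i.2.2.2.1 i.2.2.2.2 ⟶ C := fun i => f i.1 i.2.1 i.2.2.2.1 i.2.2.2.2
  refine ⟨I, _, g, fun U a b c => ⟨R U {a, b, c}, hR U _, fun V h hh => ?_⟩, fun i => hf _ _ _ _,
    fun U Λ => ⟨R U Λ, hR U Λ, fun V h hh => ⟨_, g ⟨U, Λ, V, h, hh⟩, ⟨_, 𝟙 _, _, Presieve.ofArrows.mk _, Category.id_comp _⟩, H U Λ h hh⟩⟩⟩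
  obtain ⟨a', ha⟩ := H U {a, b, c} h hh a (by simp)
  obtain ⟨b', hb⟩ := H U {a, b, c} h hh b (by simp)
  obtain ⟨c', hc⟩ := H U {a, b, c} h hh c (by simp)
  exact ⟨⟨U, {a, b, c}, V, h, hh⟩, a', b', c', ha, hb, hc⟩

/-- Descent is effective for the small family extracted from S. This family generates a covering
sieve contained in S, and for a prestack effectivity passes to the larger sieve. -/
theorem isom_isStack (ξ η : AlgTwoExt B M) : (Isom ξ η).IsStack (liftTopology B) := by
  have := isom_isPrestack ξ η
  refine Pseudofunctor.IsStack.of_isStackFor fun C S hS => ?_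
  obtain ⟨I, X, f, hf, hmem, hcov⟩ := LocLift.exists_family (C := C) (S := S) hS
  have h : (Isom ξ η).IsStackFor (Sieve.generate (Presieve.ofArrows X f)).arrows := by
    rw [Pseudofunctor.IsStackFor_generate_iff, Pseudofunctor.isStackFor_ofArrows_iff]
    exact AlgButterfly.toDescentData_isEquivalence hf
  exact Pseudofunctor.IsStackFor.of_le' _ h (J := liftTopology B) hcov ((Sieve.generate_le_iff _ _).2 (by
    rintro _ _ ⟨i⟩
    exact hmem i))

end Algebras
end Butterflies

namespace Butterflies
variable {T : Type u} [SmallCategory T] {J : GrothendieckTopology T}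

/-! ### The gerbe structure over the generated topology. -/

section Algebras
variable {A : RingSheaf J} {B : Under A} {M : ModSheaf B.right} (ξ η : AlgTwoExt B M)

/-- The map from the algebra of differences to C is locally surjective, and the isomorphism over
that algebra pulls back to every algebra mapping to it. -/
theorem AlgButterfly.locally_connected {C : Over B} (x y : AlgButterfly ξ η C) : ∃ S ∈ algTopology B C,
    ∀ ⦃D : Over B⦄ (f : D ⟶ C), S f → Nonempty ((restrict f).obj x ≅ (restrict f).obj y) := by
  refine ⟨_, generate_mem_algTopology (diffProj x y) (diffBar_locSurj x y), ?_⟩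
  rintro D _ ⟨E, a, b, hb, rfl⟩
  obtain ⟨⟩ := hb
  exact ⟨(restrictComp (diffProj x y) a).app x ≪≫ (restrict a).mapIso (@asIso _ _ _ _ (diffIso x y) (isIso _)) ≪≫
    ((restrictComp (diffProj x y) a).app y).symm⟩

theorem isom_isStack_algTopology : (Isom ξ η).IsStack (algTopology B) := by
  have := isom_isStack ξ η
  exact Pseudofunctor.IsStack.of_isStackFor fun C S hS =>
    (Isom ξ η).isStackFor' (J := liftTopology B) S (algTopology_le_liftTopology B C hS)

theorem isom_isGerbe : IsGerbe (algTopology B) (Isom ξ η) where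
  isStack := isom_isStack_algTopology ξ η
  isIso C _ _ f := AlgButterfly.isIso (C := C) (ξ := ξ) (η := η) f
  locally_nonempty C := AlgButterfly.locally_nonempty ξ η C
  locally_connected _ x y := AlgButterfly.locally_connected ξ η x y

theorem isom_isGerbeBandedBy : IsGerbeBandedBy (algTopology B) (Isom ξ η) (derPresheaf B M) where
  isGerbe := isom_isGerbe ξ η
  isSheaf := derPresheaf_isSheaf_algTopology B M
  banding := ⟨isomBanding ξ η⟩

end Algebras
end Butterflies

theorem proposition2 {T : Type u} [SmallCategory T] (J : GrothendieckTopology T) (A : RingSheaf J)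
    (B : Under A) (M : ModSheaf B.right) (ξ η : AlgTwoExt B M) :
    IsGerbeBandedBy (algTopology B) (Isom ξ η) (derPresheaf B M) ∧
    (∃ β : Banding (Isom ξ η) (derPresheaf B M),
      ∀ (C : Over B) (x : AlgButterfly ξ η C) (d : Der M C) (U : T) (q : x.bf.Q.Sec U),
        ap (AlgButterfly.Hom.f (X := x) (Y := x) (β.iso C x (.ofAdd d)).hom).φ U q =
          q + x.bf.κ U (η.ext.e U (d.1 U (ap (x.bf.ρ ≫ (ξ.ext.pullback (toBase C)).g) U q)))) ∧
    IsGerbeBandedBy (algTopology B) (Split ξ) (derPresheaf B M) := by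
  exact ⟨isom_isGerbeBandedBy ξ η, ⟨isomBanding ξ η, fun C x d U q => rfl⟩,
    isom_isGerbeBandedBy ξ (AlgTwoExt.trivial B M)⟩
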